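/- Conventions. For $n\ge 0$, $\Sigma_1(\mathbf R^n)$ is the Gelfand–Shilov space of all $f\in C^\infty(\mathbf R^n)$ such that $\|f\|_h=\sup_{\alpha,\beta,x}\frac{|x^\beta\partial^\alpha f(x)|}{h^{|\alpha+\beta|}\alpha!\,\beta!}<\infty$ for every $h>0$, with the topology defined by the norms $\|\cdot\|_h$, $h>0$; $\Sigma_1'(\mathbf R^n)$ is its dual, and $\Sigma_1\subseteq\Sigma_1'$ through $\langle f,\varphi\rangle=\int f\varphi\,dx$. For a linear bijection $T$ of $\mathbf R^n$ and $u\in\Sigma_1'(\mathbf R^n)$, the pullback is given by $\langle T^*u,\varphi\rangle=|\det T|^{-1}\langle u,\varphi\circ T^{-1}\rangle$, so that $T^*f=f\circ T$ for $f\in\Sigma_1$. A weight is a positive function $\omega$ with $\omega,1/\omega\in L^\infty_{loc}$; $\mathscr P_E(\mathbf R^n)$ is the set of moderate weights, i.e. the weights $\omega$ such that, for some weight $v$ and some constant $C$, $\omega(x+y)\le C\omega(x)v(y)$ for all $x,y$. A Young function is a convex $\Phi:[0,\infty]\to[0,\infty]$ with $\Phi(0)=0$ and $\lim_{t\to\infty}\Phi(t)=\Phi(\infty)=\infty$.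 For $\omega\in\mathscr P_E(\mathbf R^{2n})$, the Orlicz modulation space $M^\Phi_{(\omega)}(\mathbf R^n)$ is the set of all $u\in\Sigma_1'(\mathbf R^n)$ such that $$\|u\|_{M^\Phi_{(\omega)}}=\inf\Big\{\lambda>0:\iint_{\mathbf R^{2n}}\Phi\big(|V_\phi u(x,\xi)|\,\omega(x,\xi)/\lambda\big)\,dx\,d\xi\le 1\Big\}<\infty ,$$ with the topology given by this norm, where $V_\phi u(x,\xi)=(2\pi)^{-n/2}\langle u,\overline{\phi(\cdot-x)}e^{-i\langle\cdot,\xi\rangle}\rangle$ and $\phi(x)=\pi^{-n/4}e^{-|x|^2/2}$. Proposition. Let $A$ be a real $d\times d$ matrix with transpose $A^*$, let $T_A:\mathbf R^{2d}\to\mathbf R^{2d}$ be the linear bijection $T_A(x,y)=(x-A(x-y),\,y-A(x-y))$, let $\Phi$ be a Young function with $\Phi(t)<\infty$ for some $t>0$, and let $\omega_0,\omega_A\in\mathscr P_E(\mathbf R^{4d})$ satisfy $$\omega_A(x,y,\xi,\eta)=\omega_0\big(x-A(x-y),\,y-A(x-y),\,\xi+A^*(\xi+\eta),\,\eta-A^*(\xi+\eta)\big),\qquad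 x,y,\xi,\eta\in\mathbf R^d .$$ Then $\Sigma_1(\mathbf R^{2d})$ is contained in $M^\Phi_{(\omega_0)}(\mathbf R^{2d})$ and in $M^\Phi_{(\omega_A)}(\mathbf R^{2d})$, and $T_A^*$ on $\Sigma_1(\mathbf R^{2d})$ extends to a linear homeomorphism from $M^\Phi_{(\omega_0)}(\mathbf R^{2d})$ onto $M^\Phi_{(\omega_A)}(\mathbf R^{2d})$, namely the restriction of the distributional pullback $T_A^*$. This extension is continuous with respect to the weak-$*$ topologies inherited from $\Sigma_1'(\mathbf R^{2d})$, and it is the only map from $M^\Phi_{(\omega_0)}(\mathbf R^{2d})$ to $M^\Phi_{(\omega_A)}(\mathbf R^{2d})$ with this continuity that extends $T_A^*$ on $\Sigma_1(\mathbf R^{2d})$. If moreover $\Phi(t)>0$ for every $t>0$ and there are $r>0$ and $C>0$ with $\Phi(2t)\le C\Phi(t)$ for $0\le t\le r$, then it is also the only norm-continuous map that extends $T_A^*$ on $\Sigma_1(\mathbf R^{2d})$. -/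

import Mathlib

noncomputable section

namespace OrliczModulation

open MeasureTheory Set Filter Topology
open scoped ENNReal NNReal

/-! ### The Gelfand–Shilov space `Σ₁` (Beurling type) and its dual -/

section GelfandShilov

open scoped ContDiff

variable {ι : Type*} [Fintype ι]

/-- `f` is smooth and, for every `h > 0`, the quantities `|x|^k |D^m f(x)| / (h^(k+m) k! m!)` are
bounded uniformly in `k`, `m`, `x`. Since `h > 0` is arbitrary, using the norms of `x` and of the
`m`-th Fréchet derivative is the same as using all monomials `x^β`, all partial derivatives `∂^α`
and the factorials `α! β!` : the two differ by factors `c^(k+m)`. -/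
def IsGelfandShilov (f : EuclideanSpace ℝ ι → ℂ) : Prop :=
  ContDiff ℝ ∞ f ∧ ∀ h : ℝ, 0 < h → ∃ C : ℝ, ∀ (k m : ℕ) (x : EuclideanSpace ℝ ι),
    ‖x‖ ^ k * ‖iteratedFDeriv ℝ m f x‖ / (h ^ (k + m) * (k.factorial * m.factorial)) ≤ C

variable (ι) in
/-- The functions in `Σ₁(ℝ^ι)`, as a linear space. -/
def gelfandShilovSubmodule : Submodule ℂ (EuclideanSpace ℝ ι → ℂ) where
  carrier := {f | IsGelfandShilov f}
  zero_mem' := by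
    refine ⟨contDiff_const, fun h _ => ⟨0, fun k m x => ?_⟩⟩
    have : (0 : EuclideanSpace ℝ ι → ℂ) = fun _ => 0 := rfl
    simp [this]
  add_mem' := by
    rintro f g ⟨hf, hf'⟩ ⟨hg, hg'⟩
    refine ⟨hf.add hg, fun h hh => ?_⟩
    obtain ⟨C, hC⟩ := hf' h hh
    obtain ⟨D, hD⟩ := hg' h hh
    refine ⟨C + D, fun k m x => ?_⟩
    refine le_trans ?_ (add_le_add (hC k m x) (hD k m x))
    rw [← add_div, ← mul_add, iteratedFDeriv_add_apply
      (hf.of_le (mod_cast le_top)).contDiffAt (hg.of_le (mod_cast le_top)).contDiffAt]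
    gcongr
    exact norm_add_le _ _
  smul_mem' := by
    rintro c f ⟨hf, hf'⟩
    refine ⟨hf.const_smul c, fun h hh => ?_⟩
    obtain ⟨C, hC⟩ := hf' h hh
    refine ⟨‖c‖ * C, fun k m x => ?_⟩
    refine le_trans (le_of_eq ?_) (mul_le_mul_of_nonneg_left (hC k m x) (norm_nonneg c))
    rw [iteratedFDeriv_const_smul_apply (hf.of_le (mod_cast le_top)).contDiffAt, norm_smul]
    ring

variable (ι) in
/-- The Gelfand–Shilov space `Σ₁(ℝ^ι)`. -/
def GelfandShilov : Type _ := gelfandShilovSubmodule ι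

namespace GelfandShilov

instance : AddCommGroup (GelfandShilov ι) := inferInstanceAs (AddCommGroup (gelfandShilovSubmodule ι))

instance : Module ℂ (GelfandShilov ι) := inferInstanceAs (Module ℂ (gelfandShilovSubmodule ι))

instance : CoeFun (GelfandShilov ι) fun _ => EuclideanSpace ℝ ι → ℂ := ⟨fun f => f.1⟩

theorem contDiff (f : GelfandShilov ι) : ContDiff ℝ ∞ f := f.2.1

theorem contDiffAt (f : GelfandShilov ι) (m : ℕ) (x : EuclideanSpace ℝ ι) :
    ContDiffAt ℝ m f x := (f.contDiff.of_le (mod_cast le_top)).contDiffAt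

/-- The norm `sup |x|^k |D^m f(x)| / (h^(k+m) k! m!)`. -/
def gsNorm (h : ℝ) (f : GelfandShilov ι) : ℝ :=
  ⨆ p : ℕ × ℕ × EuclideanSpace ℝ ι,
    ‖p.2.2‖ ^ p.1 * ‖iteratedFDeriv ℝ p.2.1 f p.2.2‖ / (h ^ (p.1 + p.2.1) * (p.1.factorial * p.2.1.factorial))

theorem le_gsNorm {h : ℝ} (hh : 0 < h) (f : GelfandShilov ι) (k m : ℕ)
    (x : EuclideanSpace ℝ ι) :
    ‖x‖ ^ k * ‖iteratedFDeriv ℝ m f x‖ / (h ^ (k + m) * (k.factorial * m.factorial)) ≤ gsNorm h f := by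
  obtain ⟨C, hC⟩ := f.2.2 h hh
  exact le_ciSup (f := fun p : ℕ × ℕ × EuclideanSpace ℝ ι =>
    ‖p.2.2‖ ^ p.1 * ‖iteratedFDeriv ℝ p.2.1 f p.2.2‖ / (h ^ (p.1 + p.2.1) * (p.1.factorial * p.2.1.factorial)))
    ⟨C, by rintro _ ⟨p, rfl⟩; exact hC _ _ _⟩ (k, m, x)

theorem gsNorm_le {h C : ℝ} (f : GelfandShilov ι)
    (hC : ∀ (k m : ℕ) (x : EuclideanSpace ℝ ι),
      ‖x‖ ^ k * ‖iteratedFDeriv ℝ m f x‖ / (h ^ (k + m) * (k.factorial * m.factorial)) ≤ C) :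
    gsNorm h f ≤ C :=
  ciSup_le fun p => hC p.1 p.2.1 p.2.2

theorem coe_add (f g : GelfandShilov ι) : ((f + g : GelfandShilov ι).1) = f.1 + g.1 := rfl

theorem coe_smul (c : ℂ) (f : GelfandShilov ι) : ((c • f : GelfandShilov ι).1) = c • f.1 := rfl

/-- The norms `gsNorm h`, `h > 0`, as a family of seminorms. -/
def gsSeminorm (h : {h : ℝ // 0 < h}) : Seminorm ℂ (GelfandShilov ι) :=
  Seminorm.ofSMulLE (gsNorm h.1)
    (by
      refine le_antisymm (gsNorm_le _ fun k m x => le_of_eq ?_)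
        (le_trans (by have := h.2; positivity) (le_gsNorm h.2 0 0 0 0))
      have : ((0 : GelfandShilov ι).1) = fun _ => 0 := rfl
      simp [this])
    (fun f g => gsNorm_le _ fun k m x => by
      refine le_trans ?_ (add_le_add (le_gsNorm h.2 f k m x) (le_gsNorm h.2 g k m x))
      have := h.2
      rw [← add_div, ← mul_add, coe_add,
        iteratedFDeriv_add_apply (f.contDiffAt m x) (g.contDiffAt m x)]
      gcongr
      exact norm_add_le _ _)
    (fun c f => gsNorm_le _ fun k m x => by
      refine le_trans (le_of_eq ?_)
        (mul_le_mul_of_nonneg_left (le_gsNorm h.2 f k m x) (norm_nonneg c))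
      rw [coe_smul, iteratedFDeriv_const_smul_apply (f.contDiffAt m x), norm_smul]
      ring)

theorem gsSeminorm_apply (h : {h : ℝ // 0 < h}) (f : GelfandShilov ι) :
    gsSeminorm h f = gsNorm h.1 f := rfl

variable (ι) in
/-- The family of seminorms that defines the topology of `Σ₁(ℝ^ι)`. -/
def gsFamily : SeminormFamily ℂ (GelfandShilov ι) {h : ℝ // 0 < h} := gsSeminorm

/-- The projective limit topology with respect to `h > 0`. -/
instance : TopologicalSpace (GelfandShilov ι) := (gsFamily ι).moduleFilterBasis.topology'

theorem withSeminorms : WithSeminorms (gsFamily ι) := ⟨rfl⟩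

instance : IsTopologicalAddGroup (GelfandShilov ι) := withSeminorms.topologicalAddGroup

instance : ContinuousSMul ℂ (GelfandShilov ι) := withSeminorms.continuousSMul

theorem norm_le_gsNorm_one (f : GelfandShilov ι) (x : EuclideanSpace ℝ ι) :
    ‖f x‖ ≤ gsNorm 1 f := by
  simpa using le_gsNorm one_pos f 0 0 x

theorem integrable (f : GelfandShilov ι) : Integrable (f : EuclideanSpace ℝ ι → ℂ) := by
  let g : SchwartzMap (EuclideanSpace ℝ ι) ℂ :=
    { toFun := f
      smooth' := f.contDiff
      decay' := fun k m => ⟨gsNorm 1 f * (k.factorial * m.factorial), fun x => by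
        have := le_gsNorm one_pos f k m x
        rwa [one_pow, one_mul, div_le_iff₀ (by positivity)] at this⟩ }
  exact g.integrable

theorem exists_gsNorm_comp_le (L : EuclideanSpace ℝ ι ≃L[ℝ] EuclideanSpace ℝ ι) (h : ℝ)
    (hh : 0 < h) : ∃ h' : ℝ, 0 < h' ∧ ∀ (f : GelfandShilov ι) (k m : ℕ)
      (x : EuclideanSpace ℝ ι), ‖x‖ ^ k * ‖iteratedFDeriv ℝ m (fun y => f (L y)) x‖ /
        (h ^ (k + m) * (k.factorial * m.factorial)) ≤ gsNorm h' f := by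
  set c : ℝ := ‖(L : EuclideanSpace ℝ ι →L[ℝ] EuclideanSpace ℝ ι)‖ +
    ‖(L.symm : EuclideanSpace ℝ ι →L[ℝ] EuclideanSpace ℝ ι)‖ + 1 with hc
  have hc0 : 0 < c := by positivity
  refine ⟨h / c, by positivity, fun f k m x => ?_⟩
  refine le_trans ?_ (le_gsNorm (h := h / c) (by positivity) f k m (L x))
  have h1 : ‖x‖ ≤ c * ‖L x‖ := by
    have := (L.symm : EuclideanSpace ℝ ι →L[ℝ] EuclideanSpace ℝ ι).le_opNorm (L x)
    simp only [ContinuousLinearEquiv.coe_coe, ContinuousLinearEquiv.symm_apply_apply] at this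
    refine this.trans ?_
    gcongr
    rw [hc]; linarith [norm_nonneg (L : EuclideanSpace ℝ ι →L[ℝ] EuclideanSpace ℝ ι)]
  have h2 : ‖iteratedFDeriv ℝ m (fun y => f (L y)) x‖ ≤
      c ^ m * ‖iteratedFDeriv ℝ m f (L x)‖ := by
    have := ContinuousLinearMap.iteratedFDeriv_comp_right
      (L : EuclideanSpace ℝ ι →L[ℝ] EuclideanSpace ℝ ι)
      (f.contDiff.of_le (mod_cast le_top) : ContDiff ℝ m f) x (le_refl (m : WithTop ℕ∞))
    have e : (fun y => f (L y)) =
      f ∘ (L : EuclideanSpace ℝ ι →L[ℝ] EuclideanSpace ℝ ι) := rfl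
    rw [e, this]
    refine (ContinuousMultilinearMap.norm_compContinuousLinearMap_le _ _).trans ?_
    rw [mul_comm]
    simp only [Finset.prod_const, Finset.card_univ, Fintype.card_fin]
    gcongr
    · rw [hc]; linarith [norm_nonneg (L.symm : EuclideanSpace ℝ ι →L[ℝ] EuclideanSpace ℝ ι)]
    · exact le_rfl
  calc _ ≤ (c * ‖L x‖) ^ k * (c ^ m * ‖iteratedFDeriv ℝ m f (L x)‖) /
        (h ^ (k + m) * (k.factorial * m.factorial)) := by gcongr
    _ = _ := by
      rw [div_pow, mul_pow, pow_add c k m]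
      field_simp

/-- The pullback `f ↦ f ∘ L` on `Σ₁` by a linear bijection `L`, as a linear map. -/
def compLinear (L : EuclideanSpace ℝ ι ≃L[ℝ] EuclideanSpace ℝ ι) :
    GelfandShilov ι →ₗ[ℂ] GelfandShilov ι where
  toFun f := ⟨fun y => f (L y), f.contDiff.comp L.contDiff, fun h hh =>
    let ⟨h', H⟩ := exists_gsNorm_comp_le L h hh
    ⟨gsNorm h' f, H.2 f⟩⟩
  map_add' _ _ := rfl
  map_smul' _ _ := rfl

/-- The pullback `f ↦ f ∘ L` on `Σ₁` by a linear bijection `L`. -/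
def compLin (L : EuclideanSpace ℝ ι ≃L[ℝ] EuclideanSpace ℝ ι) :
    GelfandShilov ι →L[ℂ] GelfandShilov ι where
  toLinearMap := compLinear L
  cont := by
    refine WithSeminorms.continuous_of_isBounded withSeminorms withSeminorms
      (compLinear L) fun h => ?_
    obtain ⟨h', hh', H⟩ := exists_gsNorm_comp_le L h.1 h.2
    refine ⟨{⟨h', hh'⟩}, 1, fun f => ?_⟩
    simp only [Finset.sup_singleton, one_smul]
    exact gsNorm_le _ (H f)

theorem compLin_apply (L : EuclideanSpace ℝ ι ≃L[ℝ] EuclideanSpace ℝ ι) (f : GelfandShilov ι)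
    (x : EuclideanSpace ℝ ι) : compLin L f x = f (L x) := rfl

end GelfandShilov

variable (ι) in
/-- The distribution space `Σ₁'(ℝ^ι)`. -/
abbrev GSDistribution : Type _ := GelfandShilov ι →L[ℂ] ℂ

namespace GSDistribution

theorem integrable_mul (f φ : GelfandShilov ι) : Integrable fun x => f x * φ x :=
  f.integrable.mul_bdd (c := GelfandShilov.gsNorm 1 φ) φ.contDiff.continuous.aestronglyMeasurable
    (Eventually.of_forall φ.norm_le_gsNorm_one)

/-- The linear form `φ ↦ ∫ f(x) φ(x) dx` on `Σ₁`. -/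
def ofGSLinear (f : GelfandShilov ι) : GelfandShilov ι →ₗ[ℂ] ℂ where
  toFun φ := ∫ x, f x * φ x
  map_add' φ ψ := by
    rw [← integral_add (integrable_mul f φ) (integrable_mul f ψ)]
    exact integral_congr_ae (Eventually.of_forall fun x => mul_add _ _ _)
  map_smul' c φ := by
    rw [RingHom.id_apply, smul_eq_mul, ← integral_const_mul]
    exact integral_congr_ae (Eventually.of_forall fun x => mul_left_comm _ _ _)

/-- The distribution `φ ↦ ∫ f(x) φ(x) dx` given by `f ∈ Σ₁`. -/
def ofGS (f : GelfandShilov ι) : GSDistribution ι where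
  toLinearMap := ofGSLinear f
  cont := by
    refine GelfandShilov.withSeminorms.continuous_normedSpace_rng ℂ (ofGSLinear f) ?_
    refine ⟨{⟨1, one_pos⟩}, ⟨∫ x, ‖f x‖, by positivity⟩, fun φ => ?_⟩
    simp only [Finset.sup_singleton]
    change ‖∫ x, f x * φ x‖ ≤ (∫ x, ‖f x‖) * GelfandShilov.gsNorm 1 φ
    rw [← integral_mul_const]
    refine norm_integral_le_of_norm_le (f.integrable.norm.mul_const _)
      (Eventually.of_forall fun x => ?_)
    rw [norm_mul]
    gcongr
    exact φ.norm_le_gsNorm_one x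

theorem ofGS_apply (f φ : GelfandShilov ι) : ofGS f φ = ∫ x, f x * φ x := rfl

/-- The pullback `⟨L^* u, φ⟩ = |det L|⁻¹ ⟨u, φ ∘ L⁻¹⟩`. -/
def pullback (L : EuclideanSpace ℝ ι ≃L[ℝ] EuclideanSpace ℝ ι) (u : GSDistribution ι) :
    GSDistribution ι :=
  ((|(L : EuclideanSpace ℝ ι →L[ℝ] EuclideanSpace ℝ ι).det|⁻¹ : ℝ) : ℂ) •
    u.comp (GelfandShilov.compLin L.symm)

end GSDistribution

/-! ### Gaussian wave packets and the short-time Fourier transform -/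

/-- Cauchy estimates for `t ↦ exp(-(t-a)²/2 - i b t)`. -/
theorem norm_iteratedDeriv_gauss_le (a b R : ℝ) (hR : 0 < R) : ∃ C : ℝ, 0 ≤ C ∧
    ∀ (m : ℕ) (t : ℝ),
    ‖iteratedDeriv m (fun t : ℝ => Complex.exp (-((t : ℂ) - a) ^ 2 / 2 - Complex.I * (t * b))) t‖ ≤
      C * (m.factorial / R ^ m) * Real.exp (-R * |t|) := by
  set G : ℂ → ℂ := fun z => Complex.exp (-(z - a) ^ 2 / 2 - Complex.I * (z * b)) with hG
  have hGd : ContDiff ℂ ∞ G := by fun_prop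
  have hre : ∀ m : ℕ, iteratedDeriv m (fun t : ℝ => G t) = fun t : ℝ => iteratedDeriv m G t := by
    intro m
    induction m with
    | zero => simp
    | succ m ih =>
      rw [iteratedDeriv_succ, ih]
      funext t
      rw [iteratedDeriv_succ]
      have : DifferentiableAt ℂ (iteratedDeriv m G) (t : ℂ) :=
        (hGd.differentiable_iteratedDeriv m (mod_cast ENat.natCast_lt_top m)) _
      exact this.hasDerivAt.comp_ofReal.deriv
  refine ⟨Real.exp (R * |a| + 2 * R ^ 2 + R * |b|), (Real.exp_pos _).le, fun m t => ?_⟩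
  have hbound : ∀ z ∈ Metric.sphere (t : ℂ) R,
      ‖G z‖ ≤ Real.exp (R * |a| + 2 * R ^ 2 + R * |b|) * Real.exp (-R * |t|) := by
    intro z hz
    rw [mem_sphere_iff_norm] at hz
    have h1 : |z.re - t| ≤ R := by
      have := Complex.abs_re_le_norm (z - t); rw [hz] at this; simpa using this
    have h2 : |z.im| ≤ R := by
      have := Complex.abs_im_le_norm (z - t); rw [hz] at this; simpa using this
    rw [hG, Complex.norm_exp, ← Real.exp_add, Real.exp_le_exp]
    have e : (-(z - a) ^ 2 / 2 - Complex.I * (z * b)).re =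
        -((z.re - a) ^ 2 - z.im ^ 2) / 2 + z.im * b := by
      simp [pow_two]
    rw [e]
    have h3 : z.im ^ 2 ≤ R ^ 2 := sq_le_sq' (by linarith [(abs_le.1 h2).1]) (abs_le.1 h2).2
    have h4 : z.im * b ≤ R * |b| := by
      calc z.im * b ≤ |z.im * b| := le_abs_self _
        _ = |z.im| * |b| := abs_mul _ _
        _ ≤ R * |b| := by gcongr
    have h5 : |t| ≤ |z.re - a| + |a| + R := by
      have : t = (z.re - a) + a - (z.re - t) := by ring
      calc |t| = |(z.re - a) + a - (z.re - t)| := by rw [← this]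
        _ ≤ |(z.re - a) + a| + |z.re - t| := abs_sub _ _
        _ ≤ |z.re - a| + |a| + R := by gcongr; exact abs_add_le _ _
    have h6 : 2 * R * |z.re - a| ≤ (z.re - a) ^ 2 + R ^ 2 := by
      nlinarith [sq_nonneg (|z.re - a| - R), sq_abs (z.re - a)]
    nlinarith
  change ‖iteratedDeriv m (fun t : ℝ => G t) t‖ ≤ _
  rw [hre]
  have := Complex.norm_iteratedDeriv_le_of_forall_mem_sphere_norm_le m hR
    (hGd.differentiable (by simp)).diffContOnCl hbound
  refine this.trans (le_of_eq ?_)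
  ring

theorem norm_iteratedFDeriv_coord_le (a b R : ℝ) (hR : 0 < R) (j : ι) : ∃ C : ℝ, 0 ≤ C ∧
    ∀ (m : ℕ) (y : EuclideanSpace ℝ ι), ‖iteratedFDeriv ℝ m (fun y : EuclideanSpace ℝ ι =>
      Complex.exp (-((y j : ℂ) - a) ^ 2 / 2 - Complex.I * (y j * b))) y‖ ≤
        C * (m.factorial / R ^ m) * Real.exp (-R * |y j|) := by
  obtain ⟨C, hC0, hC⟩ := norm_iteratedDeriv_gauss_le a b R hR
  refine ⟨C, hC0, fun m y => le_trans ?_ (hC m (y j))⟩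
  set g : ℝ → ℂ := fun t => Complex.exp (-((t : ℂ) - a) ^ 2 / 2 - Complex.I * (t * b)) with hg
  have hgd : ContDiff ℝ m g := by
    have : ContDiff ℝ m (fun t : ℝ => (t : ℂ)) := Complex.ofRealCLM.contDiff
    fun_prop
  set P : EuclideanSpace ℝ ι →L[ℝ] ℝ := EuclideanSpace.proj j with hP
  have e : (fun y : EuclideanSpace ℝ ι =>
      Complex.exp (-((y j : ℂ) - a) ^ 2 / 2 - Complex.I * (y j * b))) = g ∘ P := rfl
  have hPn : ‖P‖ ≤ 1 := by
    refine P.opNorm_le_bound zero_le_one fun x => ?_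
    rw [one_mul]
    exact PiLp.norm_apply_le x j
  rw [e, P.iteratedFDeriv_comp_right hgd y le_rfl, ← norm_iteratedFDeriv_eq_norm_iteratedDeriv]
  refine (ContinuousMultilinearMap.norm_compContinuousLinearMap_le _ _).trans ?_
  refine mul_le_of_le_one_right (norm_nonneg _) ?_
  simpa using pow_le_one₀ (norm_nonneg P) hPn

theorem norm_iteratedFDeriv_prod_coord_le (a b : ι → ℝ) (S : Finset ι) :
    ∀ R : ℝ, 0 < R → ∃ C : ℝ, 0 ≤ C ∧
    ∀ (m : ℕ) (y : EuclideanSpace ℝ ι), ‖iteratedFDeriv ℝ m (fun y : EuclideanSpace ℝ ι =>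
      ∏ j ∈ S, Complex.exp (-((y j : ℂ) - a j) ^ 2 / 2 - Complex.I * (y j * b j))) y‖ ≤
        C * (m.factorial / R ^ m) * Real.exp (-R * ∑ j ∈ S, |y j|) := by
  classical
  induction S using Finset.induction_on with
  | empty =>
    intro R hR
    refine ⟨1, zero_le_one, fun m y => ?_⟩
    rcases m with _ | m
    · simp
    · simp only [Finset.prod_empty]
      rw [iteratedFDeriv_const_of_ne (by simp)]
      simp only [Pi.zero_apply, norm_zero]
      positivity
  | insert i S hi ih =>
    intro R hR
    obtain ⟨C, hC0, hC⟩ := norm_iteratedFDeriv_coord_le (a i) (b i) (2 * R) (by positivity) i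
    obtain ⟨D, hD0, hD⟩ := ih (2 * R) (by positivity)
    refine ⟨C * D, by positivity, fun m y => ?_⟩
    simp only [Finset.prod_insert hi, Finset.sum_insert hi]
    have hsm : ∀ j : ι, ContDiff ℝ m (fun y : EuclideanSpace ℝ ι =>
        Complex.exp (-((y j : ℂ) - a j) ^ 2 / 2 - Complex.I * (y j * b j))) := by
      intro j
      have : ContDiff ℝ m (fun y : EuclideanSpace ℝ ι => (y j : ℂ)) :=
        Complex.ofRealCLM.contDiff.comp (EuclideanSpace.proj (𝕜 := ℝ) j).contDiff
      fun_prop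
    refine (norm_iteratedFDeriv_mul_le (N := m) (hsm i) (contDiff_prod fun j _ => hsm j) y
      le_rfl).trans ?_
    have hterm : ∀ k ∈ Finset.range (m + 1), (m.choose k : ℝ) *
        ‖iteratedFDeriv ℝ k (fun y : EuclideanSpace ℝ ι =>
          Complex.exp (-((y i : ℂ) - a i) ^ 2 / 2 - Complex.I * (y i * b i))) y‖ *
        ‖iteratedFDeriv ℝ (m - k) (fun y : EuclideanSpace ℝ ι => ∏ j ∈ S,
          Complex.exp (-((y j : ℂ) - a j) ^ 2 / 2 - Complex.I * (y j * b j))) y‖ ≤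
        C * D * (m.factorial / (2 * R) ^ m) *
          Real.exp (-(2 * R) * (|y i| + ∑ j ∈ S, |y j|)) := by
      intro k hk
      have hkm : k ≤ m := Nat.lt_succ_iff.1 (Finset.mem_range.1 hk)
      calc _ ≤ (m.choose k : ℝ) * (C * (k.factorial / (2 * R) ^ k) *
            Real.exp (-(2 * R) * |y i|)) * (D * ((m - k).factorial / (2 * R) ^ (m - k)) *
            Real.exp (-(2 * R) * ∑ j ∈ S, |y j|)) := by
            gcongr
            · exact hC k y
            · exact hD (m - k) y
        _ = C * D * ((m.choose k * k.factorial * (m - k).factorial : ℕ) /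
            ((2 * R) ^ k * (2 * R) ^ (m - k))) * (Real.exp (-(2 * R) * |y i|) *
            Real.exp (-(2 * R) * ∑ j ∈ S, |y j|)) := by
            push_cast
            field_simp
        _ = _ := by
            rw [Nat.choose_mul_factorial_mul_factorial hkm, ← pow_add, ← Real.exp_add,
              Nat.add_sub_cancel' hkm, mul_add]
    refine (Finset.sum_le_card_nsmul _ _ _ hterm).trans ?_
    rw [Finset.card_range, nsmul_eq_mul]
    have h2 : ((m + 1 : ℕ) : ℝ) ≤ 2 ^ m := by
      exact_mod_cast Nat.lt_two_pow_self
    have h0 : 0 ≤ |y i| + ∑ j ∈ S, |y j| := by positivity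
    have h3 : Real.exp (-(2 * R) * (|y i| + ∑ j ∈ S, |y j|)) ≤
        Real.exp (-R * (|y i| + ∑ j ∈ S, |y j|)) := by
      rw [Real.exp_le_exp]; nlinarith
    calc _ ≤ (2 : ℝ) ^ m * (C * D * (m.factorial / (2 * R) ^ m) *
          Real.exp (-R * (|y i| + ∑ j ∈ S, |y j|))) := by gcongr
      _ = _ := by
        rw [mul_pow]
        field_simp

/-- The Gaussian window `π^(-n/4) exp(-|x|²/2)` on `ℝ^ι`, `n = |ι|`. -/
def gaussianWindow (x : EuclideanSpace ℝ ι) : ℝ :=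
  Real.pi ^ (-(Fintype.card ι : ℝ) / 4) * Real.exp (-‖x‖ ^ 2 / 2)

theorem isGelfandShilov_gaussianPacket (x ξ : EuclideanSpace ℝ ι) :
    IsGelfandShilov fun y : EuclideanSpace ℝ ι =>
      (gaussianWindow (y - x) : ℂ) * Complex.exp (-Complex.I * (inner ℝ y ξ : ℝ)) := by
  set c : ℂ := ((Real.pi ^ (-(Fintype.card ι : ℝ) / 4) : ℝ) : ℂ) with hc
  have e : (fun y : EuclideanSpace ℝ ι =>
      (gaussianWindow (y - x) : ℂ) * Complex.exp (-Complex.I * (inner ℝ y ξ : ℝ))) =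
      c • fun y : EuclideanSpace ℝ ι => ∏ j,
        Complex.exp (-((y j : ℂ) - x j) ^ 2 / 2 - Complex.I * (y j * ξ j)) := by
    funext y
    rw [Pi.smul_apply, ← Complex.exp_sum, smul_eq_mul, gaussianWindow, Complex.ofReal_mul, ← hc,
      mul_assoc, Complex.ofReal_exp, ← Complex.exp_add, EuclideanSpace.norm_sq_eq]
    congr 2
    simp only [PiLp.inner_apply, Finset.sum_sub_distrib, neg_div, Finset.sum_neg_distrib]
    push_cast
    rw [Finset.sum_div, ← Finset.mul_sum, neg_mul]
    have e1 : ∑ j, ((‖(y - x) j‖ : ℝ) : ℂ) ^ 2 / 2 = ∑ j, ((y j : ℂ) - x j) ^ 2 / 2 := by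
      refine Finset.sum_congr rfl fun j _ => ?_
      rw [← Complex.ofReal_pow, Real.norm_eq_abs, sq_abs]
      simp
    have e2 : ∑ j, ((inner ℝ (y j) (ξ j) : ℝ) : ℂ) = ∑ j, (y j : ℂ) * ξ j := by
      refine Finset.sum_congr rfl fun j _ => ?_
      simp [mul_comm]
    rw [e1, e2, sub_eq_add_neg]
  rw [e]
  refine (gelfandShilovSubmodule ι).smul_mem c ⟨?_, fun h hh => ?_⟩
  · refine contDiff_prod fun j _ => ?_
    have : ContDiff ℝ ∞ (fun y : EuclideanSpace ℝ ι => (y j : ℂ)) :=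
      Complex.ofRealCLM.contDiff.comp (EuclideanSpace.proj (𝕜 := ℝ) j).contDiff
    fun_prop
  · obtain ⟨C, hC0, hC⟩ := norm_iteratedFDeriv_prod_coord_le (fun j => x j) (fun j => ξ j)
      Finset.univ h⁻¹ (by positivity)
    refine ⟨C, fun k m y => ?_⟩
    have hy : ‖y‖ ≤ ∑ j, |y j| := by
      have h1 : y = ∑ j, y j • EuclideanSpace.basisFun ι ℝ j := by
        simpa using ((EuclideanSpace.basisFun ι ℝ).sum_repr y).symm
      calc ‖y‖ = ‖∑ j, y j • EuclideanSpace.basisFun ι ℝ j‖ := by rw [← h1]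
        _ ≤ ∑ j, ‖y j • EuclideanSpace.basisFun ι ℝ j‖ := norm_sum_le _ _
        _ = ∑ j, |y j| := by simp [norm_smul]
    have hk : ‖y‖ ^ k ≤ h ^ k * k.factorial * Real.exp (h⁻¹ * ∑ j, |y j|) := by
      have := Real.pow_div_factorial_le_exp (h⁻¹ * ∑ j, |y j|) (by positivity) k
      rw [div_le_iff₀ (by positivity), mul_pow, inv_pow, inv_mul_le_iff₀ (by positivity)] at this
      refine (pow_le_pow_left₀ (norm_nonneg y) hy k).trans (this.trans (le_of_eq ?_))
      ring
    rw [div_le_iff₀ (by positivity)]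
    calc _ ≤ (h ^ k * k.factorial * Real.exp (h⁻¹ * ∑ j, |y j|)) *
          (C * (m.factorial / h⁻¹ ^ m) * Real.exp (-h⁻¹ * ∑ j, |y j|)) := by
          gcongr
          exact hC m y
      _ = C * (h ^ k * k.factorial * (m.factorial * h ^ m)) *
          (Real.exp (h⁻¹ * ∑ j, |y j|) * Real.exp (-h⁻¹ * ∑ j, |y j|)) := by
          rw [inv_pow, div_inv_eq_mul]
          ring
      _ = _ := by
          rw [← Real.exp_add, neg_mul, add_neg_cancel, Real.exp_zero, pow_add]
          ring

/-- The test function `y ↦ conj(φ(y - x)) e^{-i⟨y,ξ⟩}`, where `φ` is the (real) Gaussian window. -/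
def gaussianPacket (x ξ : EuclideanSpace ℝ ι) : GelfandShilov ι :=
  ⟨_, isGelfandShilov_gaussianPacket x ξ⟩

/-- The short-time Fourier transform
`V_φ u (x, ξ) = (2π)^(-n/2) ⟨u, conj(φ(· - x)) e^{-i⟨·,ξ⟩}⟩` with the Gaussian window `φ`. -/
def stft (u : GSDistribution ι) (z : EuclideanSpace ℝ ι × EuclideanSpace ℝ ι) : ℂ :=
  (((2 * Real.pi) ^ (-(Fintype.card ι : ℝ) / 2) : ℝ) : ℂ) * u (gaussianPacket z.1 z.2)

end GelfandShilov

/-! ### Young functions and moderate weights -/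

/-- A Young function `Φ : [0, ∞] → [0, ∞]`. -/
structure YoungFunction where
  toFun : ℝ≥0∞ → ℝ≥0∞
  convex' : ConvexOn ℝ≥0 univ toFun
  map_zero' : toFun 0 = 0
  map_top' : toFun ∞ = ∞
  tendsto' : Tendsto (fun t : ℝ≥0 => toFun t) atTop (𝓝 ∞)

namespace YoungFunction

instance : CoeFun YoungFunction fun _ => ℝ≥0∞ → ℝ≥0∞ := ⟨toFun⟩

/-- The `Δ₂`-condition near the origin. -/
def LocalDelta2 (Φ : YoungFunction) : Prop :=
  ∃ r : ℝ≥0, 0 < r ∧ ∃ C : ℝ≥0, ∀ t : ℝ≥0∞, t ≤ r → Φ (2 * t) ≤ C * Φ t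

theorem convex (Φ : YoungFunction) {a b : ℝ≥0} (hab : a + b = 1) (s t : ℝ≥0∞) :
    Φ (a * s + b * t) ≤ a * Φ s + b * Φ t :=
  Φ.convex'.2 (mem_univ s) (mem_univ t) zero_le zero_le hab

theorem mono (Φ : YoungFunction) : Monotone Φ := by
  intro s t hst
  rcases eq_or_ne t ∞ with rfl | ht
  · rw [Φ.map_top']; exact le_top
  rcases eq_or_ne t 0 with rfl | ht0
  · rw [le_antisymm hst zero_le]
  lift t to ℝ≥0 using ht
  lift s to ℝ≥0 using ne_top_of_le_ne_top ENNReal.coe_ne_top hst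
  have ht0' : t ≠ 0 := by simpa using ht0
  have hst' : s ≤ t := by exact_mod_cast hst
  have ha : s / t ≤ 1 := div_le_one_of_le₀ hst' zero_le
  have := Φ.convex (add_tsub_cancel_of_le ha) (t : ℝ≥0∞) 0
  rw [Φ.map_zero', mul_zero, add_zero, add_zero, ← ENNReal.coe_mul,
    div_mul_cancel₀ s ht0'] at this
  refine this.trans (mul_le_of_le_one_left zero_le ?_)
  exact_mod_cast ha

theorem measurable (Φ : YoungFunction) : Measurable Φ := Φ.mono.measurable

end YoungFunction

/-- A weight: a positive function `ω` such that `ω` and `1/ω` belong to `L^∞_loc`. -/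
def IsWeight {E : Type*} [TopologicalSpace E] [MeasureSpace E] (ω : E → ℝ) : Prop :=
  (∀ x, 0 < ω x) ∧ ∀ K : Set E, IsCompact K →
    MemLp ω ∞ (volume.restrict K) ∧ MemLp (fun x => (ω x)⁻¹) ∞ (volume.restrict K)

/-- The moderate weights, i.e. the class `𝒫_E`. -/
structure ModerateWeight (E : Type*) [AddCommGroup E] [TopologicalSpace E] [MeasureSpace E] where
  toFun : E → ℝ
  isWeight' : IsWeight toFun
  moderate' : ∃ v : E → ℝ, IsWeight v ∧ ∃ C : ℝ, ∀ x y, toFun (x + y) ≤ C * (toFun x * v y)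

namespace ModerateWeight

variable {E : Type*} [AddCommGroup E] [TopologicalSpace E] [MeasureSpace E]

instance : CoeFun (ModerateWeight E) fun _ => E → ℝ := ⟨toFun⟩

theorem pos (ω : ModerateWeight E) (x : E) : 0 < ω x := ω.isWeight'.1 x

theorem aemeasurable [SigmaCompactSpace E] (ω : ModerateWeight E) :
    AEMeasurable ω (volume : Measure E) := by
  have h : ∀ n, AEStronglyMeasurable ω (volume.restrict (compactCovering E n)) := fun n =>
    (ω.isWeight'.2 _ (isCompact_compactCovering E n)).1.1
  have := aestronglyMeasurable_iUnion_iff.2 h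
  rw [iUnion_compactCovering, Measure.restrict_univ] at this
  exact this.aemeasurable

end ModerateWeight

/-! ### Orlicz spaces -/

section Orlicz

variable {E : Type*} [MeasureSpace E]

/-- The numbers `lam > 0` with `∫ Φ(|F(z)| ω(z) / lam) dz ≤ 1`. -/
def orliczSet (Φ : YoungFunction) (ω : E → ℝ) (F : E → ℂ) : Set ℝ :=
  {lam | 0 < lam ∧ ∫⁻ z, Φ (ENNReal.ofReal (‖F z‖ * ω z / lam)) ≤ 1}

/-- The (Luxemburg) norm of the weighted Orlicz space `L^Φ_(ω)`. -/
def orliczNorm (Φ : YoungFunction) (ω : E → ℝ) (F : E → ℂ) : ℝ := sInf (orliczSet Φ ω F)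

/-- `F` is measurable with finite `L^Φ_(ω)` norm. -/
def MemOrlicz (Φ : YoungFunction) (ω : E → ℝ) (F : E → ℂ) : Prop :=
  AEStronglyMeasurable F ∧ (orliczSet Φ ω F).Nonempty

theorem orliczSet_bddBelow (Φ : YoungFunction) (ω : E → ℝ) (F : E → ℂ) :
    BddBelow (orliczSet Φ ω F) := ⟨0, fun _ h => h.1.le⟩

theorem orliczNorm_nonneg (Φ : YoungFunction) (ω : E → ℝ) (F : E → ℂ) :
    0 ≤ orliczNorm Φ ω F := Real.sInf_nonneg fun _ h => h.1.le

theorem mem_orliczSet_zero (Φ : YoungFunction) (ω : E → ℝ) {r : ℝ} (hr : 0 < r) :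
    r ∈ orliczSet Φ ω (fun _ : E => (0 : ℂ)) := by
  refine ⟨hr, ?_⟩
  simp [Φ.map_zero']

theorem orliczNorm_zero (Φ : YoungFunction) (ω : E → ℝ) :
    orliczNorm Φ ω (fun _ : E => (0 : ℂ)) = 0 := by
  refine le_antisymm (le_of_forall_pos_le_add fun ε hε => ?_) (orliczNorm_nonneg _ _ _)
  rw [zero_add]
  exact csInf_le (orliczSet_bddBelow _ _ _) (mem_orliczSet_zero Φ ω hε)

theorem mul_mem_orliczSet (Φ : YoungFunction) (ω : E → ℝ) (F : E → ℂ) {c : ℂ} (hc : c ≠ 0) {r : ℝ}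
    (hr : r ∈ orliczSet Φ ω F) : ‖c‖ * r ∈ orliczSet Φ ω (fun z => c * F z) := by
  have hc' : 0 < ‖c‖ := norm_pos_iff.2 hc
  refine ⟨mul_pos hc' hr.1, ?_⟩
  convert hr.2 using 5 with z
  rw [norm_mul, mul_assoc, mul_div_mul_left _ _ hc'.ne']

theorem orliczNorm_mul_le (Φ : YoungFunction) (ω : E → ℝ) (F : E → ℂ) (c : ℂ)
    (hF : (orliczSet Φ ω F).Nonempty) :
    orliczNorm Φ ω (fun z => c * F z) ≤ ‖c‖ * orliczNorm Φ ω F := by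
  rcases eq_or_ne c 0 with rfl | hc
  · simp [orliczNorm_zero]
  have hc' : 0 < ‖c‖ := norm_pos_iff.2 hc
  rw [← div_le_iff₀' hc']
  refine le_csInf hF fun r hr => ?_
  rw [div_le_iff₀' hc']
  exact csInf_le (orliczSet_bddBelow _ _ _) (mul_mem_orliczSet Φ ω F hc hr)

theorem add_mem_orliczSet [AddCommGroup E] [TopologicalSpace E] [SigmaCompactSpace E]
    (Φ : YoungFunction) (ω : ModerateWeight E)
    {F G : E → ℂ} (hF : AEStronglyMeasurable F) {r s : ℝ} (hr : r ∈ orliczSet Φ ω F)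
    (hs : s ∈ orliczSet Φ ω G) : r + s ∈ orliczSet Φ ω (fun z => F z + G z) := by
  have hr0 := hr.1
  have hs0 := hs.1
  have hrs : 0 < r + s := add_pos hr0 hs0
  refine ⟨hrs, ?_⟩
  set a : ℝ≥0 := (r / (r + s)).toNNReal with ha
  set b : ℝ≥0 := (s / (r + s)).toNNReal with hb
  have hab : a + b = 1 := by
    rw [ha, hb, ← Real.toNNReal_add (by positivity) (by positivity), ← add_div,
      div_self hrs.ne', Real.toNNReal_one]
  have key : ∀ z, Φ (ENNReal.ofReal (‖F z + G z‖ * ω z / (r + s))) ≤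
      a * Φ (ENNReal.ofReal (‖F z‖ * ω z / r)) + b * Φ (ENNReal.ofReal (‖G z‖ * ω z / s)) := by
    intro z
    have hω := ω.pos z
    refine le_trans (Φ.mono ?_) (Φ.convex hab _ _)
    change _ ≤ ENNReal.ofReal _ * _ + ENNReal.ofReal _ * _
    rw [← ENNReal.ofReal_mul (by positivity), ← ENNReal.ofReal_mul (by positivity),
      ← ENNReal.ofReal_add (by positivity) (by positivity)]
    refine ENNReal.ofReal_le_ofReal ?_
    calc ‖F z + G z‖ * ω z / (r + s) ≤ (‖F z‖ + ‖G z‖) * ω z / (r + s) := by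
          gcongr
          exact norm_add_le _ _
      _ = _ := by field_simp
  have hmeas : AEMeasurable (fun z => (a : ℝ≥0∞) * Φ (ENNReal.ofReal (‖F z‖ * ω z / r))) :=
    (Φ.measurable.comp_aemeasurable
      ((hF.norm.aemeasurable.mul ω.aemeasurable).div_const r).ennreal_ofReal).const_mul _
  calc _ ≤ ∫⁻ z, (a * Φ (ENNReal.ofReal (‖F z‖ * ω z / r)) +
          b * Φ (ENNReal.ofReal (‖G z‖ * ω z / s))) := lintegral_mono key
    _ = a * (∫⁻ z, Φ (ENNReal.ofReal (‖F z‖ * ω z / r))) +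
          b * ∫⁻ z, Φ (ENNReal.ofReal (‖G z‖ * ω z / s)) := by
        rw [lintegral_add_left' hmeas, lintegral_const_mul' _ _ ENNReal.coe_ne_top,
          lintegral_const_mul' _ _ ENNReal.coe_ne_top]
    _ ≤ a * 1 + b * 1 := by
        gcongr
        · exact hr.2
        · exact hs.2
    _ = 1 := by
        rw [mul_one, mul_one]
        exact_mod_cast hab

theorem orliczNorm_add_le [AddCommGroup E] [TopologicalSpace E] [SigmaCompactSpace E]
    (Φ : YoungFunction) (ω : ModerateWeight E)
    {F G : E → ℂ} (hF : MemOrlicz Φ ω F) (hG : MemOrlicz Φ ω G) :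
    orliczNorm Φ ω (fun z => F z + G z) ≤ orliczNorm Φ ω F + orliczNorm Φ ω G := by
  have h : ∀ r ∈ orliczSet Φ ω F, ∀ s ∈ orliczSet Φ ω G,
      orliczNorm Φ ω (fun z => F z + G z) ≤ r + s := fun r hr s hs =>
    csInf_le (orliczSet_bddBelow _ _ _) (add_mem_orliczSet Φ ω hF.1 hr hs)
  have h1 : ∀ r ∈ orliczSet Φ ω F,
      orliczNorm Φ ω (fun z => F z + G z) - r ≤ orliczNorm Φ ω G := fun r hr =>
    le_csInf hG.2 fun s hs => by linarith [h r hr s hs]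
  have h2 : orliczNorm Φ ω (fun z => F z + G z) - orliczNorm Φ ω G ≤ orliczNorm Φ ω F :=
    le_csInf hF.2 fun r hr => by linarith [h1 r hr]
  linarith

end Orlicz

/-! ### Orlicz modulation spaces -/

section Modulation

variable {ι : Type*} [Fintype ι]

theorem stft_zero : stft (0 : GSDistribution ι) = fun _ => 0 := by
  funext z; simp [stft]

theorem stft_add (u w : GSDistribution ι) : stft (u + w) = fun z => stft u z + stft w z := by
  funext z; simp [stft, mul_add]

theorem stft_smul (c : ℂ) (u : GSDistribution ι) : stft (c • u) = fun z => c * stft u z := by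
  funext z; simp [stft, mul_left_comm]

/-- The elements of `M^Φ_(ω)(ℝ^ι)`: all `u ∈ Σ₁'(ℝ^ι)` whose short-time Fourier transform belongs
to `L^Φ_(ω)(ℝ^ι × ℝ^ι)`. -/
def modulationSubmodule (Φ : YoungFunction)
    (ω : ModerateWeight (EuclideanSpace ℝ ι × EuclideanSpace ℝ ι)) :
    Submodule ℂ (GSDistribution ι) where
  carrier := {u | MemOrlicz Φ ω (stft u)}
  zero_mem' := by
    rw [mem_ofPred_eq, stft_zero]
    exact ⟨aestronglyMeasurable_const, 1, mem_orliczSet_zero Φ ω one_pos⟩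
  add_mem' := by
    rintro u w ⟨hu, r, hr⟩ ⟨hw, s, hs⟩
    rw [mem_ofPred_eq, stft_add]
    exact ⟨hu.add hw, r + s, add_mem_orliczSet Φ ω hu hr hs⟩
  smul_mem' := by
    rintro c u ⟨hu, r, hr⟩
    rw [mem_ofPred_eq, stft_smul]
    refine ⟨hu.const_mul c, ?_⟩
    rcases eq_or_ne c 0 with rfl | hc
    · simp only [zero_mul]
      exact ⟨1, mem_orliczSet_zero Φ ω one_pos⟩
    · exact ⟨_, mul_mem_orliczSet Φ ω _ hc hr⟩

/-- The Orlicz modulation space `M^Φ_(ω)(ℝ^ι)`. -/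
def OrliczModulationSpace (Φ : YoungFunction)
    (ω : ModerateWeight (EuclideanSpace ℝ ι × EuclideanSpace ℝ ι)) : Type _ :=
  modulationSubmodule Φ ω

namespace OrliczModulationSpace

variable (Φ : YoungFunction) (ω : ModerateWeight (EuclideanSpace ℝ ι × EuclideanSpace ℝ ι))

instance : AddCommGroup (OrliczModulationSpace Φ ω) :=
  inferInstanceAs (AddCommGroup (modulationSubmodule Φ ω))

instance : Module ℂ (OrliczModulationSpace Φ ω) :=
  inferInstanceAs (Module ℂ (modulationSubmodule Φ ω))

/-- The inclusion of `M^Φ_(ω)` in `Σ₁'`. -/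
def toDistribution : OrliczModulationSpace Φ ω →ₗ[ℂ] GSDistribution ι :=
  (modulationSubmodule Φ ω).subtype

/-- The norm `‖V_φ u‖` in `L^Φ_(ω)` of `u ∈ M^Φ_(ω)`. -/
def modulationSeminorm : Seminorm ℂ (OrliczModulationSpace Φ ω) :=
  Seminorm.ofSMulLE (fun u => orliczNorm Φ ω (stft (toDistribution Φ ω u)))
    (by
      rw [map_zero, stft_zero, orliczNorm_zero])
    (fun u w => by
      rw [map_add, stft_add]
      exact orliczNorm_add_le Φ ω u.2 w.2)
    (fun c u => by
      rw [map_smul, stft_smul]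
      exact orliczNorm_mul_le Φ ω _ c u.2.2)

/-- The topology of `M^Φ_(ω)` is given by its norm. (Only the properties of a seminorm are recorded
here.) -/
instance : SeminormedAddCommGroup (OrliczModulationSpace Φ ω) :=
  (modulationSeminorm Φ ω).toAddGroupSeminorm.toSeminormedAddCommGroup

theorem norm_def (u : OrliczModulationSpace Φ ω) :
    ‖u‖ = orliczNorm Φ ω (stft (toDistribution Φ ω u)) := rfl

instance : NormedSpace ℂ (OrliczModulationSpace Φ ω) where
  norm_smul_le c u := ((modulationSeminorm Φ ω).smul' c u).le

/-- The topology on `M^Φ_(ω)` induced by the weak-* topology `σ(Σ₁', Σ₁)`: pointwise convergence on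
test functions. -/
@[reducible]
def weakStarTopology : TopologicalSpace (OrliczModulationSpace Φ ω) :=
  TopologicalSpace.induced
    (fun u (φ : GelfandShilov ι) => toDistribution Φ ω u φ) Pi.topologicalSpace

/-- `S : M^Φ_(ω) → M^Φ_(ω')` extends the pullback `f ↦ f ∘ L` on `Σ₁`. -/
def ExtendsPullback {Φ : YoungFunction}
    {ω ω' : ModerateWeight (EuclideanSpace ℝ ι × EuclideanSpace ℝ ι)}
    (L : EuclideanSpace ℝ ι ≃L[ℝ] EuclideanSpace ℝ ι)
    (S : OrliczModulationSpace Φ ω → OrliczModulationSpace Φ ω') : Prop :=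
  ∀ (f : GelfandShilov ι) (u : OrliczModulationSpace Φ ω),
    toDistribution Φ ω u = GSDistribution.ofGS f →
      toDistribution Φ ω' (S u) = GSDistribution.ofGS (GelfandShilov.compLin L f)

end OrliczModulationSpace

end Modulation

/-! ### The shear `T_A` on `ℝ^{2d}` -/

section Shear

variable {d : ℕ}

/-- The point `(x, y) ∈ ℝ^{2d}`. -/
def pair (x y : EuclideanSpace ℝ (Fin d)) : EuclideanSpace ℝ (Fin d ⊕ Fin d) :=
  WithLp.toLp 2 (Sum.elim x y)

/-- The component `x` of `(x, y) ∈ ℝ^{2d}`. -/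
def fstPart (z : EuclideanSpace ℝ (Fin d ⊕ Fin d)) : EuclideanSpace ℝ (Fin d) :=
  WithLp.toLp 2 fun i => z (Sum.inl i)

/-- The component `y` of `(x, y) ∈ ℝ^{2d}`. -/
def sndPart (z : EuclideanSpace ℝ (Fin d ⊕ Fin d)) : EuclideanSpace ℝ (Fin d) :=
  WithLp.toLp 2 fun i => z (Sum.inr i)

/-- The action of a real `d × d` matrix on `ℝ^d`. -/
def act (A : Matrix (Fin d) (Fin d) ℝ) (x : EuclideanSpace ℝ (Fin d)) :
    EuclideanSpace ℝ (Fin d) := Matrix.toEuclideanLin A x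

theorem fstPart_pair (x y : EuclideanSpace ℝ (Fin d)) : fstPart (pair x y) = x := rfl

theorem sndPart_pair (x y : EuclideanSpace ℝ (Fin d)) : sndPart (pair x y) = y := rfl

theorem pair_fstPart_sndPart (z : EuclideanSpace ℝ (Fin d ⊕ Fin d)) :
    pair (fstPart z) (sndPart z) = z := by
  ext i
  cases i <;> rfl

theorem pair_add (x y x' y' : EuclideanSpace ℝ (Fin d)) :
    pair (x + x') (y + y') = pair x y + pair x' y' := by
  ext i
  cases i <;> rfl

theorem pair_smul (c : ℝ) (x y : EuclideanSpace ℝ (Fin d)) :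
    pair (c • x) (c • y) = c • pair x y := by
  ext i
  cases i <;> rfl

theorem fstPart_add (z w : EuclideanSpace ℝ (Fin d ⊕ Fin d)) :
    fstPart (z + w) = fstPart z + fstPart w := rfl

theorem sndPart_add (z w : EuclideanSpace ℝ (Fin d ⊕ Fin d)) :
    sndPart (z + w) = sndPart z + sndPart w := rfl

theorem fstPart_smul (c : ℝ) (z : EuclideanSpace ℝ (Fin d ⊕ Fin d)) :
    fstPart (c • z) = c • fstPart z := rfl

theorem sndPart_smul (c : ℝ) (z : EuclideanSpace ℝ (Fin d ⊕ Fin d)) :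
    sndPart (c • z) = c • sndPart z := rfl

/-- The map `T_A(x, y) = (x - A(x - y), y - A(x - y))`, a linear bijection with inverse
`T_{-A}`. -/
def shear (A : Matrix (Fin d) (Fin d) ℝ) :
    EuclideanSpace ℝ (Fin d ⊕ Fin d) ≃L[ℝ] EuclideanSpace ℝ (Fin d ⊕ Fin d) :=
  LinearEquiv.toContinuousLinearEquiv
    { toFun := fun z =>
        pair (fstPart z - act A (fstPart z - sndPart z)) (sndPart z - act A (fstPart z - sndPart z))
      invFun := fun z =>
        pair (fstPart z + act A (fstPart z - sndPart z)) (sndPart z + act A (fstPart z - sndPart z))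
      map_add' := fun z w => by
        rw [← pair_add]
        simp only [fstPart_add, sndPart_add, act, add_sub_add_comm, map_add]
      map_smul' := fun c z => by
        rw [RingHom.id_apply, ← pair_smul]
        simp only [fstPart_smul, sndPart_smul, act, ← smul_sub, map_smul]
      left_inv := fun z => by
        simp only [fstPart_pair, sndPart_pair, sub_sub_sub_cancel_right, sub_add_cancel,
          pair_fstPart_sndPart]
      right_inv := fun z => by
        simp only [fstPart_pair, sndPart_pair, add_sub_add_right_eq_sub, add_sub_cancel_right,
          pair_fstPart_sndPart] }

theorem shear_pair (A : Matrix (Fin d) (Fin d) ℝ) (x y : EuclideanSpace ℝ (Fin d)) :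
    shear A (pair x y) = pair (x - act A (x - y)) (y - act A (x - y)) := rfl

end Shear

end OrliczModulation

end

open OrliczModulation OrliczModulation.OrliczModulationSpace
open scoped Topology ENNReal

/-!
The time-frequency shifts of the Gaussian window `φ` form a continuous family in `Σ₁` whose norms
grow at most exponentially, while `V_φ f` decays faster than every exponential for `f ∈ Σ₁`. Hence
the inversion formula holds for all `u ∈ Σ₁'`, and for a linear bijection `L` with contragredient
`M` it expresses `V_φ (L^* u)(w)` as the integral of `V_φ u(z)` against a kernel which, for every
`R`, is `O(exp (-R |Λ w - z|))`, where `Λ = L × M`. Moderate weights vary at most exponentially,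
so after multiplication by `ω(Λ w)` the kernel is still dominated by a multiple of an exponential
probability density. Jensen's inequality then bounds `L^*` from `M^Φ_(ω)` to `M^Φ_(ω ∘ Λ)`, and
applying this to `L⁻¹` gives a homeomorphism.

Uniqueness is density of `Σ₁`. A distribution can be interpolated by elements of `Σ₁` on any
finite set of test functions, which gives weak-* density. If `Φ` is positive and satisfies the
local `Δ₂` condition, then `ω V_φ u` tends to `0` at infinity and `Φ(ω |V_φ u| / λ)` has small
tails for every `λ > 0`. Restricting the integral in the inversion formula to a large ball
therefore gives elements of `Σ₁` that converge to `u` in norm.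
-/

noncomputable section

namespace OrliczModulation

open MeasureTheory Set Filter Topology
open scoped ENNReal NNReal

/-! ### Cauchy estimates and Gelfand–Shilov bounds from entire extensions -/

section Cauchy

open scoped ContDiff Nat

variable {V W : Type*} [NormedAddCommGroup V] [NormedSpace ℂ V] [NormedAddCommGroup W]
  [NormedSpace ℂ W]

theorem norm_fderiv_le_of_forall_mem_closedBall_norm_le {f : V → W} {c : V} {R C : ℝ}
    (hR : 0 < R) (hf : DiffContOnCl ℂ f (Metric.ball c R))
    (hC : ∀ z ∈ Metric.closedBall c R, ‖f z‖ ≤ C) : ‖fderiv ℂ f c‖ ≤ C / R := by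
  have hC0 : 0 ≤ C := (norm_nonneg _).trans (hC c (Metric.mem_closedBall_self hR.le))
  refine ContinuousLinearMap.opNorm_le_bound _ (by positivity) fun v => ?_
  rcases eq_or_ne v 0 with rfl | hv
  · simp
  have hv' : 0 < ‖v‖ := norm_pos_iff.2 hv
  let line : ℂ → V := fun t => c + t • v
  have hmaps : MapsTo line (Metric.ball 0 (R / ‖v‖)) (Metric.ball c R) := fun t ht => by
    rw [mem_ball_zero_iff, lt_div_iff₀ hv', ← norm_smul] at ht
    simpa [line] using ht
  have hline : HasDerivAt line v 0 := by
    simpa [line] using ((hasDerivAt_id (0 : ℂ)).smul_const v).const_add c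
  have hfc : HasFDerivAt f (fderiv ℂ f c) (line 0) := by
    simpa [line] using
      (hf.differentiableAt Metric.isOpen_ball (Metric.mem_ball_self hR)).hasFDerivAt
  have hcomp : DiffContOnCl ℂ (f ∘ line) (Metric.ball 0 (R / ‖v‖)) :=
    hf.comp (Differentiable.diffContOnCl (by fun_prop)) hmaps
  have hbound := Complex.norm_deriv_le_of_forall_mem_sphere_norm_le (div_pos hR hv') hcomp
    fun t ht => hC (line t) (by
      rw [mem_sphere_zero_iff_norm] at ht
      simp [line, norm_smul, ht, hv'.ne'])
  rw [(hfc.comp_hasDerivAt (0 : ℂ) hline).deriv] at hbound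
  exact hbound.trans_eq (by field_simp)

theorem norm_iteratedFDeriv_le_of_forall_mem_closedBall_mul_norm_le {f : V → W}
    (hf : ContDiff ℂ ∞ f) {r C : ℝ} (hr : 0 < r) (m : ℕ) (c : V)
    (hC : ∀ z ∈ Metric.closedBall c (m * r), ‖f z‖ ≤ C) :
    ‖iteratedFDeriv ℂ m f c‖ ≤ C / r ^ m := by
  induction m generalizing c with
  | zero => simpa using hC c (by simp)
  | succ m ih =>
    rw [← norm_fderiv_iteratedFDeriv, pow_succ, ← div_div]
    refine norm_fderiv_le_of_forall_mem_closedBall_norm_le hr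
      (hf.differentiable_iteratedFDeriv (mod_cast ENat.natCast_lt_top m)).diffContOnCl
      fun z hz => ih z fun w hw => hC w ?_
    rw [Metric.mem_closedBall] at hz hw ⊢
    push_cast
    linarith [dist_triangle w z c]

theorem natCast_pow_self_le (m : ℕ) : (m : ℝ) ^ m ≤ Real.exp 1 ^ m * m ! := by
  rw [← div_le_iff₀ (by positivity), ← Real.exp_nat_mul, mul_one]
  exact Real.pow_div_factorial_le_exp m (by positivity) m

-- The ball of radius `R` is reached in `m` Cauchy estimates of radius `R / m` each.
theorem norm_iteratedFDeriv_le_of_forall_mem_closedBall_norm_le {f : V → W}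
    (hf : ContDiff ℂ ∞ f) {R C : ℝ} (hR : 0 < R) (m : ℕ) (c : V)
    (hC : ∀ z ∈ Metric.closedBall c R, ‖f z‖ ≤ C) :
    ‖iteratedFDeriv ℂ m f c‖ ≤ C * ((Real.exp 1 / R) ^ m * m !) := by
  rcases m.eq_zero_or_pos with rfl | hm
  · simpa using hC c (Metric.mem_closedBall_self hR.le)
  have hC0 : 0 ≤ C := (norm_nonneg _).trans (hC c (Metric.mem_closedBall_self hR.le))
  have hm' : (m : ℝ) ≠ 0 := mod_cast hm.ne'
  refine (norm_iteratedFDeriv_le_of_forall_mem_closedBall_mul_norm_le hf (r := R / m)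
    (by positivity) m c (C := C) (by rwa [mul_div_cancel₀ R hm'])).trans ?_
  rw [div_eq_mul_inv C, div_pow, inv_div, div_pow, div_mul_eq_mul_div]
  gcongr
  exact natCast_pow_self_le m

theorem pow_mul_exp_neg_mul_le {a t : ℝ} (ha : 0 < a) (ht : 0 ≤ t) (k : ℕ) :
    t ^ k * Real.exp (-a * t) ≤ k ! / a ^ k := by
  have hexp := Real.pow_div_factorial_le_exp (a * t) (by positivity) k
  rw [div_le_iff₀ (by positivity), mul_pow] at hexp
  rw [neg_mul, Real.exp_neg, ← div_eq_mul_inv, div_le_div_iff₀ (Real.exp_pos _) (by positivity)]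
  linarith

variable {ι : Type*} [Fintype ι]

variable (ι) in
/-- The isometric embedding of `ℝ^ι` in `ℂ^ι`. -/
def complexify : EuclideanSpace ℝ ι →ₗᵢ[ℝ] EuclideanSpace ℂ ι where
  toFun y := WithLp.toLp 2 fun j => (y j : ℂ)
  map_add' y w := by ext j; simp
  map_smul' c y := by ext j; simp
  norm_map' y := by simp [EuclideanSpace.norm_eq]

theorem complexify_apply (y : EuclideanSpace ℝ ι) (j : ι) : complexify ι y j = (y j : ℂ) := rfl

theorem norm_iteratedFDeriv_comp_complexify_le {F : EuclideanSpace ℂ ι → W} {m : ℕ}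
    (hF : ContDiff ℂ m F) (x : EuclideanSpace ℝ ι) :
    ‖iteratedFDeriv ℝ m (F ∘ complexify ι) x‖ ≤ ‖iteratedFDeriv ℂ m F (complexify ι x)‖ := by
  have hcomp := (complexify ι).toContinuousLinearMap.iteratedFDeriv_comp_right
    (hF.restrict_scalars ℝ) x le_rfl
  rw [LinearIsometry.coe_toContinuousLinearMap] at hcomp
  rw [hcomp, ← hF.contDiffAt.restrictScalars_iteratedFDeriv (𝕜 := ℝ)]
  refine (ContinuousMultilinearMap.norm_compContinuousLinearMap_le _ _).trans ?_
  rw [Function.comp_apply, ContinuousMultilinearMap.norm_restrictScalars, Finset.prod_const]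
  exact mul_le_of_le_one_right (norm_nonneg _)
    (pow_le_one₀ (norm_nonneg _) (complexify ι).norm_toContinuousLinearMap_le)

theorem gelfandShilov_bound_of_entire {F : EuclideanSpace ℂ ι → W} (hF : ContDiff ℂ ∞ F)
    {h C : ℝ} (hh : 0 < h)
    (hC : ∀ (y : EuclideanSpace ℝ ι) (ζ : EuclideanSpace ℂ ι),
      ‖ζ - complexify ι y‖ ≤ Real.exp 1 / h → ‖F ζ‖ ≤ C * Real.exp (-(Real.exp 1 / h) * ‖y‖))
    (k m : ℕ) (x : EuclideanSpace ℝ ι) :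
    ‖x‖ ^ k * ‖iteratedFDeriv ℝ m (F ∘ complexify ι) x‖ / (h ^ (k + m) * (k ! * m !)) ≤ C := by
  set a := Real.exp 1 / h with ha
  have ha0 : 0 < a := by positivity
  have hah : Real.exp 1 / a = h := by rw [ha, div_div_cancel₀ (Real.exp_pos 1).ne']
  have hC0 : 0 ≤ C := by
    simpa using (norm_nonneg _).trans (hC 0 (complexify ι 0) (by simpa using ha0.le))
  have hderiv : ‖iteratedFDeriv ℝ m (F ∘ complexify ι) x‖ ≤
      C * Real.exp (-a * ‖x‖) * (h ^ m * m !) := by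
    rw [← hah]
    exact (norm_iteratedFDeriv_comp_complexify_le (hF.of_le (mod_cast le_top)) x).trans
      (norm_iteratedFDeriv_le_of_forall_mem_closedBall_norm_le hF ha0 m _
        fun ζ hζ => hC x ζ (mem_closedBall_iff_norm.1 hζ))
  have hpow : ‖x‖ ^ k * Real.exp (-a * ‖x‖) ≤ h ^ k * k ! := by
    refine (pow_mul_exp_neg_mul_le ha0 (norm_nonneg x) k).trans ?_
    rw [div_eq_inv_mul, ← inv_pow]
    gcongr
    rw [ha, inv_div]
    exact div_le_self hh.le (Real.one_le_exp zero_le_one)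
  rw [div_le_iff₀ (by positivity)]
  calc ‖x‖ ^ k * ‖iteratedFDeriv ℝ m (F ∘ complexify ι) x‖
      ≤ ‖x‖ ^ k * (C * Real.exp (-a * ‖x‖) * (h ^ m * m !)) := by gcongr
    _ = C * (h ^ m * m !) * (‖x‖ ^ k * Real.exp (-a * ‖x‖)) := by ring
    _ ≤ C * (h ^ m * m !) * (h ^ k * k !) := by gcongr
    _ = C * (h ^ (k + m) * (k ! * m !)) := by rw [pow_add]; ring

end Cauchy

/-! ### Gaussian wave packets as a continuous family in `Σ₁` -/

/-- The phase space `ℝ^ι × ℝ^ι` on which short-time Fourier transforms live. -/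
abbrev PhaseSpace (ι : Type*) : Type _ := EuclideanSpace ℝ ι × EuclideanSpace ℝ ι

section Packet

open scoped ContDiff

variable {ι : Type*} [Fintype ι]

/-- The real part of a vector in `ℂ^ι`. -/
def vecRe (ζ : EuclideanSpace ℂ ι) : EuclideanSpace ℝ ι := WithLp.toLp 2 fun j => (ζ j).re

/-- The imaginary part of a vector in `ℂ^ι`. -/
def vecIm (ζ : EuclideanSpace ℂ ι) : EuclideanSpace ℝ ι := WithLp.toLp 2 fun j => (ζ j).im

theorem norm_vecRe_sub_le (ζ : EuclideanSpace ℂ ι) (y : EuclideanSpace ℝ ι) :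
    ‖vecRe ζ - y‖ ≤ ‖ζ - complexify ι y‖ := by
  rw [EuclideanSpace.norm_eq, EuclideanSpace.norm_eq]
  gcongr with j
  simpa [vecRe, complexify_apply] using Complex.abs_re_le_norm (ζ j - (y j : ℂ))

theorem norm_vecIm_le (ζ : EuclideanSpace ℂ ι) (y : EuclideanSpace ℝ ι) :
    ‖vecIm ζ‖ ≤ ‖ζ - complexify ι y‖ := by
  rw [EuclideanSpace.norm_eq, EuclideanSpace.norm_eq]
  gcongr with j
  simpa [vecIm, complexify_apply] using Complex.abs_im_le_norm (ζ j - (y j : ℂ))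

/-- The entire extension to `ℂ^ι` of the Gaussian wave packet at a point of phase space. -/
def packetExt (z : PhaseSpace ι) (ζ : EuclideanSpace ℂ ι) : ℂ :=
  ((Real.pi ^ (-(Fintype.card ι : ℝ) / 4) : ℝ) : ℂ) *
    Complex.exp (∑ j, (-(ζ j - z.1 j) ^ 2 / 2 - Complex.I * (ζ j * z.2 j)))

theorem gaussianPacket_apply (x ξ y : EuclideanSpace ℝ ι) :
    gaussianPacket x ξ y =
      (gaussianWindow (y - x) : ℂ) * Complex.exp (-Complex.I * (inner ℝ y ξ : ℝ)) := rfl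

theorem packetExt_comp_complexify (z : PhaseSpace ι) :
    packetExt z ∘ complexify ι = gaussianPacket z.1 z.2 := by
  funext y
  have hsq : ∀ j, ((‖(y - z.1) j‖ : ℝ) : ℂ) ^ 2 = ((y j : ℂ) - z.1 j) ^ 2 := fun j => by
    rw [← Complex.ofReal_pow, Real.norm_eq_abs, sq_abs]
    simp
  have hinner : ∀ j, ((inner ℝ (y j) (z.2 j) : ℝ) : ℂ) = (y j : ℂ) * z.2 j := fun j => by
    simp [mul_comm]
  rw [gaussianPacket_apply, Function.comp_apply, packetExt, gaussianWindow, Complex.ofReal_mul,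
    mul_assoc, Complex.ofReal_exp, ← Complex.exp_add, EuclideanSpace.norm_sq_eq, PiLp.inner_apply]
  push_cast
  simp only [complexify_apply, hsq, hinner, Finset.sum_sub_distrib, neg_div,
    Finset.sum_neg_distrib, Finset.sum_div, neg_mul, Finset.mul_sum]
  rw [← sub_eq_add_neg]

theorem contDiff_packetExt (z : PhaseSpace ι) : ContDiff ℂ ∞ (packetExt z) := by
  have : ∀ j : ι, ContDiff ℂ ∞ fun ζ : EuclideanSpace ℂ ι => ζ j := fun j =>
    (EuclideanSpace.proj (𝕜 := ℂ) j).contDiff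
  unfold packetExt
  fun_prop

theorem continuous_uncurry_packetExt :
    Continuous (Function.uncurry packetExt : PhaseSpace ι × EuclideanSpace ℂ ι → ℂ) := by
  unfold Function.uncurry packetExt
  fun_prop

theorem norm_packetExt (z : PhaseSpace ι) (ζ : EuclideanSpace ℂ ι) :
    ‖packetExt z ζ‖ = Real.pi ^ (-(Fintype.card ι : ℝ) / 4) *
      Real.exp (-‖vecRe ζ - z.1‖ ^ 2 / 2 + ‖vecIm ζ‖ ^ 2 / 2 + inner ℝ (vecIm ζ) z.2) := by
  have hre : (∑ j, (-(ζ j - z.1 j) ^ 2 / 2 - Complex.I * (ζ j * z.2 j))).re =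
      -‖vecRe ζ - z.1‖ ^ 2 / 2 + ‖vecIm ζ‖ ^ 2 / 2 + inner ℝ (vecIm ζ) z.2 := by
    rw [Complex.re_sum, EuclideanSpace.norm_sq_eq, EuclideanSpace.norm_sq_eq, PiLp.inner_apply,
      ← Finset.sum_neg_distrib, Finset.sum_div, Finset.sum_div, ← Finset.sum_add_distrib,
      ← Finset.sum_add_distrib]
    refine Finset.sum_congr rfl fun j _ => ?_
    simp only [vecRe, vecIm, PiLp.sub_apply, Real.norm_eq_abs, sq_abs]
    simp [pow_two]
    ring
  rw [packetExt, norm_mul, Complex.norm_exp, hre, Complex.norm_real,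
    Real.norm_of_nonneg (by positivity)]

theorem norm_packetExt_le {a b : ℝ} (hb : 0 ≤ b) (z : PhaseSpace ι) (y : EuclideanSpace ℝ ι)
    (ζ : EuclideanSpace ℂ ι) (hζ : ‖ζ - complexify ι y‖ ≤ a) :
    ‖packetExt z ζ‖ ≤ Real.pi ^ (-(Fintype.card ι : ℝ) / 4) *
      Real.exp (a * b + (a ^ 2 + b ^ 2) / 2 + (a + b) * ‖z‖) * Real.exp (-b * ‖y‖) := by
  have ha : 0 ≤ a := (norm_nonneg _).trans hζ
  have hre : ‖vecRe ζ - y‖ ≤ a := (norm_vecRe_sub_le ζ y).trans hζ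
  have him : ‖vecIm ζ‖ ≤ a := (norm_vecIm_le ζ y).trans hζ
  have hinner : inner ℝ (vecIm ζ) z.2 ≤ a * ‖z‖ :=
    (real_inner_le_norm _ _).trans (mul_le_mul him (norm_snd_le z) (norm_nonneg _) ha)
  have hy : ‖y‖ ≤ a + ‖z‖ + ‖vecRe ζ - z.1‖ := by
    calc ‖y‖ = ‖-(vecRe ζ - y) + z.1 + (vecRe ζ - z.1)‖ := by congr 1; abel
      _ ≤ ‖-(vecRe ζ - y)‖ + ‖z.1‖ + ‖vecRe ζ - z.1‖ := norm_add₃_le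
      _ ≤ a + ‖z‖ + ‖vecRe ζ - z.1‖ := by rw [norm_neg]; gcongr; exact norm_fst_le z
  have hsq : ‖vecIm ζ‖ ^ 2 ≤ a ^ 2 := by gcongr
  rw [norm_packetExt, mul_assoc, ← Real.exp_add]
  refine mul_le_mul_of_nonneg_left (Real.exp_le_exp.2 ?_) (by positivity)
  -- `b ‖y‖` is absorbed by the Gaussian: `b s ≤ s² / 2 + b² / 2`.
  nlinarith [mul_le_mul_of_nonneg_left hy hb, sq_nonneg (‖vecRe ζ - z.1‖ - b)]

theorem exists_gsNorm_gaussianPacket_le {h : ℝ} (hh : 0 < h) :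
    ∃ C a : ℝ, 0 ≤ C ∧ 0 ≤ a ∧ ∀ z : PhaseSpace ι,
      GelfandShilov.gsNorm h (gaussianPacket z.1 z.2) ≤ C * Real.exp (a * ‖z‖) := by
  set a := Real.exp 1 / h
  have ha : 0 < a := by positivity
  refine ⟨Real.pi ^ (-(Fintype.card ι : ℝ) / 4) * Real.exp (a * a + (a ^ 2 + a ^ 2) / 2), a + a,
    by positivity, by positivity, fun z => GelfandShilov.gsNorm_le _ fun k m x => ?_⟩
  rw [← packetExt_comp_complexify]
  refine gelfandShilov_bound_of_entire (contDiff_packetExt z) hh (fun y ζ hζ => ?_) k m x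
  refine (norm_packetExt_le ha.le z y ζ hζ).trans_eq ?_
  rw [Real.exp_add _ ((a + a) * ‖z‖)]
  ring

theorem eventually_norm_packetExt_sub_le_of_norm_le (z₀ : PhaseSpace ι) (R : ℝ) {ε : ℝ}
    (hε : 0 < ε) : ∀ᶠ z in 𝓝 z₀, ∀ ζ : EuclideanSpace ℂ ι, ‖ζ‖ ≤ R →
      ‖packetExt z ζ - packetExt z₀ ζ‖ ≤ ε := by
  obtain ⟨v, hv, hvR⟩ := (isCompact_closedBall (0 : EuclideanSpace ℂ ι) R).mem_uniformity_of_prod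
    (f := packetExt (ι := ι)) (s := univ) (q := z₀)
    continuous_uncurry_packetExt.continuousOn (mem_univ _) (Metric.dist_mem_uniformity hε)
  rw [nhdsWithin_univ] at hv
  filter_upwards [hv] with z hz ζ hζ
  have hdist := hvR z hz ζ (mem_closedBall_zero_iff.2 hζ)
  rw [mem_ofPred_eq, dist_eq_norm] at hdist
  exact hdist.le

theorem eventually_norm_packetExt_sub_le (z₀ : PhaseSpace ι) {a ε : ℝ} (ha : 0 ≤ a)
    (hε : 0 < ε) : ∀ᶠ z in 𝓝 z₀, ∀ (y : EuclideanSpace ℝ ι) (ζ : EuclideanSpace ℂ ι),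
      ‖ζ - complexify ι y‖ ≤ a →
        ‖packetExt z ζ - packetExt z₀ ζ‖ ≤ ε * Real.exp (-a * ‖y‖) := by
  set B : ℝ := Real.pi ^ (-(Fintype.card ι : ℝ) / 4) *
    Real.exp (a * (a + 1) + (a ^ 2 + (a + 1) ^ 2) / 2 + (a + (a + 1)) * (‖z₀‖ + 1)) with hB
  have hpacket : ∀ (w : PhaseSpace ι) (y : EuclideanSpace ℝ ι) (ζ : EuclideanSpace ℂ ι),
      ‖w‖ ≤ ‖z₀‖ + 1 → ‖ζ - complexify ι y‖ ≤ a →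
        ‖packetExt w ζ‖ ≤ B * Real.exp (-(a + 1) * ‖y‖) := fun w y ζ hw hζ => by
    refine (norm_packetExt_le (b := a + 1) (by positivity) w y ζ hζ).trans ?_
    rw [hB]
    gcongr
  obtain ⟨R, hR⟩ : ∃ R : ℝ, 2 * B * Real.exp (-R) < ε := by
    have htends : Tendsto (fun R : ℝ => 2 * B * Real.exp (-R)) atTop (𝓝 (2 * B * 0)) :=
      Real.tendsto_exp_neg_atTop_nhds_zero.const_mul _
    rw [mul_zero] at htends
    exact (htends.eventually (gt_mem_nhds hε)).exists
  filter_upwards [eventually_norm_packetExt_sub_le_of_norm_le z₀ (a + R)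
      (show 0 < ε * Real.exp (-a * R) by positivity), Metric.ball_mem_nhds z₀ one_pos]
    with z hcompact hz y ζ hζ
  rcases le_or_gt ‖y‖ R with hy | hy
  · have hζR : ‖ζ‖ ≤ a + R := by
      have := norm_le_norm_add_norm_sub' ζ (complexify ι y)
      rw [LinearIsometry.norm_map] at this
      linarith
    exact (hcompact ζ hζR).trans
      (mul_le_mul_of_nonneg_left (Real.exp_le_exp.2 (by nlinarith)) hε.le)
  · have hz' : ‖z‖ ≤ ‖z₀‖ + 1 := by
      linarith [norm_le_norm_add_norm_sub' z z₀, mem_ball_iff_norm.1 hz]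
    calc ‖packetExt z ζ - packetExt z₀ ζ‖
        ≤ B * Real.exp (-(a + 1) * ‖y‖) + B * Real.exp (-(a + 1) * ‖y‖) :=
          norm_sub_le_of_le (hpacket z y ζ hz' hζ) (hpacket z₀ y ζ (by linarith) hζ)
      _ = 2 * B * Real.exp (-‖y‖) * Real.exp (-a * ‖y‖) := by
          rw [mul_assoc (2 * B), ← Real.exp_add]; ring_nf
      _ ≤ 2 * B * Real.exp (-R) * Real.exp (-a * ‖y‖) := by gcongr
      _ ≤ ε * Real.exp (-a * ‖y‖) := by gcongr

theorem continuous_gaussianPacket :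
    Continuous fun z : PhaseSpace ι => gaussianPacket z.1 z.2 := by
  refine continuous_iff_continuousAt.2 fun z₀ => ?_
  rw [ContinuousAt, GelfandShilov.withSeminorms.tendsto_nhds]
  intro h ε hε
  filter_upwards [eventually_norm_packetExt_sub_le z₀
    (div_pos (Real.exp_pos 1) h.2).le (half_pos hε)] with z hz
  refine lt_of_le_of_lt (GelfandShilov.gsNorm_le _ fun k m x => ?_) (half_lt_self hε)
  have hext : (gaussianPacket z.1 z.2 - gaussianPacket z₀.1 z₀.2 : GelfandShilov ι).1 =
      (packetExt z - packetExt z₀) ∘ complexify ι := by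
    rw [Pi.sub_comp, packetExt_comp_complexify, packetExt_comp_complexify]
    rfl
  rw [hext]
  exact gelfandShilov_bound_of_entire ((contDiff_packetExt z).sub (contDiff_packetExt z₀)) h.2
    hz k m x

theorem continuous_stft (u : GSDistribution ι) : Continuous (stft u) :=
  (u.continuous.comp continuous_gaussianPacket).const_mul _

end Packet

/-! ### Integrals of `Σ₁`-valued maps -/

namespace GelfandShilov

open scoped Nat

variable {ι : Type*} [Fintype ι]

theorem gsNorm_nonneg {h : ℝ} (hh : 0 < h) (f : GelfandShilov ι) : 0 ≤ gsNorm h f :=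
  apply_nonneg (gsSeminorm ⟨h, hh⟩) f

theorem gsNorm_anti {h h' : ℝ} (hh : 0 < h) (hhh' : h ≤ h') (f : GelfandShilov ι) :
    gsNorm h' f ≤ gsNorm h f :=
  gsNorm_le f fun k m x => le_trans (by gcongr) (le_gsNorm hh f k m x)

theorem continuous_gsNorm {h : ℝ} (hh : 0 < h) : Continuous (gsNorm h : GelfandShilov ι → ℝ) :=
  withSeminorms.continuous_seminorm (⟨h, hh⟩ : {h : ℝ // 0 < h})

theorem norm_iteratedFDeriv_le (f : GelfandShilov ι) (m : ℕ) (x : EuclideanSpace ℝ ι) :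
    ‖iteratedFDeriv ℝ m f x‖ ≤ m ! * gsNorm 1 f := by
  have hle := le_gsNorm one_pos f 0 m x
  rw [div_le_iff₀ (by positivity)] at hle
  simpa [mul_comm] using hle

/-- The linear map `f ↦ D^m f(x)` on `Σ₁`. -/
def iteratedFDerivAt (m : ℕ) (x : EuclideanSpace ℝ ι) :
    GelfandShilov ι →ₗ[ℂ] (EuclideanSpace ℝ ι [×m]→L[ℝ] ℂ) where
  toFun f := iteratedFDeriv ℝ m f x
  map_add' f g := by
    rw [coe_add, iteratedFDeriv_add_apply (f.contDiffAt m x) (g.contDiffAt m x)]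
  map_smul' c f := by
    rw [coe_smul, iteratedFDeriv_const_smul_apply (f.contDiffAt m x), RingHom.id_apply]

theorem iteratedFDerivAt_apply (m : ℕ) (x : EuclideanSpace ℝ ι) (f : GelfandShilov ι) :
    iteratedFDerivAt m x f = iteratedFDeriv ℝ m f x := rfl

theorem continuous_iteratedFDerivAt (m : ℕ) (x : EuclideanSpace ℝ ι) :
    Continuous (iteratedFDerivAt m x : GelfandShilov ι → _) := by
  refine withSeminorms.continuous_normedSpace_rng _ (iteratedFDerivAt m x)
    ⟨{⟨1, one_pos⟩}, m !, fun f => ?_⟩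
  simp only [Finset.sup_singleton]
  exact norm_iteratedFDeriv_le f m x

theorem exists_norm_le_mul_gsNorm (u : GSDistribution ι) : ∃ h : ℝ, 0 < h ∧ ∃ C : ℝ, 0 ≤ C ∧
    ∀ f, ‖u f‖ ≤ C * gsNorm h f := by
  obtain ⟨s, C, -, hC⟩ := Seminorm.bound_of_continuous withSeminorms
    ((normSeminorm ℂ ℂ).comp u.toLinearMap) (continuous_norm.comp u.continuous)
  obtain ⟨h, hs⟩ : ∃ h : {h : ℝ // 0 < h}, ∀ i ∈ s, h ≤ i :=
    Finset.exists_le (α := {h : ℝ // 0 < h}ᵒᵈ) s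
  exact ⟨h, h.2, C, C.2, fun f => (hC f).trans <| mul_le_mul_of_nonneg_left
    (Seminorm.finset_sup_apply_le (gsNorm_nonneg h.2 f) fun i hi => gsNorm_anti h.2 (hs i hi) f)
    C.2⟩

section Jet

variable (ι) in
/-- The indices `(k, m, x)` of the quantities `|x|^k D^m f(x)` that enter `gsNorm`. -/
abbrev JetIndex : Type _ := ℕ × ℕ × EuclideanSpace ℝ ι

variable (ι) in
/-- The Banach space of bounded families of multilinear maps, which carries the jets of `Σ₁`. -/
abbrev JetSpace : Type _ := lp (fun p : JetIndex ι => EuclideanSpace ℝ ι [×p.2.1]→L[ℝ] ℂ) ∞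

/-- The factor `|x|^k / (h^(k+m) k! m!)` of `D^m f(x)` in `gsNorm h f`. -/
def jetWeight (h : ℝ) (p : JetIndex ι) : ℝ :=
  ‖p.2.2‖ ^ p.1 / (h ^ (p.1 + p.2.1) * (p.1 ! * p.2.1 !))

variable {h : ℝ} (hh : 0 < h)

include hh in
theorem norm_jetWeight_smul (p : JetIndex ι) (f : GelfandShilov ι) :
    ‖((jetWeight h p : ℝ) : ℂ) • iteratedFDerivAt p.2.1 p.2.2 f‖ =
      ‖p.2.2‖ ^ p.1 * ‖iteratedFDeriv ℝ p.2.1 f p.2.2‖ /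
        (h ^ (p.1 + p.2.1) * (p.1 ! * p.2.1 !)) := by
  rw [norm_smul, Complex.norm_real, Real.norm_of_nonneg (by unfold jetWeight; positivity),
    jetWeight, iteratedFDerivAt_apply]
  ring

/-- The embedding `f ↦ (|x|^k D^m f(x) / (h^(k+m) k! m!))`, which is isometric for `gsNorm h`. It
reduces integrals and functionals on `Σ₁` to those on a Banach space. -/
def jet : GelfandShilov ι →ₗ[ℂ] JetSpace ι where
  toFun f := ⟨fun p => ((jetWeight h p : ℝ) : ℂ) • iteratedFDerivAt p.2.1 p.2.2 f, by
    refine memℓp_infty_iff.2 ⟨gsNorm h f, ?_⟩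
    rintro _ ⟨p, rfl⟩
    simp only [norm_jetWeight_smul hh]
    exact le_gsNorm hh f _ _ _⟩
  map_add' f g := Subtype.ext <| funext fun p =>
    (congrArg (((jetWeight h p : ℝ) : ℂ) • ·) (map_add (iteratedFDerivAt p.2.1 p.2.2) f g)).trans
      (smul_add _ _ _)
  map_smul' c f := Subtype.ext <| funext fun p =>
    (congrArg (((jetWeight h p : ℝ) : ℂ) • ·) (map_smul (iteratedFDerivAt p.2.1 p.2.2) c f)).trans
      (smul_comm _ _ _)

theorem jet_apply (f : GelfandShilov ι) (p : JetIndex ι) :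
    jet hh f p = ((jetWeight h p : ℝ) : ℂ) • iteratedFDeriv ℝ p.2.1 f p.2.2 := rfl

theorem norm_jet (f : GelfandShilov ι) : ‖jet hh f‖ = gsNorm h f := by
  rw [lp.norm_eq_ciSup, gsNorm]
  exact iSup_congr fun p => norm_jetWeight_smul hh p f

theorem jet_injective : Function.Injective (jet (ι := ι) hh) := by
  rw [← LinearMap.ker_eq_bot, LinearMap.ker_eq_bot']
  intro f hf
  have hnorm : gsNorm h f = 0 := by rw [← norm_jet hh, hf, norm_zero]
  refine Subtype.ext (funext fun x => norm_le_zero_iff.1 ?_)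
  simpa [hnorm] using le_gsNorm hh f 0 0 x

theorem continuous_jet : Continuous (jet (ι := ι) hh) := by
  refine withSeminorms.continuous_normedSpace_rng (JetSpace ι) (𝕝₂ := ℂ) (jet hh)
    ⟨{⟨h, hh⟩}, 1, fun f => ?_⟩
  simp only [Finset.sup_singleton, one_smul]
  exact (norm_jet hh f).le

theorem exists_apply_jet_eq (u : GSDistribution ι) :
    ∃ (h : ℝ) (hh : 0 < h) (v : JetSpace ι →L[ℂ] ℂ), ∀ f, v (jet hh f) = u f := by
  obtain ⟨h, hh, C, -, hC⟩ := exists_norm_le_mul_gsNorm u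
  let e := LinearEquiv.ofInjective (jet (ι := ι) hh) (jet_injective hh)
  have hnorm : ∀ f, ‖e f‖ = gsNorm h f := norm_jet hh
  let v₀ : LinearMap.range (jet (ι := ι) hh) →L[ℂ] ℂ :=
    LinearMap.mkContinuous (u.toLinearMap ∘ₗ e.symm.toLinearMap) C fun x => by
      obtain ⟨f, rfl⟩ := e.surjective x
      simpa [hnorm] using hC f
  obtain ⟨v, hv, -⟩ := exists_extension_norm_eq _ v₀
  exact ⟨h, hh, v, fun f => (hv (e f)).trans (by simp [v₀])⟩

end Jet

section Integral

variable {Z : Type*} [TopologicalSpace Z] [SecondCountableTopology Z] [MeasurableSpace Z]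
  [OpensMeasurableSpace Z] {μ : Measure Z} {F : Z → GelfandShilov ι}

theorem integrable_iteratedFDeriv (hF : Continuous F)
    (hint : Integrable (fun z => gsNorm 1 (F z)) μ) (m : ℕ) (x : EuclideanSpace ℝ ι) :
    Integrable (fun z => iteratedFDeriv ℝ m (F z) x) μ :=
  (hint.const_mul (m ! : ℝ)).mono'
    ((continuous_iteratedFDerivAt m x).comp hF).aestronglyMeasurable
    (Eventually.of_forall fun z => norm_iteratedFDeriv_le (F z) m x)

theorem hasFDerivAt_integral_iteratedFDeriv (hF : Continuous F)
    (hint : Integrable (fun z => gsNorm 1 (F z)) μ) (m : ℕ) (x : EuclideanSpace ℝ ι) :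
    HasFDerivAt (fun x => ∫ z, iteratedFDeriv ℝ m (F z) x ∂μ)
      (∫ z, fderiv ℝ (iteratedFDeriv ℝ m (F z)) x ∂μ) x := by
  refine hasFDerivAt_integral_of_dominated_of_fderiv_le (s := univ)
    (F' := fun x z => fderiv ℝ (iteratedFDeriv ℝ m (F z)) x)
    (bound := fun z => (m + 1)! * gsNorm 1 (F z)) univ_mem
    (Eventually.of_forall fun y => (integrable_iteratedFDeriv hF hint m y).1)
    (integrable_iteratedFDeriv hF hint m x) ?_ (Eventually.of_forall fun z y _ => ?_)
    (hint.const_mul _) (Eventually.of_forall fun z y _ => ?_)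
  · simp only [fderiv_iteratedFDeriv, Function.comp_apply]
    exact (LinearIsometryEquiv.continuous _).comp_aestronglyMeasurable
      (integrable_iteratedFDeriv hF hint (m + 1) x).1
  · rw [norm_fderiv_iteratedFDeriv]
    exact norm_iteratedFDeriv_le (F z) (m + 1) y
  · exact ((F z).contDiff.differentiable_iteratedFDeriv
      (mod_cast ENat.natCast_lt_top m) y).hasFDerivAt

theorem iteratedFDeriv_integral (hF : Continuous F)
    (hint : Integrable (fun z => gsNorm 1 (F z)) μ) (m : ℕ) :
    iteratedFDeriv ℝ m (fun x => ∫ z, F z x ∂μ) =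
      fun x => ∫ z, iteratedFDeriv ℝ m (F z) x ∂μ := by
  induction m with
  | zero =>
    funext x
    rw [iteratedFDeriv_zero_eq_comp]
    exact (((continuousMultilinearCurryFin0 ℝ (EuclideanSpace ℝ ι) ℂ).symm
      |>.toContinuousLinearEquiv).integral_comp_comm (μ := μ) fun z => F z x).symm
  | succ m ih =>
    funext x
    rw [iteratedFDeriv_succ_eq_comp_left, Function.comp_apply, ih,
      (hasFDerivAt_integral_iteratedFDeriv hF hint m x).fderiv]
    exact (((continuousMultilinearCurryLeftEquiv ℝ (fun _ : Fin (m + 1) => EuclideanSpace ℝ ι) ℂ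
      ).symm.toContinuousLinearEquiv).integral_comp_comm (𝕜 := ℝ) (μ := μ)
        fun z => fderiv ℝ (iteratedFDeriv ℝ m (F z)) x).symm

theorem isGelfandShilov_integral (hF : Continuous F)
    (hint : ∀ h : ℝ, 0 < h → Integrable (fun z => gsNorm h (F z)) μ) :
    IsGelfandShilov fun x => ∫ z, F z x ∂μ := by
  have hint₁ := hint 1 one_pos
  have hderiv := iteratedFDeriv_integral hF hint₁
  refine ⟨contDiff_of_differentiable_iteratedFDeriv fun m _ => ?_, fun h hh =>
    ⟨∫ z, gsNorm h (F z) ∂μ, fun k m x => ?_⟩⟩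
  · rw [hderiv]
    exact fun x => (hasFDerivAt_integral_iteratedFDeriv hF hint₁ m x).differentiableAt
  · rw [hderiv, mul_div_right_comm]
    calc ‖x‖ ^ k / (h ^ (k + m) * (k ! * m !)) * ‖∫ z, iteratedFDeriv ℝ m (F z) x ∂μ‖
        ≤ ‖x‖ ^ k / (h ^ (k + m) * (k ! * m !)) * ∫ z, ‖iteratedFDeriv ℝ m (F z) x‖ ∂μ := by
          gcongr
          exact norm_integral_le_integral_norm _
      _ = ∫ z, ‖x‖ ^ k / (h ^ (k + m) * (k ! * m !)) * ‖iteratedFDeriv ℝ m (F z) x‖ ∂μ :=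
          (integral_const_mul _ _).symm
      _ ≤ ∫ z, gsNorm h (F z) ∂μ := by
          refine integral_mono ((integrable_iteratedFDeriv hF hint₁ m x).norm.const_mul _)
            (hint h hh) fun z => ?_
          exact (mul_div_right_comm _ _ _).symm.trans_le (le_gsNorm hh (F z) k m x)

theorem exists_eq_integral (hF : Continuous F)
    (hint : ∀ h : ℝ, 0 < h → Integrable (fun z => gsNorm h (F z)) μ) :
    ∃ f : GelfandShilov ι, (∀ x, f x = ∫ z, F z x ∂μ) ∧
      ∀ u : GSDistribution ι, u f = ∫ z, u (F z) ∂μ := by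
  let f : GelfandShilov ι := ⟨fun x => ∫ z, F z x ∂μ, isGelfandShilov_integral hF hint⟩
  refine ⟨f, fun _ => rfl, fun u => ?_⟩
  obtain ⟨h, hh, v, hv⟩ := exists_apply_jet_eq u
  have hjet : Integrable (fun z => jet hh (F z)) μ :=
    (hint h hh).mono' ((continuous_jet hh).comp hF).aestronglyMeasurable
      (Eventually.of_forall fun z => (norm_jet hh (F z)).le)
  have hjet_eq : jet hh f = ∫ z, jet hh (F z) ∂μ := by
    ext p : 2
    refine Eq.trans ?_ ((lp.evalCLM ℂ (fun p : JetIndex ι => EuclideanSpace ℝ ι [×p.2.1]→L[ℝ] ℂ) ∞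
      p).integral_comp_comm hjet)
    change _ = ∫ z, ((jetWeight h p : ℝ) : ℂ) • iteratedFDeriv ℝ p.2.1 (F z) p.2.2 ∂μ
    rw [jet_apply, integral_smul]
    exact congrArg _ (congrFun (iteratedFDeriv_integral hF (hint 1 one_pos) p.2.1) p.2.2)
  simp only [← hv]
  rw [hjet_eq, ← v.integral_comp_comm hjet]

end Integral

end GelfandShilov

/-! ### Exponential decay -/

section ExponentialDecay

open scoped ContDiff Nat FourierTransform

theorem le_mul_exp_of_forall_pow_mul_le {t A N h : ℝ} (hh : 0 < h)
    (hpow : ∀ k : ℕ, t ^ k * A ≤ N * (h ^ k * k !)) : A ≤ 2 * N * Real.exp (-(t / (2 * h))) := by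
  have hexp : HasSum (fun k : ℕ => A * ((t / (2 * h)) ^ k / k !))
      (A * Real.exp (t / (2 * h))) := by
    rw [Real.exp_eq_exp_ℝ]
    exact (NormedSpace.expSeries_div_hasSum_exp (t / (2 * h))).mul_left A
  have hgeom : HasSum (fun k : ℕ => N * (1 / 2 : ℝ) ^ k) (N * 2) := hasSum_geometric_two.mul_left N
  rw [Real.exp_neg, ← div_eq_mul_inv, le_div_iff₀ (Real.exp_pos _), mul_comm 2 N]
  refine hasSum_le (fun k => ?_) hexp hgeom
  rw [← mul_div_assoc, div_le_iff₀ (by positivity), div_pow, mul_pow, div_pow, one_pow,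
    ← mul_div_assoc, div_le_iff₀ (by positivity)]
  calc A * t ^ k = t ^ k * A := mul_comm _ _
    _ ≤ N * (h ^ k * k !) := hpow k
    _ = N * (1 / 2 ^ k) * k ! * (2 ^ k * h ^ k) := by field_simp

theorem integrable_exp_neg_mul_norm {V : Type*} [NormedAddCommGroup V] [NormedSpace ℝ V]
    [FiniteDimensional ℝ V] [MeasurableSpace V] [BorelSpace V] (μ : Measure V)
    [μ.IsAddHaarMeasure] {R : ℝ} (hR : 0 < R) :
    Integrable (fun x : V => Real.exp (-R * ‖x‖)) μ := by
  set n : ℕ := Module.finrank ℝ V + 1 with hn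
  have hpoly : Integrable (fun x : V => (1 + ‖x‖) ^ (-(n : ℝ))) μ :=
    integrable_one_add_norm (by rw [hn]; push_cast; linarith)
  refine (hpoly.const_mul (n ! * Real.exp R / R ^ n)).mono'
    (by fun_prop) (Eventually.of_forall fun x => ?_)
  have hle := Real.pow_div_factorial_le_exp (R * (1 + ‖x‖)) (by positivity) n
  rw [div_le_iff₀ (by positivity), mul_pow, mul_add, Real.exp_add, mul_one] at hle
  rw [Real.norm_of_nonneg (Real.exp_pos _).le, Real.rpow_neg (by positivity), Real.rpow_natCast,
    neg_mul, Real.exp_neg, ← div_eq_mul_inv, div_div, inv_eq_one_div,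
    div_le_div_iff₀ (Real.exp_pos _) (by positivity)]
  linarith

theorem norm_iteratedFDeriv_mul_le_of_forall_le {𝕜 V 𝔸 : Type*} [NontriviallyNormedField 𝕜]
    [NormedAddCommGroup V] [NormedSpace 𝕜 V] [NormedRing 𝔸] [NormedAlgebra 𝕜 𝔸] {f g : V → 𝔸}
    {y : V} {A B h : ℝ} (hf : ContDiff 𝕜 ∞ f) (hg : ContDiff 𝕜 ∞ g)
    (hA : ∀ j : ℕ, ‖iteratedFDeriv 𝕜 j f y‖ ≤ A * (h ^ j * j !))
    (hB : ∀ j : ℕ, ‖iteratedFDeriv 𝕜 j g y‖ ≤ B * (h ^ j * j !)) (k : ℕ) :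
    ‖iteratedFDeriv 𝕜 k (fun y => f y * g y) y‖ ≤ A * B * ((2 * h) ^ k * k !) := by
  have hterm : ∀ j ∈ Finset.range (k + 1), (k.choose j : ℝ) * ‖iteratedFDeriv 𝕜 j f y‖ *
      ‖iteratedFDeriv 𝕜 (k - j) g y‖ ≤ A * B * (h ^ k * k !) := fun j hj => by
    have hjk : j ≤ k := Nat.lt_succ_iff.1 (Finset.mem_range.1 hj)
    calc (k.choose j : ℝ) * ‖iteratedFDeriv 𝕜 j f y‖ * ‖iteratedFDeriv 𝕜 (k - j) g y‖
        = k.choose j * (‖iteratedFDeriv 𝕜 j f y‖ * ‖iteratedFDeriv 𝕜 (k - j) g y‖) := by ring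
      _ ≤ k.choose j * (A * (h ^ j * j !) * (B * (h ^ (k - j) * (k - j)!))) :=
          mul_le_mul_of_nonneg_left (mul_le_mul (hA j) (hB (k - j)) (norm_nonneg _)
            ((norm_nonneg _).trans (hA j))) (Nat.cast_nonneg _)
      _ = A * B * (h ^ (j + (k - j)) * (k.choose j * j ! * (k - j)! : ℕ)) := by
          push_cast [pow_add]; ring
      _ = A * B * (h ^ k * k !) := by
          rw [Nat.choose_mul_factorial_mul_factorial hjk, Nat.add_sub_cancel' hjk]
  have hAB : 0 ≤ A * B * (h ^ k * k !) :=
    le_trans (by positivity) (hterm 0 (Finset.mem_range.2 k.succ_pos))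
  have hcard : ((k + 1 : ℕ) : ℝ) ≤ 2 ^ k := mod_cast Nat.lt_two_pow_self
  calc ‖iteratedFDeriv 𝕜 k (fun y => f y * g y) y‖
      ≤ ∑ j ∈ Finset.range (k + 1), (k.choose j : ℝ) * ‖iteratedFDeriv 𝕜 j f y‖ *
          ‖iteratedFDeriv 𝕜 (k - j) g y‖ :=
        norm_iteratedFDeriv_mul_le (N := k) (hf.of_le (mod_cast le_top))
          (hg.of_le (mod_cast le_top)) y le_rfl
    _ ≤ (k + 1 : ℕ) * (A * B * (h ^ k * k !)) := by
        simpa using Finset.sum_le_card_nsmul _ _ _ hterm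
    _ ≤ 2 ^ k * (A * B * (h ^ k * k !)) := by gcongr
    _ = A * B * ((2 * h) ^ k * k !) := by rw [mul_pow]; ring

section Fourier

variable {V E : Type*} [NormedAddCommGroup V] [InnerProductSpace ℝ V] [FiniteDimensional ℝ V]
  [MeasurableSpace V] [BorelSpace V] [NormedAddCommGroup E] [NormedSpace ℂ E]

theorem pow_mul_norm_fourier_le_integral_norm_iteratedFDeriv {g : V → E} (hg : ContDiff ℝ ∞ g)
    (hint : ∀ n : ℕ, Integrable (iteratedFDeriv ℝ n g)) (n : ℕ) (w : V) :
    (2 * Real.pi * ‖w‖) ^ n * ‖𝓕 g w‖ ≤ ∫ y, ‖iteratedFDeriv ℝ n g y‖ := by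
  rcases n.eq_zero_or_pos with rfl | hn
  · simp only [pow_zero, one_mul, norm_iteratedFDeriv_zero]
    exact VectorFourier.norm_fourierIntegral_le_integral_norm _ _ _ _ _
  rcases eq_or_ne w 0 with rfl | hw
  · rw [norm_zero, mul_zero, zero_pow hn.ne', zero_mul]
    positivity
  have hdiag : ‖𝓕 (iteratedFDeriv ℝ n g) w fun _ => w‖ =
      (2 * Real.pi * ‖w‖) ^ n * ‖𝓕 g w‖ * ‖w‖ ^ n := by
    rw [Real.fourier_iteratedFDeriv (N := ⊤) hg (fun n _ => hint n) le_top]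
    simp only [VectorFourier.fourierPowSMulRight_apply, norm_smul, norm_pow, norm_neg, norm_mul,
      Complex.norm_ofNat, Complex.norm_real, Real.norm_of_nonneg Real.pi_pos.le, Complex.norm_I,
      mul_one, Finset.prod_const, Finset.card_univ, Fintype.card_fin,
      neg_apply, innerSL_apply_apply ℝ, real_inner_self_eq_norm_sq, norm_norm]
    ring
  refine le_of_mul_le_mul_right ?_ (pow_pos (norm_pos_iff.2 hw) n)
  rw [← hdiag]
  refine (ContinuousMultilinearMap.le_opNorm _ _).trans ?_
  rw [Finset.prod_const, Finset.card_univ, Fintype.card_fin]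
  gcongr
  exact VectorFourier.norm_fourierIntegral_le_integral_norm _ _ _ _ _

theorem norm_fourier_le_exp {g : V → E} (hg : ContDiff ℝ ∞ g)
    (hint : ∀ n : ℕ, Integrable (iteratedFDeriv ℝ n g)) {K h : ℝ} (hh : 0 < h)
    (hK : ∀ n : ℕ, ∫ y, ‖iteratedFDeriv ℝ n g y‖ ≤ K * (h ^ n * n !)) (w : V) :
    ‖𝓕 g w‖ ≤ 2 * K * Real.exp (-(2 * Real.pi * ‖w‖ / (2 * h))) :=
  le_mul_exp_of_forall_pow_mul_le hh fun n =>
    (pow_mul_norm_fourier_le_integral_norm_iteratedFDeriv hg hint n w).trans (hK n)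

end Fourier

end ExponentialDecay

/-! ### Short-time Fourier transform of test functions and inversion formula -/

section Inversion

open scoped ContDiff Nat FourierTransform

variable {ι : Type*} [Fintype ι]

instance : (volume : Measure (PhaseSpace ι)).IsAddHaarMeasure :=
  inferInstanceAs ((volume : Measure (EuclideanSpace ℝ ι)).prod volume).IsAddHaarMeasure

/-- Decay of a function on a normed space faster than every exponential `exp (-R * ‖x‖)`. -/
def HasSuperexpDecay {V E : Type*} [Norm V] [Norm E] (G : V → E) : Prop :=
  ∀ R : ℝ, ∃ C : ℝ, 0 ≤ C ∧ ∀ x, ‖G x‖ ≤ C * Real.exp (-R * ‖x‖)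

theorem HasSuperexpDecay.const_mul {V A : Type*} [Norm V] [NormedRing A] {G : V → A}
    (hG : HasSuperexpDecay G) (c : A) : HasSuperexpDecay fun x => c * G x := fun R => by
  obtain ⟨C, hC0, hC⟩ := hG R
  refine ⟨‖c‖ * C, by positivity, fun x => (norm_mul_le _ _).trans ?_⟩
  rw [mul_assoc]
  exact mul_le_mul_of_nonneg_left (hC x) (norm_nonneg c)

theorem GelfandShilov.norm_iteratedFDeriv_le_exp {h : ℝ} (hh : 0 < h) (f : GelfandShilov ι) (m : ℕ)
    (y : EuclideanSpace ℝ ι) : ‖iteratedFDeriv ℝ m f y‖ ≤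
      2 * gsNorm h f * Real.exp (-(‖y‖ / (2 * h))) * (h ^ m * m !) := by
  have hpow (k : ℕ) : ‖y‖ ^ k * ‖iteratedFDeriv ℝ m f y‖ ≤
      gsNorm h f * (h ^ m * m !) * (h ^ k * k !) := by
    have hle := le_gsNorm hh f k m y
    rw [div_le_iff₀ (by positivity)] at hle
    exact hle.trans_eq (by ring)
  exact (le_mul_exp_of_forall_pow_mul_le hh hpow).trans_eq (by ring)

theorem gaussianPacket_zero_apply (x y : EuclideanSpace ℝ ι) :
    gaussianPacket x 0 y = (gaussianWindow (y - x) : ℂ) := by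
  simp [gaussianPacket_apply]

/-- The function `f φ(· - x)`, where `φ` is the Gaussian window. -/
def windowed (f : GelfandShilov ι) (x y : EuclideanSpace ℝ ι) : ℂ := f y * gaussianPacket x 0 y

theorem contDiff_windowed (f : GelfandShilov ι) (x : EuclideanSpace ℝ ι) :
    ContDiff ℝ ∞ (windowed f x) := f.contDiff.mul (gaussianPacket x 0).contDiff

theorem iteratedFDeriv_gaussianPacket_zero (m : ℕ) (x y : EuclideanSpace ℝ ι) :
    iteratedFDeriv ℝ m (gaussianPacket x 0) y =
      iteratedFDeriv ℝ m (gaussianPacket (0 : EuclideanSpace ℝ ι) 0) (y - x) := by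
  rw [← iteratedFDeriv_comp_sub]
  congr 1
  funext w
  rw [gaussianPacket_zero_apply, gaussianPacket_zero_apply, sub_zero]

theorem exists_norm_iteratedFDeriv_windowed_le {R : ℝ} (hR : 0 < R) (f : GelfandShilov ι) :
    ∃ N : ℝ, 0 ≤ N ∧ ∀ (k : ℕ) (x y : EuclideanSpace ℝ ι),
      ‖iteratedFDeriv ℝ k (windowed f x) y‖ ≤
        N * Real.exp (-R * ‖x‖) * ((2 * R)⁻¹ ^ k * k !) * Real.exp (-R * ‖y‖) := by
  have hh : 0 < (4 * R)⁻¹ := by positivity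
  set A := GelfandShilov.gsNorm (4 * R)⁻¹ f
  set B := GelfandShilov.gsNorm (4 * R)⁻¹ (gaussianPacket (0 : EuclideanSpace ℝ ι) 0)
  have hA : 0 ≤ A := GelfandShilov.gsNorm_nonneg hh f
  have hB : 0 ≤ B := GelfandShilov.gsNorm_nonneg hh _
  refine ⟨2 * A * (2 * B), by positivity, fun k x y => ?_⟩
  have hrate (t : ℝ) : t / (2 * (4 * R)⁻¹) = 2 * R * t := by field_simp; norm_num
  have hx : ‖x‖ ≤ ‖y‖ + ‖y - x‖ := by simpa using norm_sub_le y (y - x)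
  have hexp : Real.exp (-(2 * R * ‖y‖)) * Real.exp (-(2 * R * ‖y - x‖)) ≤
      Real.exp (-R * ‖x‖) * Real.exp (-R * ‖y‖) := by
    rw [← Real.exp_add, ← Real.exp_add, Real.exp_le_exp]
    nlinarith [norm_nonneg (y - x)]
  have hleibniz := norm_iteratedFDeriv_mul_le_of_forall_le f.contDiff
    (gaussianPacket x 0).contDiff (fun j => f.norm_iteratedFDeriv_le_exp hh j y)
    (fun j => (iteratedFDeriv_gaussianPacket_zero j x y).symm ▸
      GelfandShilov.norm_iteratedFDeriv_le_exp hh (gaussianPacket 0 0) j (y - x)) k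
  rw [hrate, hrate] at hleibniz
  calc ‖iteratedFDeriv ℝ k (windowed f x) y‖
      ≤ 2 * A * Real.exp (-(2 * R * ‖y‖)) * (2 * B * Real.exp (-(2 * R * ‖y - x‖))) *
          ((2 * (4 * R)⁻¹) ^ k * k !) := hleibniz
    _ = 2 * A * (2 * B) * (Real.exp (-(2 * R * ‖y‖)) * Real.exp (-(2 * R * ‖y - x‖))) *
          ((2 * R)⁻¹ ^ k * k !) := by
        rw [show 2 * (4 * R)⁻¹ = (2 * R)⁻¹ by field_simp; norm_num]; ring
    _ ≤ 2 * A * (2 * B) * (Real.exp (-R * ‖x‖) * Real.exp (-R * ‖y‖)) *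
          ((2 * R)⁻¹ ^ k * k !) := by gcongr
    _ = 2 * A * (2 * B) * Real.exp (-R * ‖x‖) * ((2 * R)⁻¹ ^ k * k !) *
          Real.exp (-R * ‖y‖) := by ring

theorem integrable_iteratedFDeriv_windowed (f : GelfandShilov ι) (x : EuclideanSpace ℝ ι)
    (k : ℕ) : Integrable (iteratedFDeriv ℝ k (windowed f x)) := by
  obtain ⟨N, -, hN⟩ := exists_norm_iteratedFDeriv_windowed_le one_pos f
  exact ((integrable_exp_neg_mul_norm volume one_pos).const_mul _).mono'
    ((contDiff_windowed f x).continuous_iteratedFDeriv (mod_cast le_top)).aestronglyMeasurable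
    (Eventually.of_forall fun y => hN k x y)

theorem integrable_windowed (f : GelfandShilov ι) (x : EuclideanSpace ℝ ι) :
    Integrable (windowed f x) :=
  f.integrable.mul_bdd (gaussianPacket x 0).contDiff.continuous.aestronglyMeasurable
    (Eventually.of_forall (GelfandShilov.norm_le_gsNorm_one (gaussianPacket x 0)))

theorem exists_norm_fourier_windowed_le {R : ℝ} (hR : 0 < R) (f : GelfandShilov ι) :
    ∃ N : ℝ, 0 ≤ N ∧ ∀ x w : EuclideanSpace ℝ ι, ‖𝓕 (windowed f x) w‖ ≤
      N * Real.exp (-R * ‖x‖) * Real.exp (-R * (2 * Real.pi * ‖w‖)) := by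
  obtain ⟨N, hN0, hN⟩ := exists_norm_iteratedFDeriv_windowed_le hR f
  set I : ℝ := ∫ y : EuclideanSpace ℝ ι, Real.exp (-R * ‖y‖)
  have hI : 0 ≤ I := integral_nonneg fun y => (Real.exp_pos _).le
  refine ⟨2 * (N * I), by positivity, fun x w => ?_⟩
  have hint (n : ℕ) : ∫ y, ‖iteratedFDeriv ℝ n (windowed f x) y‖ ≤
      N * Real.exp (-R * ‖x‖) * I * ((2 * R)⁻¹ ^ n * n !) := by
    rw [mul_right_comm _ I, ← integral_const_mul]
    exact integral_mono (integrable_iteratedFDeriv_windowed f x n).norm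
      ((integrable_exp_neg_mul_norm volume hR).const_mul _) fun y => hN n x y
  refine (norm_fourier_le_exp (contDiff_windowed f x) (integrable_iteratedFDeriv_windowed f x)
    (by positivity) hint w).trans_eq ?_
  rw [show -(2 * Real.pi * ‖w‖ / (2 * (2 * R)⁻¹)) = -R * (2 * Real.pi * ‖w‖) by field_simp]
  ring

variable (ι) in
/-- The normalizing factor `(2π)^(-n/2)` of the short-time Fourier transform. -/
def stftConst : ℝ := (2 * Real.pi) ^ (-(Fintype.card ι : ℝ) / 2)

theorem stftConst_pos : 0 < stftConst ι := by unfold stftConst; positivity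

theorem stftConst_mul_self_mul_two_pi_pow :
    stftConst ι * stftConst ι * (2 * Real.pi) ^ Fintype.card ι = 1 := by
  rw [stftConst, ← Real.rpow_natCast, ← Real.rpow_add (by positivity),
    ← Real.rpow_add (by positivity), add_halves, neg_add_cancel, Real.rpow_zero]

theorem stft_eq (u : GSDistribution ι) (z : PhaseSpace ι) :
    stft u z = (stftConst ι : ℂ) * u (gaussianPacket z.1 z.2) := rfl

theorem norm_stft (u : GSDistribution ι) (z : PhaseSpace ι) :
    ‖stft u z‖ = stftConst ι * ‖u (gaussianPacket z.1 z.2)‖ := by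
  rw [stft_eq, norm_mul, Complex.norm_real, Real.norm_of_nonneg stftConst_pos.le]

theorem stft_ofGS (f : GelfandShilov ι) (z : PhaseSpace ι) :
    stft (GSDistribution.ofGS f) z =
      stftConst ι * 𝓕 (windowed f z.1) ((2 * Real.pi)⁻¹ • z.2) := by
  rw [stft_eq, GSDistribution.ofGS_apply, Real.fourier_eq']
  congr 2
  funext y
  have hphase : ((-2 * Real.pi * ((2 * Real.pi)⁻¹ * inner ℝ y z.2) : ℝ) : ℂ) * Complex.I =
      -Complex.I * (inner ℝ y z.2 : ℝ) := by
    rw [neg_mul, neg_mul, mul_inv_cancel_left₀ (by positivity)]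
    push_cast; ring
  rw [windowed, gaussianPacket_apply, gaussianPacket_zero_apply, smul_eq_mul, inner_smul_right,
    hphase]
  ring

theorem hasSuperexpDecay_stft_ofGS (f : GelfandShilov ι) :
    HasSuperexpDecay (stft (GSDistribution.ofGS f)) := fun R => by
  wlog hR : 0 < R generalizing R
  · obtain ⟨C, hC0, hC⟩ := this 1 one_pos
    refine ⟨C, hC0, fun z => (hC z).trans ?_⟩
    gcongr
    linarith
  obtain ⟨N, hN0, hN⟩ := exists_norm_fourier_windowed_le hR f
  refine ⟨stftConst ι * N, mul_nonneg stftConst_pos.le hN0, fun z => ?_⟩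
  have hz : ‖z‖ ≤ ‖z.1‖ + ‖z.2‖ := max_le_add_of_nonneg (norm_nonneg _) (norm_nonneg _)
  have hscale : 2 * Real.pi * ‖(2 * Real.pi)⁻¹ • z.2‖ = ‖z.2‖ := by
    rw [norm_smul, Real.norm_of_nonneg (by positivity), mul_inv_cancel_left₀ (by positivity)]
  rw [stft_ofGS, norm_mul, Complex.norm_real, Real.norm_of_nonneg stftConst_pos.le, mul_assoc]
  refine mul_le_mul_of_nonneg_left ((hN _ _).trans ?_) stftConst_pos.le
  rw [hscale, mul_assoc, ← Real.exp_add]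
  gcongr
  nlinarith

theorem integrable_stft_ofGS_snd (f : GelfandShilov ι) (x : EuclideanSpace ℝ ι) :
    Integrable fun ξ => stft (GSDistribution.ofGS f) (x, ξ) := by
  obtain ⟨C, hC0, hC⟩ := hasSuperexpDecay_stft_ofGS f 1
  refine ((integrable_exp_neg_mul_norm volume one_pos).const_mul C).mono'
    ((continuous_stft _).comp (Continuous.prodMk_right x)).aestronglyMeasurable
    (Eventually.of_forall fun ξ => (hC _).trans ?_)
  gcongr C * Real.exp ?_
  linarith [norm_snd_le (x, ξ)]

theorem integrable_fourier_windowed (f : GelfandShilov ι) (x : EuclideanSpace ℝ ι) :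
    Integrable (𝓕 (windowed f x)) := by
  have hc : (stftConst ι : ℂ) ≠ 0 := mod_cast stftConst_pos.ne'
  have hdilate := ((integrable_stft_ofGS_snd f x).const_mul (stftConst ι : ℂ)⁻¹).comp_smul
    (R := 2 * Real.pi) (by positivity)
  simpa only [stft_ofGS, inv_mul_cancel_left₀ hc,
    inv_smul_smul₀ (show 2 * Real.pi ≠ 0 by positivity)] using hdilate

theorem windowed_eq_integral (f : GelfandShilov ι) (x y : EuclideanSpace ℝ ι) :
    windowed f x y = stftConst ι * ∫ ξ, stft (GSDistribution.ofGS f) (x, ξ) *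
      Complex.exp (Complex.I * (inner ℝ y ξ : ℝ)) := by
  have hinv := congr_fun ((contDiff_windowed f x).continuous.fourierInv_fourier_eq
    (integrable_windowed f x) (integrable_fourier_windowed f x)) y
  have hdilate := Measure.integral_comp_inv_smul (volume : Measure (EuclideanSpace ℝ ι))
    (fun v => Complex.exp (((2 * Real.pi * inner ℝ v y : ℝ) : ℂ) * Complex.I) •
      𝓕 (windowed f x) v) (2 * Real.pi)
  have hintegrand : ∀ ξ : EuclideanSpace ℝ ι, stft (GSDistribution.ofGS f) (x, ξ) *
      Complex.exp (Complex.I * (inner ℝ y ξ : ℝ)) = stftConst ι *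
      (Complex.exp (((2 * Real.pi * inner ℝ ((2 * Real.pi)⁻¹ • ξ) y : ℝ) : ℂ) * Complex.I) •
        𝓕 (windowed f x) ((2 * Real.pi)⁻¹ • ξ)) := fun ξ => by
    rw [stft_ofGS, inner_smul_left, conj_trivial, mul_inv_cancel_left₀ (by positivity),
      real_inner_comm, smul_eq_mul, mul_comm Complex.I]
    ring
  have hconst : (stftConst ι : ℂ) * stftConst ι * (((2 * Real.pi) ^ Fintype.card ι : ℝ) : ℂ) = 1 :=
    mod_cast stftConst_mul_self_mul_two_pi_pow
  simp only [hintegrand]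
  rw [integral_const_mul, hdilate, abs_of_pos (by positivity), finrank_euclideanSpace,
    Complex.real_smul, ← mul_assoc, ← mul_assoc, hconst, one_mul, ← Real.fourierInv_eq', hinv]

theorem integral_gaussianWindow_sub_sq (y : EuclideanSpace ℝ ι) :
    ∫ x, gaussianWindow (y - x) ^ 2 = 1 := by
  rw [integral_sub_left_eq_self (fun x : EuclideanSpace ℝ ι => gaussianWindow x ^ 2)]
  have hsq : (fun x : EuclideanSpace ℝ ι => gaussianWindow x ^ 2) = fun x =>
      (Real.pi ^ (-(Fintype.card ι : ℝ) / 4)) ^ 2 * Real.exp (-1 * ‖x‖ ^ 2) := by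
    funext x
    rw [gaussianWindow, mul_pow, ← Real.exp_nat_mul]
    congr 2
    push_cast; ring
  rw [hsq, integral_const_mul, GaussianFourier.integral_rexp_neg_mul_sq_norm one_pos, div_one,
    ← Real.rpow_natCast, ← Real.rpow_mul Real.pi_pos.le, ← Real.rpow_add Real.pi_pos,
    finrank_euclideanSpace]
  rw [show -(Fintype.card ι : ℝ) / 4 * (2 : ℕ) + (Fintype.card ι : ℝ) / 2 = 0 by push_cast; ring,
    Real.rpow_zero]

theorem GelfandShilov.gsNorm_smul {h : ℝ} (hh : 0 < h) (c : ℂ) (f : GelfandShilov ι) :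
    gsNorm h (c • f) = ‖c‖ * gsNorm h f := map_smul_eq_mul (gsSeminorm ⟨h, hh⟩) c f

theorem norm_fst_neg_snd (z : PhaseSpace ι) : ‖(z.1, -z.2)‖ = ‖z‖ := by
  simp [Prod.norm_def]

theorem exists_norm_stft_le (u : GSDistribution ι) : ∃ C a : ℝ, 0 ≤ C ∧ 0 ≤ a ∧
    ∀ z, ‖stft u z‖ ≤ C * Real.exp (a * ‖z‖) := by
  obtain ⟨h, hh, C, hC0, hC⟩ := GelfandShilov.exists_norm_le_mul_gsNorm u
  obtain ⟨D, a, hD0, ha, hD⟩ := exists_gsNorm_gaussianPacket_le (ι := ι) hh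
  refine ⟨stftConst ι * (C * D), a, mul_nonneg stftConst_pos.le (by positivity), ha, fun z => ?_⟩
  rw [norm_stft, mul_assoc, mul_assoc]
  exact mul_le_mul_of_nonneg_left ((hC _).trans (mul_le_mul_of_nonneg_left (hD z) hC0))
    stftConst_pos.le

theorem continuous_gaussianPacket_neg_snd :
    Continuous fun z : PhaseSpace ι => gaussianPacket z.1 (-z.2) :=
  continuous_gaussianPacket.comp (by fun_prop : Continuous fun z : PhaseSpace ι => (z.1, -z.2))

theorem integrable_gsNorm_smul_packet {G : PhaseSpace ι → ℂ} (hG : Continuous G)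
    (hdecay : HasSuperexpDecay G) {h : ℝ} (hh : 0 < h) :
    Integrable fun z => GelfandShilov.gsNorm h (G z • gaussianPacket z.1 (-z.2)) := by
  obtain ⟨D, a, hD0, ha, hD⟩ := exists_gsNorm_gaussianPacket_le (ι := ι) hh
  obtain ⟨C, hC0, hC⟩ := hdecay (a + 1)
  refine ((integrable_exp_neg_mul_norm volume one_pos).const_mul (C * D)).mono'
    ((GelfandShilov.continuous_gsNorm hh).comp
      (hG.smul continuous_gaussianPacket_neg_snd)).aestronglyMeasurable
    (Eventually.of_forall fun z => ?_)
  have hDz := hD (z.1, -z.2)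
  rw [norm_fst_neg_snd] at hDz
  rw [Real.norm_of_nonneg (GelfandShilov.gsNorm_nonneg hh _), GelfandShilov.gsNorm_smul hh]
  calc ‖G z‖ * GelfandShilov.gsNorm h (gaussianPacket z.1 (-z.2))
      ≤ C * Real.exp (-(a + 1) * ‖z‖) * (D * Real.exp (a * ‖z‖)) :=
        mul_le_mul (hC z) hDz (GelfandShilov.gsNorm_nonneg hh _) (by positivity)
    _ = C * D * (Real.exp (-(a + 1) * ‖z‖) * Real.exp (a * ‖z‖)) := by ring
    _ = C * D * Real.exp (-1 * ‖z‖) := by rw [← Real.exp_add]; ring_nf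

theorem integrable_mul_packet_apply {G : PhaseSpace ι → ℂ} (hG : Continuous G)
    (hdecay : HasSuperexpDecay G) (y : EuclideanSpace ℝ ι) :
    Integrable fun z => G z * gaussianPacket z.1 (-z.2) y := by
  refine (integrable_gsNorm_smul_packet hG hdecay one_pos).mono' ?_
    (Eventually.of_forall fun z =>
      GelfandShilov.norm_le_gsNorm_one (G z • gaussianPacket z.1 (-z.2)) y)
  refine (hG.mul ?_).aestronglyMeasurable
  simp only [gaussianPacket_apply, gaussianWindow]
  fun_prop

theorem integral_stft_mul_packet_snd (f : GelfandShilov ι) (x y : EuclideanSpace ℝ ι) :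
    ∫ ξ, stftConst ι * stft (GSDistribution.ofGS f) (x, ξ) * gaussianPacket x (-ξ) y =
      f y * ((gaussianWindow (y - x) ^ 2 : ℝ) : ℂ) := by
  have hwindowed := windowed_eq_integral f x y
  rw [windowed, gaussianPacket_zero_apply] at hwindowed
  have hintegrand : ∀ ξ,
      stftConst ι * stft (GSDistribution.ofGS f) (x, ξ) * gaussianPacket x (-ξ) y =
        (gaussianWindow (y - x) : ℂ) * stftConst ι * (stft (GSDistribution.ofGS f) (x, ξ) *
          Complex.exp (Complex.I * (inner ℝ y ξ : ℝ))) := fun ξ => by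
    rw [gaussianPacket_apply, inner_neg_right, Complex.ofReal_neg, neg_mul_neg]
    ring
  simp only [hintegrand]
  rw [integral_const_mul, mul_assoc, ← hwindowed]
  push_cast; ring

theorem eq_integral_stft_mul_packet (f : GelfandShilov ι) (y : EuclideanSpace ℝ ι) :
    f y = ∫ z : PhaseSpace ι,
      stftConst ι * stft (GSDistribution.ofGS f) z * gaussianPacket z.1 (-z.2) y := by
  have hint : Integrable fun z : PhaseSpace ι =>
      stftConst ι * stft (GSDistribution.ofGS f) z * gaussianPacket z.1 (-z.2) y :=
    integrable_mul_packet_apply (continuous_const.mul (continuous_stft _))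
      ((hasSuperexpDecay_stft_ofGS f).const_mul _) y
  rw [Measure.volume_eq_prod, integral_prod _ hint]
  simp only [integral_stft_mul_packet_snd]
  rw [integral_const_mul, integral_complex_ofReal, integral_gaussianWindow_sub_sq,
    Complex.ofReal_one, mul_one]

theorem apply_eq_integral_stft (u : GSDistribution ι) (f : GelfandShilov ι) :
    u f = ∫ z : PhaseSpace ι, stft (GSDistribution.ofGS f) z * stft u (z.1, -z.2) := by
  have hcont : Continuous fun z => (stftConst ι : ℂ) * stft (GSDistribution.ofGS f) z :=
    continuous_const.mul (continuous_stft _)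
  obtain ⟨g, hg, hu⟩ := GelfandShilov.exists_eq_integral (μ := volume)
    (F := fun z : PhaseSpace ι =>
      (stftConst ι * stft (GSDistribution.ofGS f) z) • gaussianPacket z.1 (-z.2))
    (hcont.smul continuous_gaussianPacket_neg_snd)
    fun h hh => integrable_gsNorm_smul_packet hcont ((hasSuperexpDecay_stft_ofGS f).const_mul _) hh
  have hgf : g = f := Subtype.ext (funext fun y =>
    (hg y).trans (eq_integral_stft_mul_packet f y).symm)
  rw [← hgf, hu, hgf]
  congr 1
  funext z
  rw [map_smul, smul_eq_mul, stft_eq u]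
  ring

end Inversion

/-! ### Moderate weights grow at most exponentially -/

section Weights

variable {V : Type*} [NormedAddCommGroup V] [NormedSpace ℝ V] [MeasureSpace V]

theorem ModerateWeight.add_le_pow_mul_of_norm_le (ω : ModerateWeight V) {B : ℝ} (hB0 : 0 ≤ B)
    (hB : ∀ x y : V, ‖y‖ ≤ 1 → ω (x + y) ≤ B * ω x) (n : ℕ) (x : V) {y : V} (hy : ‖y‖ ≤ n) :
    ω (x + y) ≤ B ^ n * ω x := by
  induction n generalizing y with
  | zero =>
    obtain rfl : y = 0 := norm_le_zero_iff.1 (by simpa using hy)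
    simp
  | succ n ih =>
    have hn : (0 : ℝ) < n + 1 := by positivity
    push_cast at hy
    have hsplit : x + y = x + ((n : ℝ) / (n + 1)) • y + ((1 : ℝ) / (n + 1)) • y := by
      rw [add_assoc, ← add_smul, ← add_div, div_self hn.ne', one_smul]
    have hlong : ‖((n : ℝ) / (n + 1)) • y‖ ≤ n := by
      rw [norm_smul, Real.norm_of_nonneg (by positivity), div_mul_eq_mul_div, div_le_iff₀ hn]
      gcongr
    have hshort : ‖((1 : ℝ) / (n + 1)) • y‖ ≤ 1 := by
      rw [norm_smul, Real.norm_of_nonneg (by positivity), div_mul_eq_mul_div, one_mul]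
      exact (div_le_one hn).2 hy
    rw [hsplit, pow_succ', mul_assoc]
    exact (hB _ _ hshort).trans (mul_le_mul_of_nonneg_left (ih hlong) hB0)

variable [FiniteDimensional ℝ V] [BorelSpace V]

theorem IsWeight.exists_ae_le {v : V → ℝ} (hv : IsWeight v) (r : ℝ) :
    ∃ M : ℝ, ∀ᵐ y, y ∈ Metric.closedBall (0 : V) r → v y ≤ M := by
  have hfinite := (hv.2 _ (isCompact_closedBall (0 : V) r)).1.2
  rw [eLpNorm_exponent_top] at hfinite
  refine ⟨(eLpNormEssSup v (volume.restrict (Metric.closedBall 0 r))).toReal, ?_⟩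
  rw [← ae_restrict_iff' Metric.isClosed_closedBall.measurableSet]
  filter_upwards [ae_le_eLpNormEssSup (f := v) (μ := volume.restrict (Metric.closedBall 0 r))]
    with y hy
  refine (le_abs_self _).trans ?_
  rw [← Real.norm_eq_abs, ← toReal_enorm]
  exact ENNReal.toReal_mono hfinite.ne hy

namespace ModerateWeight

variable [(volume : Measure V).IsAddHaarMeasure]

-- The weight `v` is only essentially bounded on balls, so the step from `x` to `x + y` is split
-- at a generic point `x + w`.
theorem exists_add_le_mul_of_norm_le_one (ω : ModerateWeight V) : ∃ B : ℝ, 1 ≤ B ∧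
    ∀ x y : V, ‖y‖ ≤ 1 → ω (x + y) ≤ B * ω x := by
  obtain ⟨v, hv, C, hC⟩ := ω.moderate'
  obtain ⟨M, hM⟩ := hv.exists_ae_le 2
  have hC0 : 0 < C := pos_of_mul_pos_left ((ω.pos (0 + 0)).trans_le (hC 0 0))
    (mul_pos (ω.pos 0) (hv.1 0)).le
  refine ⟨max 1 (C * C * (M * M)), le_max_left _ _, fun x y hy => ?_⟩
  have hM_sub : ∀ᵐ w, y - w ∈ Metric.closedBall (0 : V) 2 → v (y - w) ≤ M :=
    (quasiMeasurePreserving_sub_left_of_right_invariant volume y).ae hM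
  obtain ⟨w, hw, hvw, hvyw⟩ := Measure.exists_mem_of_measure_ne_zero_of_ae
    (Metric.measure_ball_pos volume (0 : V) one_pos).ne' (ae_restrict_of_ae (hM.and hM_sub))
  rw [mem_ball_zero_iff] at hw
  replace hvw : v w ≤ M := hvw (by rw [mem_closedBall_zero_iff]; linarith)
  replace hvyw : v (y - w) ≤ M :=
    hvyw (by rw [mem_closedBall_zero_iff]; linarith [norm_sub_le y w])
  have hvw_pos := hv.1 w
  have hvyw_pos := hv.1 (y - w)
  have hωx_pos := ω.pos x
  calc ω (x + y) = ω (x + w + (y - w)) := by congr 1; abel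
    _ ≤ C * (ω (x + w) * v (y - w)) := hC _ _
    _ ≤ C * (C * (ω x * v w) * v (y - w)) := by gcongr; exact hC x w
    _ = C * C * (v w * v (y - w)) * ω x := by ring
    _ ≤ C * C * (M * M) * ω x := by gcongr; exact hvw_pos.le.trans hvw
    _ ≤ max 1 (C * C * (M * M)) * ω x := by gcongr; exact le_max_right _ _

theorem exists_add_le_mul_exp (ω : ModerateWeight V) : ∃ B r : ℝ, 0 < B ∧ 0 ≤ r ∧
    ∀ x y : V, ω (x + y) ≤ B * Real.exp (r * ‖y‖) * ω x := by
  obtain ⟨B, hB1, hB⟩ := ω.exists_add_le_mul_of_norm_le_one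
  have hB0 : 0 < B := by linarith
  refine ⟨B, Real.log B, hB0, Real.log_nonneg hB1, fun x y => ?_⟩
  refine (ω.add_le_pow_mul_of_norm_le hB0.le hB ⌈‖y‖⌉₊ x (Nat.le_ceil _)).trans
    (mul_le_mul_of_nonneg_right ?_ (ω.pos x).le)
  rw [← Real.rpow_natCast, Real.rpow_def_of_pos hB0]
  nth_rewrite 2 [← Real.exp_log hB0]
  rw [← Real.exp_add, Real.exp_le_exp]
  nlinarith [Real.log_nonneg hB1, Nat.ceil_lt_add_one (norm_nonneg y)]

theorem exists_le_mul_exp_sub (ω : ModerateWeight V) : ∃ B r : ℝ, 0 < B ∧ 0 ≤ r ∧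
    ∀ x y : V, ω x ≤ B * Real.exp (r * ‖y - x‖) * ω y := by
  obtain ⟨B, r, hB, hr, hω⟩ := ω.exists_add_le_mul_exp
  exact ⟨B, r, hB, hr, fun x y => by simpa [norm_sub_rev] using hω y (x - y)⟩

end ModerateWeight

end Weights

/-! ### Jensen's inequality for Young functions -/

theorem exists_supporting_line_of_convexOn {S : Set ℝ} {f : ℝ → ℝ} (hf : ConvexOn ℝ S f) {x : ℝ}
    (hx : x ∈ interior S) : ∃ m : ℝ, ∀ y ∈ S, f x + m * (y - x) ≤ f y := by
  refine ⟨derivWithin f (Ioi x) x, fun y hy => ?_⟩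
  rcases lt_trichotomy y x with hyx | rfl | hxy
  · have hslope := (hf.slope_le_leftDeriv_of_mem_interior hy hx hyx).trans
      (hf.leftDeriv_le_rightDeriv_of_mem_interior hx)
    rw [slope_def_field, div_le_iff₀ (sub_pos.2 hyx)] at hslope
    linarith
  · simp
  · have hslope := hf.rightDeriv_le_slope_of_mem_interior hx hy hxy
    rw [slope_def_field, le_div_iff₀ (sub_pos.2 hxy)] at hslope
    linarith

namespace YoungFunction

variable (Φ : YoungFunction)

theorem map_mul_le {θ : ℝ≥0} (hθ : θ ≤ 1) (t : ℝ≥0∞) : Φ (θ * t) ≤ θ * Φ t := by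
  have hconvex := Φ.convex (add_tsub_cancel_of_le hθ) t 0
  rwa [Φ.map_zero', mul_zero, add_zero, add_zero] at hconvex

theorem ne_top_of_map_ne_top {t : ℝ≥0∞} (ht : Φ t ≠ ∞) : t ≠ ∞ := by
  rintro rfl
  exact ht Φ.map_top'

theorem convexOn_toReal_map_ofReal :
    ConvexOn ℝ {r : ℝ | Φ (ENNReal.ofReal r) ≠ ∞} fun r => (Φ (ENNReal.ofReal r)).toReal := by
  have hle : ∀ r t a b : ℝ, 0 ≤ a → 0 ≤ b → a + b = 1 → Φ (ENNReal.ofReal (a * r + b * t)) ≤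
      ENNReal.ofReal a * Φ (ENNReal.ofReal r) + ENNReal.ofReal b * Φ (ENNReal.ofReal t) := by
    intro r t a b ha hb hab
    have hab' : a.toNNReal + b.toNNReal = 1 := by rw [← Real.toNNReal_add ha hb, hab]; simp
    refine (Φ.mono ?_).trans (Φ.convex hab' (ENNReal.ofReal r) (ENNReal.ofReal t))
    exact ENNReal.ofReal_add_le.trans_eq (by
      rw [ENNReal.ofReal_mul ha, ENNReal.ofReal_mul hb]; rfl)
  refine ⟨fun r hr t ht a b ha hb hab => ?_, fun r hr t ht a b ha hb hab => ?_⟩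
  · rw [mem_ofPred_eq] at hr ht
    exact ne_top_of_le_ne_top (by finiteness) (hle r t a b ha hb hab)
  · rw [mem_ofPred_eq] at hr ht
    have hreal := ENNReal.toReal_mono (by finiteness) (hle r t a b ha hb hab)
    rwa [ENNReal.toReal_add (by finiteness) (by finiteness), ENNReal.toReal_mul,
      ENNReal.toReal_mul, ENNReal.toReal_ofReal ha, ENNReal.toReal_ofReal hb] at hreal

theorem exists_supporting_line {s t : ℝ≥0} (hst : s < t) (ht : Φ t ≠ ∞) :
    ∃ a : ℝ≥0, ∀ x : ℝ≥0∞, Φ s + a * x ≤ Φ x + a * s := by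
  have hdomain : Iio (t : ℝ) ⊆ {r : ℝ | Φ (ENNReal.ofReal r) ≠ ∞} := fun r hr =>
    ne_top_of_le_ne_top ht
      (Φ.mono (ENNReal.ofReal_le_of_le_toReal (show r ≤ (t : ℝ≥0∞).toReal from hr.le)))
  obtain ⟨m, hm⟩ := exists_supporting_line_of_convexOn Φ.convexOn_toReal_map_ofReal
    (isOpen_Iio.subset_interior_iff.2 hdomain (show (s : ℝ) ∈ Iio (t : ℝ) from hst))
  have hΦs : Φ s ≠ ∞ := ne_top_of_le_ne_top ht (Φ.mono (by exact_mod_cast hst.le))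
  simp only [ENNReal.ofReal_coe_nnreal] at hm
  have hm0 : 0 ≤ m := by
    have hleft := hm (s - 1) (hdomain (by simp only [mem_Iio]; linarith [NNReal.coe_lt_coe.2 hst]))
    have hmono : (Φ (ENNReal.ofReal (s - 1))).toReal ≤ (Φ s).toReal :=
      ENNReal.toReal_mono hΦs (Φ.mono (ENNReal.ofReal_le_of_le_toReal (by simp)))
    linarith
  lift m to ℝ≥0 using hm0
  refine ⟨m, fun x => ?_⟩
  by_cases hx : Φ x = ∞
  · simp [hx]
  lift x to ℝ≥0 using Φ.ne_top_of_map_ne_top hx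
  have hline := hm x (by simpa using hx)
  rw [ENNReal.ofReal_coe_nnreal] at hline
  rw [← ENNReal.toReal_le_toReal (by finiteness) (by finiteness),
    ENNReal.toReal_add hΦs (by finiteness), ENNReal.toReal_add hx (by finiteness),
    ENNReal.toReal_mul, ENNReal.toReal_mul]
  simp only [ENNReal.coe_toReal]
  linarith

section Jensen

variable {Z : Type*} [MeasurableSpace Z] {μ : Measure Z} [IsProbabilityMeasure μ] {g : Z → ℝ≥0∞}

-- With `≤` instead of `<` this fails when `Φ` jumps to `∞` at `s`.
theorem map_le_lintegral_of_lt_lintegral (hg : AEMeasurable g μ) {s : ℝ≥0∞}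
    (hs : s < ∫⁻ z, g z ∂μ) : Φ s ≤ ∫⁻ z, Φ (g z) ∂μ := by
  have hΦg : AEMeasurable (fun z => Φ (g z)) μ := Φ.measurable.comp_aemeasurable hg
  lift s to ℝ≥0 using hs.ne_top
  by_cases hfinite : ∃ t : ℝ≥0∞, s < t ∧ Φ t ≠ ∞
  · obtain ⟨t, hst, ht⟩ := hfinite
    lift t to ℝ≥0 using Φ.ne_top_of_map_ne_top ht
    obtain ⟨a, ha⟩ := Φ.exists_supporting_line (by exact_mod_cast hst) ht
    have hintegrated : ∫⁻ z, (Φ s + a * g z) ∂μ ≤ ∫⁻ z, (Φ (g z) + a * s) ∂μ :=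
      lintegral_mono fun z => ha (g z)
    rw [lintegral_add_left measurable_const, lintegral_const, measure_univ, mul_one,
      lintegral_const_mul' _ _ ENNReal.coe_ne_top, lintegral_add_left' hΦg, lintegral_const,
      measure_univ, mul_one] at hintegrated
    refine (ENNReal.add_le_add_iff_right (by finiteness : (a : ℝ≥0∞) * s ≠ ∞)).1
      (le_trans ?_ hintegrated)
    gcongr
  · push Not at hfinite
    by_contra! hlt
    have hg_le : ∀ᵐ z ∂μ, g z ≤ s := by
      filter_upwards [ae_lt_top' hΦg hlt.ne_top] with z hz
      by_contra! hgt
      exact hz.ne (hfinite _ hgt)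
    have hmean := lintegral_mono_ae hg_le
    rw [lintegral_const, measure_univ, mul_one] at hmean
    exact hs.not_ge hmean

theorem map_le_lintegral_of_two_mul_le_lintegral (hg : AEMeasurable g μ) {s : ℝ≥0∞} (hs : s ≠ ∞)
    (hsg : 2 * s ≤ ∫⁻ z, g z ∂μ) : Φ s ≤ ∫⁻ z, Φ (g z) ∂μ := by
  rcases eq_or_ne s 0 with rfl | hs0
  · simp [Φ.map_zero']
  · refine Φ.map_le_lintegral_of_lt_lintegral hg (lt_of_lt_of_le ?_ hsg)
    rw [two_mul]
    exact ENNReal.lt_add_right hs hs0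

end Jensen

end YoungFunction

/-! ### Exponential averages in Orlicz spaces -/

section Convolution

variable {V : Type*} [NormedAddCommGroup V]

/-- The convolution kernel `exp (-‖w‖)`. -/
def expKernel (w : V) : ℝ≥0∞ := ENNReal.ofReal (Real.exp (-‖w‖))

theorem continuous_expKernel : Continuous (expKernel : V → ℝ≥0∞) :=
  ENNReal.continuous_ofReal.comp (by fun_prop)

variable [MeasureSpace V]

variable (V) in
/-- The total mass of `expKernel`. -/
def expMass : ℝ≥0∞ := ∫⁻ w : V, expKernel w

/-- The probability measure with density proportional to `exp (-‖w - x‖)`. -/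
def expMeasure (x : V) : Measure V :=
  volume.withDensity fun w => (expMass V)⁻¹ * expKernel (w - x)

variable [BorelSpace V]

theorem YoungFunction.lintegral_map_inv_mul_expKernel_mul_le_one (Φ : YoungFunction) {t N : ℝ≥0}
    (hN : 1 ≤ N) (ht : expMass V * Φ t ≤ N) :
    ∫⁻ z : V, Φ ((N⁻¹ : ℝ≥0) * expKernel z * t) ≤ 1 := by
  have hpointwise (z : V) : Φ ((N⁻¹ : ℝ≥0) * expKernel z * t) ≤
      (N⁻¹ : ℝ≥0) * expKernel z * Φ t := by
    have hexp : (Real.exp (-‖z‖)).toNNReal ≤ 1 := by simp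
    have hθ : N⁻¹ * (Real.exp (-‖z‖)).toNNReal ≤ 1 :=
      mul_le_one₀ (inv_le_one_of_one_le₀ hN) zero_le hexp
    have hmul := Φ.map_mul_le hθ t
    rwa [ENNReal.coe_mul] at hmul
  calc ∫⁻ z : V, Φ ((N⁻¹ : ℝ≥0) * expKernel z * t)
      ≤ ∫⁻ z : V, (N⁻¹ : ℝ≥0) * expKernel z * Φ t := lintegral_mono hpointwise
    _ = (N⁻¹ : ℝ≥0) * (expMass V * Φ t) := by
        rw [lintegral_mul_const _ (continuous_expKernel.measurable.const_mul _),
          lintegral_const_mul _ continuous_expKernel.measurable, expMass, mul_assoc]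
    _ ≤ (N⁻¹ : ℝ≥0) * N := by gcongr
    _ = 1 := by
        rw [← ENNReal.coe_mul, inv_mul_cancel₀ (one_pos.trans_le hN).ne', ENNReal.coe_one]

variable [(volume : Measure V).IsAddHaarMeasure]

theorem expMass_ne_zero : expMass V ≠ 0 := by
  rw [expMass, Ne, lintegral_eq_zero_iff continuous_expKernel.measurable]
  intro hzero
  obtain ⟨w, hw⟩ := hzero.exists
  exact (ENNReal.ofReal_pos.2 (Real.exp_pos (-‖w‖))).ne' hw

theorem lintegral_expMeasure {g : V → ℝ≥0∞} (hg : AEMeasurable g) (x : V) :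
    ∫⁻ w, g w ∂expMeasure x = (expMass V)⁻¹ * ∫⁻ w, g w * expKernel (w - x) := by
  have hdensity : Measurable fun w : V => (expMass V)⁻¹ * expKernel (w - x) :=
    (continuous_expKernel.comp (continuous_sub_right x)).measurable.const_mul _
  rw [expMeasure, lintegral_withDensity_eq_lintegral_mul₀ hdensity.aemeasurable hg,
    ← lintegral_const_mul' _ _ (ENNReal.inv_ne_top.2 expMass_ne_zero)]
  refine lintegral_congr fun w => ?_
  rw [Pi.mul_apply, mul_comm (g w), mul_assoc]

variable [NormedSpace ℝ V] [FiniteDimensional ℝ V]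

theorem expMass_ne_top : expMass V ≠ ∞ := by
  simpa [expMass, expKernel] using
    (integrable_exp_neg_mul_norm (volume : Measure V) one_pos).lintegral_lt_top.ne

instance isProbabilityMeasure_expMeasure (x : V) : IsProbabilityMeasure (expMeasure x) where
  measure_univ := by
    rw [← lintegral_one, lintegral_expMeasure aemeasurable_const]
    simp only [one_mul]
    rw [lintegral_sub_right_eq_self expKernel x]
    exact ENNReal.inv_mul_cancel expMass_ne_zero expMass_ne_top

theorem map_continuousLinearEquiv_volume (Λ : V ≃L[ℝ] V) : Measure.map Λ (volume : Measure V) =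
    ENNReal.ofReal |(Λ : V →L[ℝ] V).det|⁻¹ • volume := by
  rw [← abs_inv]
  exact Measure.map_linearMap_addHaar_eq_smul_addHaar (volume : Measure V)
    (LinearEquiv.isUnit_det' Λ.toLinearEquiv).ne_zero

theorem lintegral_expKernel_sub_comp (Λ : V ≃L[ℝ] V) (w : V) :
    ∫⁻ z, expKernel (w - Λ z) = ENNReal.ofReal |(Λ : V →L[ℝ] V).det|⁻¹ * expMass V := by
  have hmeas : Measurable fun y => expKernel (w - y) :=
    (continuous_expKernel.comp (continuous_sub_left w)).measurable
  rw [← lintegral_map hmeas Λ.continuous.measurable, map_continuousLinearEquiv_volume,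
    lintegral_smul_measure, lintegral_sub_left_eq_self expKernel w, smul_eq_mul, expMass]

theorem lintegral_lintegral_expMeasure_comp (Λ : V ≃L[ℝ] V) {g : V → ℝ≥0∞} (hg : AEMeasurable g) :
    ∫⁻ z, ∫⁻ w, g w ∂expMeasure (Λ z) =
      ENNReal.ofReal |(Λ : V →L[ℝ] V).det|⁻¹ * ∫⁻ w, g w := by
  have hinv : (expMass V)⁻¹ ≠ ∞ := ENNReal.inv_ne_top.2 expMass_ne_zero
  have hkernel : Measurable fun q : V × V => expKernel (q.2 - Λ q.1) :=
    (continuous_expKernel.comp (by fun_prop)).measurable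
  have hkernel_left (w : V) : Measurable fun z => expKernel (w - Λ z) :=
    (continuous_expKernel.comp (by fun_prop)).measurable
  calc ∫⁻ z, ∫⁻ w, g w ∂expMeasure (Λ z)
      = (expMass V)⁻¹ * ∫⁻ z, ∫⁻ w, g w * expKernel (w - Λ z) := by
        simp only [lintegral_expMeasure hg, lintegral_const_mul' _ _ hinv]
    _ = (expMass V)⁻¹ * ∫⁻ w, ∫⁻ z, g w * expKernel (w - Λ z) := by
        rw [lintegral_lintegral_swap (hg.comp_snd.mul hkernel.aemeasurable)]
    _ = (expMass V)⁻¹ *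
          ((∫⁻ w, g w) * (ENNReal.ofReal |(Λ : V →L[ℝ] V).det|⁻¹ * expMass V)) := by
        simp only [lintegral_const_mul _ (hkernel_left _), lintegral_expKernel_sub_comp]
        rw [lintegral_mul_const' _ _ (ENNReal.mul_ne_top ENNReal.ofReal_ne_top expMass_ne_top)]
    _ = (expMass V)⁻¹ * expMass V *
          (ENNReal.ofReal |(Λ : V →L[ℝ] V).det|⁻¹ * ∫⁻ w, g w) := by ring
    _ = ENNReal.ofReal |(Λ : V →L[ℝ] V).det|⁻¹ * ∫⁻ w, g w := by
        rw [ENNReal.inv_mul_cancel expMass_ne_zero expMass_ne_top, one_mul]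

theorem YoungFunction.map_le_mul_lintegral_expMeasure (Φ : YoungFunction) {G : V → ℝ≥0∞}
    (hG : AEMeasurable G) {M : ℝ≥0} (hM : 1 ≤ M) {x : V} {s : ℝ}
    (hs : ENNReal.ofReal s ≤ ∫⁻ w, G w * expKernel (w - x)) :
    Φ (ENNReal.ofReal (s / (2 * (expMass V).toReal * M))) ≤
      (M⁻¹ : ℝ≥0) * ∫⁻ w, Φ (G w) ∂expMeasure x := by
  have hM0 : 0 < M := one_pos.trans_le hM
  have hmass : 0 < (expMass V).toReal := ENNReal.toReal_pos expMass_ne_zero expMass_ne_top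
  have hscale : ENNReal.ofReal (s / (2 * (expMass V).toReal * M)) =
      (M⁻¹ : ℝ≥0) * ENNReal.ofReal (s / (2 * (expMass V).toReal)) := by
    rw [← ENNReal.ofReal_coe_nnreal, ← ENNReal.ofReal_mul (by positivity)]
    congr 1
    push_cast
    field_simp
  have hmean : 2 * ENNReal.ofReal (s / (2 * (expMass V).toReal)) ≤ ∫⁻ w, G w ∂expMeasure x := by
    rw [lintegral_expMeasure hG, ← ENNReal.ofReal_ofNat, ← ENNReal.ofReal_mul (by positivity)]
    calc ENNReal.ofReal (2 * (s / (2 * (expMass V).toReal)))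
        = ENNReal.ofReal ((expMass V).toReal⁻¹ * s) := by congr 1; field_simp
      _ = (expMass V)⁻¹ * ENNReal.ofReal s := by
          rw [ENNReal.ofReal_mul (by positivity), ENNReal.ofReal_inv_of_pos hmass,
            ENNReal.ofReal_toReal expMass_ne_top]
      _ ≤ (expMass V)⁻¹ * ∫⁻ w, G w * expKernel (w - x) := by gcongr
  rw [hscale]
  refine (Φ.map_mul_le (inv_le_one_of_one_le₀ hM) _).trans ?_
  gcongr
  exact Φ.map_le_lintegral_of_two_mul_le_lintegral (μ := expMeasure x)
    (hG.mono_ac (withDensity_absolutelyContinuous _ _)) ENNReal.ofReal_ne_top hmean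

theorem exists_lintegral_map_div_le_one (Λ : V ≃L[ℝ] V) : ∃ C : ℝ, 0 < C ∧
    ∀ (Φ : YoungFunction) (G : V → ℝ≥0∞) (H : V → ℝ), AEMeasurable G →
      (∀ z, ENNReal.ofReal (H z) ≤ ∫⁻ w, G w * expKernel (w - Λ z)) → ∫⁻ w, Φ (G w) ≤ 1 →
        ∫⁻ z, Φ (ENNReal.ofReal (H z / C)) ≤ 1 := by
  let D : ℝ≥0 := Real.toNNReal |(Λ : V →L[ℝ] V).det|⁻¹
  have hM : 1 ≤ max 1 D := le_max_left 1 D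
  have hM0 : 0 < max 1 D := one_pos.trans_le hM
  have hmass : 0 < (expMass V).toReal := ENNReal.toReal_pos expMass_ne_zero expMass_ne_top
  refine ⟨2 * (expMass V).toReal * (max 1 D : ℝ≥0), by positivity, fun Φ G H hG hH hΦ => ?_⟩
  calc _ ≤ ∫⁻ z, ((max 1 D)⁻¹ : ℝ≥0) * ∫⁻ w, Φ (G w) ∂expMeasure (Λ z) :=
        lintegral_mono fun z => Φ.map_le_mul_lintegral_expMeasure hG hM (hH z)
    _ = ((max 1 D)⁻¹ : ℝ≥0) * (D * ∫⁻ w, Φ (G w)) := by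
        rw [lintegral_const_mul' _ _ ENNReal.coe_ne_top,
          lintegral_lintegral_expMeasure_comp Λ (g := fun w => Φ (G w))
            (Φ.measurable.comp_aemeasurable hG)]
        rfl
    _ ≤ ((max 1 D)⁻¹ : ℝ≥0) * ((max 1 D : ℝ≥0) * 1) := by
        gcongr
        exact le_max_right 1 D
    _ = 1 := by rw [mul_one, ← ENNReal.coe_mul, inv_mul_cancel₀ hM0.ne', ENNReal.coe_one]

theorem HasSuperexpDecay.exists_norm_mul_weight_le {W : Type*} [NormedAddCommGroup W] {F : V → W}
    (hF : HasSuperexpDecay F) (ω : ModerateWeight V) :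
    ∃ A : ℝ, 0 ≤ A ∧ ∀ z, ‖F z‖ * ω z ≤ A * Real.exp (-‖z‖) := by
  obtain ⟨B, r, hB, -, hω⟩ := ω.exists_add_le_mul_exp
  obtain ⟨C, hC0, hC⟩ := hF (r + 1)
  refine ⟨C * (B * ω 0), mul_nonneg hC0 (mul_nonneg hB.le (ω.pos 0).le), fun z => ?_⟩
  have hωz : ω z ≤ B * Real.exp (r * ‖z‖) * ω 0 := by simpa using hω 0 z
  calc ‖F z‖ * ω z ≤ C * Real.exp (-(r + 1) * ‖z‖) * (B * Real.exp (r * ‖z‖) * ω 0) :=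
        mul_le_mul (hC z) hωz (ω.pos z).le (by positivity)
    _ = C * (B * ω 0) * (Real.exp (-(r + 1) * ‖z‖) * Real.exp (r * ‖z‖)) := by ring
    _ = C * (B * ω 0) * Real.exp (-‖z‖) := by rw [← Real.exp_add]; ring_nf

theorem HasSuperexpDecay.memOrlicz {F : V → ℂ} (hF : HasSuperexpDecay F)
    (hF_meas : AEStronglyMeasurable F) (Φ : YoungFunction) (hΦ : ∃ t : ℝ≥0∞, 0 < t ∧ Φ t ≠ ∞)
    (ω : ModerateWeight V) : MemOrlicz Φ ω F := by
  refine ⟨hF_meas, ?_⟩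
  obtain ⟨t, ht0, ht⟩ := hΦ
  lift t to ℝ≥0 using Φ.ne_top_of_map_ne_top ht
  have ht_pos : (0 : ℝ) < t := by exact_mod_cast ht0
  obtain ⟨A, hA0, hA⟩ := hF.exists_norm_mul_weight_le ω
  have hΦt : expMass V * Φ t ≠ ∞ := ENNReal.mul_ne_top expMass_ne_top ht
  obtain ⟨N, hN⟩ : ∃ N : ℝ≥0, N = max 1 (expMass V * Φ t).toNNReal := ⟨_, rfl⟩
  have hN1 : 1 ≤ N := hN ▸ le_max_left _ _
  have hN0 : 0 < N := one_pos.trans_le hN1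
  have hmass_le : expMass V * Φ t ≤ N := by
    rw [← ENNReal.coe_toNNReal hΦt, ENNReal.coe_le_coe, hN]
    exact le_max_right _ _
  refine ⟨(A + 1) * N / t, by positivity, le_trans (lintegral_mono fun z => Φ.mono ?_)
    (Φ.lintegral_map_inv_mul_expKernel_mul_le_one (V := V) hN1 hmass_le)⟩
  rw [expKernel, ← ENNReal.ofReal_coe_nnreal, ← ENNReal.ofReal_coe_nnreal (p := t),
    ← ENNReal.ofReal_mul (by positivity), ← ENNReal.ofReal_mul (by positivity)]
  refine ENNReal.ofReal_le_ofReal ?_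
  rw [div_le_iff₀ (by positivity)]
  calc ‖F z‖ * ω z ≤ A * Real.exp (-‖z‖) := hA z
    _ ≤ (A + 1) * Real.exp (-‖z‖) := by gcongr; linarith
    _ = _ := by push_cast; field_simp

end Convolution

/-! ### Linear pullbacks as integral operators on phase space -/

section Pullback

variable {ι : Type*} [Fintype ι]

theorem integral_fst_neg_snd (F : PhaseSpace ι → ℂ) :
    ∫ z : PhaseSpace ι, F (z.1, -z.2) = ∫ z, F z :=
  let e := (Homeomorph.refl (EuclideanSpace ℝ ι)).prodCongr (Homeomorph.neg (EuclideanSpace ℝ ι))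
  have he : MeasurePreserving e volume volume :=
    (MeasurePreserving.id volume).prod (Measure.measurePreserving_neg volume)
  he.integral_comp e.measurableEmbedding F

theorem integral_comp_continuousLinearEquiv {V : Type*} [NormedAddCommGroup V] [NormedSpace ℝ V]
    [FiniteDimensional ℝ V] [MeasureSpace V] [BorelSpace V]
    [(volume : Measure V).IsAddHaarMeasure] (L : V ≃L[ℝ] V) (g : V → ℂ) :
    ∫ y, g (L y) = ((|(L : V →L[ℝ] V).det|⁻¹ : ℝ) : ℂ) * ∫ y, g y := by
  have hmap : ∫ y, g y ∂Measure.map L volume = ∫ y, g (L y) :=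
    L.toHomeomorph.measurableEmbedding.integral_map g
  rw [← hmap, map_continuousLinearEquiv_volume, integral_smul_measure,
    ENNReal.toReal_ofReal (by positivity), Complex.real_smul]

namespace GSDistribution

theorem ofGS_comm (f g : GelfandShilov ι) : ofGS f g = ofGS g f := by
  simp only [ofGS_apply, mul_comm]

theorem pullback_apply (L : EuclideanSpace ℝ ι ≃L[ℝ] EuclideanSpace ℝ ι) (u : GSDistribution ι)
    (φ : GelfandShilov ι) : pullback L u φ =
      ((|(L : EuclideanSpace ℝ ι →L[ℝ] EuclideanSpace ℝ ι).det|⁻¹ : ℝ) : ℂ) *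
        u (GelfandShilov.compLin L.symm φ) := rfl

theorem pullback_ofGS (L : EuclideanSpace ℝ ι ≃L[ℝ] EuclideanSpace ℝ ι) (f : GelfandShilov ι) :
    pullback L (ofGS f) = ofGS (GelfandShilov.compLin L f) := by
  ext φ
  have hsubst := integral_comp_continuousLinearEquiv L fun y => f y * φ (L.symm y)
  simp only [ContinuousLinearEquiv.symm_apply_apply] at hsubst
  exact hsubst.symm

theorem pullback_symm_pullback (L : EuclideanSpace ℝ ι ≃L[ℝ] EuclideanSpace ℝ ι)
    (u : GSDistribution ι) : pullback L.symm (pullback L u) = u := by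
  ext φ
  have hcomp : GelfandShilov.compLin L.symm (GelfandShilov.compLin L.symm.symm φ) = φ :=
    Subtype.ext (funext fun y => congrArg φ (L.apply_symm_apply y))
  have hdet : (L.symm : EuclideanSpace ℝ ι →L[ℝ] EuclideanSpace ℝ ι).det *
      (L : EuclideanSpace ℝ ι →L[ℝ] EuclideanSpace ℝ ι).det = 1 :=
    LinearEquiv.det_symm_mul_det L.toLinearEquiv
  rw [pullback_apply, pullback_apply, hcomp, ← mul_assoc, ← Complex.ofReal_mul, ← mul_inv,
    ← abs_mul, hdet, abs_one, inv_one, Complex.ofReal_one, one_mul]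

/-- The distributional pullback as a linear map, so that it can be restricted to the Orlicz
modulation spaces. -/
def pullbackLinearMap (L : EuclideanSpace ℝ ι ≃L[ℝ] EuclideanSpace ℝ ι) :
    GSDistribution ι →ₗ[ℂ] GSDistribution ι where
  toFun := pullback L
  map_add' u v := by rw [pullback, ContinuousLinearMap.add_comp, smul_add]; rfl
  map_smul' c u := by rw [pullback, ContinuousLinearMap.smul_comp, smul_comm]; rfl

end GSDistribution

/-- The Gaussian wave packet at `w`, transported by `L`: its pairing with `u` is, up to a constant,
the short-time Fourier transform of the pullback of `u` by `L`. -/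
def packetComp (L : EuclideanSpace ℝ ι ≃L[ℝ] EuclideanSpace ℝ ι) (w : PhaseSpace ι) :
    GelfandShilov ι :=
  GelfandShilov.compLin L.symm (gaussianPacket w.1 w.2)

/-- The kernel of the operator which pullback by `L` induces on short-time Fourier transforms. -/
def pullbackKernel (L : EuclideanSpace ℝ ι ≃L[ℝ] EuclideanSpace ℝ ι) (w z : PhaseSpace ι) : ℂ :=
  stft (GSDistribution.ofGS (packetComp L w)) (z.1, -z.2)

theorem apply_packetComp (L : EuclideanSpace ℝ ι ≃L[ℝ] EuclideanSpace ℝ ι)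
    (u : GSDistribution ι) (w : PhaseSpace ι) :
    u (packetComp L w) = ∫ z, pullbackKernel L w z * stft u z := by
  rw [apply_eq_integral_stft, ← integral_fst_neg_snd]
  simp only [neg_neg]
  rfl

theorem stft_pullback (L : EuclideanSpace ℝ ι ≃L[ℝ] EuclideanSpace ℝ ι) (u : GSDistribution ι) :
    stft (GSDistribution.pullback L u) = fun w => (stftConst ι *
      ((|(L : EuclideanSpace ℝ ι →L[ℝ] EuclideanSpace ℝ ι).det|⁻¹ : ℝ) : ℂ)) *
        ∫ z, pullbackKernel L w z * stft u z := by
  funext w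
  rw [stft_eq, GSDistribution.pullback_apply, mul_assoc, ← apply_packetComp]
  rfl

theorem integrable_pullbackKernel_mul (L : EuclideanSpace ℝ ι ≃L[ℝ] EuclideanSpace ℝ ι)
    (u : GSDistribution ι) (w : PhaseSpace ι) :
    Integrable fun z => pullbackKernel L w z * stft u z := by
  obtain ⟨D, a, hD0, ha, hD⟩ := exists_norm_stft_le u
  obtain ⟨C, hC0, hC⟩ := hasSuperexpDecay_stft_ofGS (packetComp L w) (a + 1)
  have hkernel : Continuous fun z => pullbackKernel L w z :=
    (continuous_stft _).comp (continuous_fst.prodMk continuous_snd.neg)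
  refine ((integrable_exp_neg_mul_norm volume one_pos).const_mul (C * D)).mono'
    (hkernel.mul (continuous_stft u)).aestronglyMeasurable (Eventually.of_forall fun z => ?_)
  have hdecay := hC (z.1, -z.2)
  rw [norm_fst_neg_snd] at hdecay
  calc ‖pullbackKernel L w z * stft u z‖
      ≤ C * Real.exp (-(a + 1) * ‖z‖) * (D * Real.exp (a * ‖z‖)) :=
        (norm_mul_le _ _).trans (mul_le_mul hdecay (hD z) (norm_nonneg _) (by positivity))
    _ = C * D * (Real.exp (-(a + 1) * ‖z‖) * Real.exp (a * ‖z‖)) := by ring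
    _ = C * D * Real.exp (-1 * ‖z‖) := by rw [← Real.exp_add]; ring_nf

section Dual

variable {L M : EuclideanSpace ℝ ι ≃L[ℝ] EuclideanSpace ℝ ι}

theorem packetComp_mul_gaussianPacket (hLM : ∀ y ξ, inner ℝ (L y) (M ξ) = inner ℝ y ξ)
    (w z : PhaseSpace ι) (y : EuclideanSpace ℝ ι) :
    packetComp L w (y + L w.1) * gaussianPacket z.1 (-z.2) (y + L w.1) =
      Complex.exp (((inner ℝ (L w.1) (z.2 - M w.2) : ℝ) : ℂ) * Complex.I) *
        (packetComp L 0 y * gaussianPacket (z.1 - L w.1) (M w.2 - z.2) y) := by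
  have hinner : inner ℝ (L.symm y + w.1) w.2 = inner ℝ y (M w.2) + inner ℝ (L w.1) (M w.2) := by
    rw [← hLM, map_add, L.apply_symm_apply, inner_add_left]
  change gaussianPacket w.1 w.2 (L.symm (y + L w.1)) * gaussianPacket z.1 (-z.2) (y + L w.1) =
    _ * (gaussianPacket 0 0 (L.symm y) * gaussianPacket (z.1 - L w.1) (M w.2 - z.2) y)
  rw [map_add, L.symm_apply_apply, gaussianPacket_zero_apply, gaussianPacket_apply,
    gaussianPacket_apply, gaussianPacket_apply, add_sub_cancel_right, sub_zero, hinner,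
    show y + L w.1 - z.1 = y - (z.1 - L w.1) by abel, inner_sub_right, inner_sub_right,
    inner_neg_right, inner_add_left, mul_mul_mul_comm, ← Complex.exp_add,
    mul_left_comm (Complex.exp _), mul_assoc, mul_left_comm (Complex.exp _), ← Complex.exp_add]
  congr 3
  push_cast
  ring

theorem ofGS_packetComp_gaussianPacket (hLM : ∀ y ξ, inner ℝ (L y) (M ξ) = inner ℝ y ξ)
    (w z : PhaseSpace ι) :
    GSDistribution.ofGS (packetComp L w) (gaussianPacket z.1 (-z.2)) =
      Complex.exp (((inner ℝ (L w.1) (z.2 - M w.2) : ℝ) : ℂ) * Complex.I) *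
        GSDistribution.ofGS (packetComp L 0) (gaussianPacket (z.1 - L w.1) (M w.2 - z.2)) := by
  rw [GSDistribution.ofGS_apply, GSDistribution.ofGS_apply, ← integral_const_mul,
    ← integral_add_right_eq_self _ (L w.1)]
  simp only [packetComp_mul_gaussianPacket hLM]

theorem norm_pullbackKernel_eq (hLM : ∀ y ξ, inner ℝ (L y) (M ξ) = inner ℝ y ξ)
    (w z : PhaseSpace ι) : ‖pullbackKernel L w z‖ =
      ‖stft (GSDistribution.ofGS (packetComp L 0)) (z.1 - L w.1, M w.2 - z.2)‖ := by
  rw [pullbackKernel, norm_stft, norm_stft]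
  dsimp only
  rw [ofGS_packetComp_gaussianPacket hLM, norm_mul, Complex.norm_exp_ofReal_mul_I, one_mul]

theorem exists_norm_pullbackKernel_le (hLM : ∀ y ξ, inner ℝ (L y) (M ξ) = inner ℝ y ξ) (R : ℝ) :
    ∃ C : ℝ, 0 < C ∧ ∀ w z,
      ‖pullbackKernel L w z‖ ≤ C * Real.exp (-R * ‖z - L.prodCongr M w‖) := by
  obtain ⟨C, hC0, hC⟩ := hasSuperexpDecay_stft_ofGS (packetComp L 0) R
  refine ⟨C + 1, by positivity, fun w z => ?_⟩
  have hnorm : ‖(z.1 - L w.1, M w.2 - z.2)‖ = ‖z - L.prodCongr M w‖ := by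
    rw [Prod.norm_def, Prod.norm_def, norm_sub_rev (M w.2)]
    rfl
  rw [norm_pullbackKernel_eq hLM, ← hnorm]
  refine (hC _).trans ?_
  gcongr
  linarith

variable {ω ω' : ModerateWeight (PhaseSpace ι)}

theorem exists_ofReal_norm_integral_pullbackKernel_le
    (hLM : ∀ y ξ, inner ℝ (L y) (M ξ) = inner ℝ y ξ) (hω : ∀ w, ω' w = ω (L.prodCongr M w)) :
    ∃ A : ℝ, 0 < A ∧ ∀ (U : PhaseSpace ι → ℂ) (w : PhaseSpace ι) (r : ℝ), 0 < r →
      ENNReal.ofReal (‖∫ z, pullbackKernel L w z * U z‖ * ω' w / (A * r)) ≤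
        ∫⁻ z, ENNReal.ofReal (‖U z‖ * ω z / r) * expKernel (z - L.prodCongr M w) := by
  obtain ⟨B, s, hB, -, hBω⟩ := ω.exists_le_mul_exp_sub
  obtain ⟨C, hC0, hC⟩ := exists_norm_pullbackKernel_le hLM (s + 1)
  refine ⟨C * B, by positivity, fun U w r hr => ?_⟩
  have hω'w : 0 < ω' w := ω'.pos w
  have hpointwise (z : PhaseSpace ι) :
      ‖pullbackKernel L w z * U z‖ * (ω' w / (C * B * r)) ≤
        ‖U z‖ * ω z / r * Real.exp (-‖z - L.prodCongr M w‖) := by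
    set ρ := ‖z - L.prodCongr M w‖
    have hωz : 0 < ω z := ω.pos z
    have hweight : ω' w ≤ B * Real.exp (s * ρ) * ω z := (hω w).trans_le (hBω _ _)
    have hkernel : ‖pullbackKernel L w z‖ ≤ C * Real.exp (-(s + 1) * ρ) := hC w z
    rw [norm_mul]
    calc ‖pullbackKernel L w z‖ * ‖U z‖ * (ω' w / (C * B * r))
        ≤ C * Real.exp (-(s + 1) * ρ) * ‖U z‖ * (B * Real.exp (s * ρ) * ω z / (C * B * r)) := by
          gcongr
      _ = ‖U z‖ * ω z / r * (Real.exp (-(s + 1) * ρ) * Real.exp (s * ρ)) := by field_simp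
      _ = ‖U z‖ * ω z / r * Real.exp (-ρ) := by rw [← Real.exp_add]; ring_nf
  rw [mul_div_assoc, ENNReal.ofReal_mul (norm_nonneg _), ofReal_norm]
  refine (mul_le_mul_left (enorm_integral_le_lintegral_enorm _) _).trans ?_
  rw [← lintegral_mul_const' _ _ ENNReal.ofReal_ne_top]
  refine lintegral_mono fun z => ?_
  have hωz : 0 < ω z := ω.pos z
  rw [← ofReal_norm, expKernel, ← ENNReal.ofReal_mul (norm_nonneg _),
    ← ENNReal.ofReal_mul (by positivity)]
  exact ENNReal.ofReal_le_ofReal (hpointwise z)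

theorem exists_mul_mem_orliczSet_integral_pullbackKernel
    (hLM : ∀ y ξ, inner ℝ (L y) (M ξ) = inner ℝ y ξ) (hω : ∀ w, ω' w = ω (L.prodCongr M w)) :
    ∃ C : ℝ, 0 < C ∧ ∀ (Φ : YoungFunction) (U : PhaseSpace ι → ℂ), AEStronglyMeasurable U →
      ∀ r ∈ orliczSet Φ ω U, C * r ∈ orliczSet Φ ω' fun w => ∫ z, pullbackKernel L w z * U z := by
  obtain ⟨A, hA, hAU⟩ := exists_ofReal_norm_integral_pullbackKernel_le hLM hω
  obtain ⟨C, hC, hCΦ⟩ := exists_lintegral_map_div_le_one (L.prodCongr M)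
  refine ⟨A * C, by positivity, fun Φ U hU r ⟨hr0, hr⟩ => ⟨by positivity, ?_⟩⟩
  have hmeas : AEMeasurable fun z => ENNReal.ofReal (‖U z‖ * ω z / r) :=
    ((hU.norm.aemeasurable.mul ω.aemeasurable).div_const r).ennreal_ofReal
  refine le_of_eq_of_le (lintegral_congr fun w => ?_)
    (hCΦ Φ _ (fun w => ‖∫ z, pullbackKernel L w z * U z‖ * ω' w / (A * r)) hmeas
      (fun w => hAU U w r hr0) hr)
  rw [div_div, mul_right_comm]

theorem exists_mul_mem_orliczSet_stft_pullback
    (hLM : ∀ y ξ, inner ℝ (L y) (M ξ) = inner ℝ y ξ) (hω : ∀ w, ω' w = ω (L.prodCongr M w))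
    (Φ : YoungFunction) : ∃ C : ℝ, 0 < C ∧ ∀ u : GSDistribution ι, ∀ r ∈ orliczSet Φ ω (stft u),
      C * r ∈ orliczSet Φ ω' (stft (GSDistribution.pullback L u)) := by
  obtain ⟨C, hC, hCU⟩ := exists_mul_mem_orliczSet_integral_pullbackKernel hLM hω
  have hdet : (L : EuclideanSpace ℝ ι →L[ℝ] EuclideanSpace ℝ ι).det ≠ 0 :=
    (LinearEquiv.isUnit_det' L.toLinearEquiv).ne_zero
  have hconst : (stftConst ι : ℂ) *
      ((|(L : EuclideanSpace ℝ ι →L[ℝ] EuclideanSpace ℝ ι).det|⁻¹ : ℝ) : ℂ) ≠ 0 := by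
    exact_mod_cast mul_ne_zero stftConst_pos.ne' (inv_ne_zero (abs_ne_zero.2 hdet))
  refine ⟨_ * C, mul_pos (norm_pos_iff.2 hconst) hC, fun u r hr => ?_⟩
  rw [stft_pullback, mul_assoc]
  exact mul_mem_orliczSet Φ ω' _ hconst (hCU Φ _ (continuous_stft u).aestronglyMeasurable r hr)

end Dual

namespace OrliczModulationSpace

variable {Φ : YoungFunction} {ω ω' : ModerateWeight (PhaseSpace ι)}

theorem toDistribution_injective : Function.Injective (toDistribution Φ ω) :=
  Subtype.val_injective

theorem ofGS_mem (hΦ : ∃ t : ℝ≥0∞, 0 < t ∧ Φ t ≠ ∞) (f : GelfandShilov ι) :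
    GSDistribution.ofGS f ∈ modulationSubmodule Φ ω :=
  (hasSuperexpDecay_stft_ofGS f).memOrlicz (continuous_stft _).aestronglyMeasurable Φ hΦ ω

section Dual

variable {L M : EuclideanSpace ℝ ι ≃L[ℝ] EuclideanSpace ℝ ι}

theorem exists_pullback (hLM : ∀ y ξ, inner ℝ (L y) (M ξ) = inner ℝ y ξ)
    (hω : ∀ w, ω' w = ω (L.prodCongr M w)) :
    ∃ T : OrliczModulationSpace Φ ω →L[ℂ] OrliczModulationSpace Φ ω', ∀ u,
      toDistribution Φ ω' (T u) = GSDistribution.pullback L (toDistribution Φ ω u) := by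
  obtain ⟨C, hC, hCr⟩ := exists_mul_mem_orliczSet_stft_pullback hLM hω Φ
  have hmem : ∀ u ∈ modulationSubmodule Φ ω,
      GSDistribution.pullbackLinearMap L u ∈ modulationSubmodule Φ ω' := fun u ⟨_, r, hr⟩ =>
    ⟨(continuous_stft _).aestronglyMeasurable, _, hCr u r hr⟩
  let T₀ : OrliczModulationSpace Φ ω →ₗ[ℂ] OrliczModulationSpace Φ ω' :=
    (GSDistribution.pullbackLinearMap L).restrict hmem
  have hbound (u : OrliczModulationSpace Φ ω) : ‖T₀ u‖ ≤ C * ‖u‖ := by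
    rw [← div_le_iff₀' hC]
    refine le_csInf u.2.2 fun r hr => ?_
    rw [div_le_iff₀' hC]
    exact csInf_le (orliczSet_bddBelow _ _ _) (hCr _ r hr)
  exact ⟨T₀.mkContinuous C hbound, fun u => rfl⟩

theorem exists_pullbackEquiv (hLM : ∀ y ξ, inner ℝ (L y) (M ξ) = inner ℝ y ξ)
    (hω : ∀ w, ω' w = ω (L.prodCongr M w)) :
    ∃ T : OrliczModulationSpace Φ ω ≃L[ℂ] OrliczModulationSpace Φ ω', ∀ u,
      toDistribution Φ ω' (T u) = GSDistribution.pullback L (toDistribution Φ ω u) := by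
  have hLM_symm : ∀ y ξ, inner ℝ (L.symm y) (M.symm ξ) = inner ℝ y ξ := fun y ξ => by
    rw [← hLM, L.apply_symm_apply, M.apply_symm_apply]
  have hω_symm : ∀ w, ω w = ω' (L.symm.prodCongr M.symm w) := fun w => by
    rw [hω]
    exact congrArg ω ((L.prodCongr M).apply_symm_apply w).symm
  obtain ⟨T, hT⟩ := exists_pullback (Φ := Φ) hLM hω
  obtain ⟨S, hS⟩ := exists_pullback (Φ := Φ) hLM_symm hω_symm
  refine ⟨ContinuousLinearEquiv.equivOfInverse T S
    (fun u => toDistribution_injective ?_) (fun u => toDistribution_injective ?_), hT⟩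
  · rw [hS, hT, GSDistribution.pullback_symm_pullback]
  · rw [hT, hS]
    exact GSDistribution.pullback_symm_pullback L.symm _

end Dual

theorem continuous_weakStar_of_pullback {L : EuclideanSpace ℝ ι ≃L[ℝ] EuclideanSpace ℝ ι}
    {T : OrliczModulationSpace Φ ω → OrliczModulationSpace Φ ω'}
    (hT : ∀ u, toDistribution Φ ω' (T u) = GSDistribution.pullback L (toDistribution Φ ω u)) :
    Continuous[weakStarTopology Φ ω, weakStarTopology Φ ω'] T := by
  let := weakStarTopology Φ ω
  have heval : Continuous fun (u : OrliczModulationSpace Φ ω) (φ : GelfandShilov ι) =>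
      toDistribution Φ ω u φ := continuous_induced_dom
  refine continuous_induced_rng.2 (continuous_pi fun φ => ?_)
  simp only [Function.comp_apply, hT, GSDistribution.pullback_apply]
  exact ((continuous_apply (GelfandShilov.compLin L.symm φ)).comp heval).const_mul _

end OrliczModulationSpace

end Pullback

/-! ### Weak-* density of the test functions -/

section WeakStar

-- Otherwise a functional on `I → 𝕜`, that is, an element of the span of `I`, would annihilate
-- the range of `B` but not `v`.
theorem exists_forall_mem_finset_apply_eq {𝕜 E W : Type*} [Field 𝕜] [AddCommGroup E] [Module 𝕜 E]
    [AddCommGroup W] [Module 𝕜 W] (B : W →ₗ[𝕜] E →ₗ[𝕜] 𝕜) {v : E →ₗ[𝕜] 𝕜}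
    (hv : ∀ e, (∀ w, B w e = 0) → v e = 0) (I : Finset E) :
    ∃ w, ∀ e ∈ I, B w e = v e := by
  classical
  let res : (E →ₗ[𝕜] 𝕜) →ₗ[𝕜] (I → 𝕜) := LinearMap.pi fun e => LinearMap.applyₗ e.1
  suffices hmem : res v ∈ LinearMap.range (res ∘ₗ B) by
    obtain ⟨w, hw⟩ := hmem
    exact ⟨w, fun e he => congr_fun hw ⟨e, he⟩⟩
  by_contra hnotMem
  obtain ⟨l, hl, hker⟩ := Submodule.exists_le_ker_of_notMem hnotMem
  have hrepr (f : E →ₗ[𝕜] 𝕜) :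
      l (res f) = f (∑ i : I, l (fun j => if i = j then 1 else 0) • i.1) := by
    rw [LinearMap.pi_apply_eq_sum_univ l, map_sum]
    refine Finset.sum_congr rfl fun i _ => ?_
    rw [map_smul, smul_eq_mul, smul_eq_mul, mul_comm]
    rfl
  rw [hrepr] at hl
  exact hl (hv _ fun w => (hrepr (B w)).symm.trans (hker ⟨w, rfl⟩))

variable {ι : Type*} [Fintype ι]

theorem GSDistribution.apply_eq_zero_of_forall_ofGS (u : GSDistribution ι) {g : GelfandShilov ι}
    (hg : ∀ f : GelfandShilov ι, ofGS f g = 0) : u g = 0 := by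
  rw [apply_eq_integral_stft]
  simp only [stft_eq (ofGS g), ofGS_comm g, hg, mul_zero, zero_mul, integral_zero]

theorem GSDistribution.exists_ofGS_eq_on_finset (u : GSDistribution ι)
    (I : Finset (GelfandShilov ι)) : ∃ f : GelfandShilov ι, ∀ φ ∈ I, ofGS f φ = u φ :=
  exists_forall_mem_finset_apply_eq
    (LinearMap.mk₂ ℂ (fun f φ => ofGS f φ) (fun f g φ => by simp only [ofGS_comm _ φ, map_add])
      (fun c f φ => by simp only [ofGS_comm _ φ, map_smul]) (fun f => map_add (ofGS f))
      fun c f => map_smul (ofGS f) c)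
    (v := u.toLinearMap) (fun _ hφ => u.apply_eq_zero_of_forall_ofGS hφ) I

namespace OrliczModulationSpace

variable {Φ : YoungFunction} {ω ω' : ModerateWeight (PhaseSpace ι)}

variable (Φ ω) in
/-- The elements of `M^Φ_(ω)` that are given by functions in `Σ₁`. -/
def gsSet : Set (OrliczModulationSpace Φ ω) :=
  {u | ∃ f : GelfandShilov ι, toDistribution Φ ω u = GSDistribution.ofGS f}

theorem ExtendsPullback.eqOn {L : EuclideanSpace ℝ ι ≃L[ℝ] EuclideanSpace ℝ ι}
    {S T : OrliczModulationSpace Φ ω → OrliczModulationSpace Φ ω'} (hS : ExtendsPullback L S)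
    (hT : ExtendsPullback L T) : EqOn S T (gsSet Φ ω) := by
  rintro u ⟨f, hf⟩
  exact toDistribution_injective (by rw [hS f u hf, hT f u hf])

theorem dense_gsSet_weakStar (hΦ : ∃ t : ℝ≥0∞, 0 < t ∧ Φ t ≠ ∞) :
    @Dense _ (weakStarTopology Φ ω) (gsSet Φ ω) := by
  let := weakStarTopology Φ ω
  rw [dense_iff_inter_open]
  rintro O hO ⟨u, hu⟩
  obtain ⟨O', hO', rfl⟩ := isOpen_induced_iff.1 hO
  obtain ⟨I, s, hs, hsub⟩ := isOpen_pi_iff.1 hO' _ hu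
  obtain ⟨f, hf⟩ := (toDistribution Φ ω u).exists_ofGS_eq_on_finset I
  refine ⟨⟨GSDistribution.ofGS f, ofGS_mem hΦ f⟩, hsub fun φ hφ => ?_, f, rfl⟩
  change GSDistribution.ofGS f φ ∈ s φ
  rw [hf φ hφ]
  exact (hs φ hφ).2

theorem t2Space_weakStar : @T2Space (OrliczModulationSpace Φ ω) (weakStarTopology Φ ω) := by
  let := weakStarTopology Φ ω
  have hinj : Function.Injective fun (u : OrliczModulationSpace Φ ω) (φ : GelfandShilov ι) =>
      toDistribution Φ ω u φ := fun u v huv =>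
    toDistribution_injective (ContinuousLinearMap.ext fun φ => congr_fun huv φ)
  exact T2Space.of_injective_continuous hinj continuous_induced_dom

theorem eq_of_continuous_weakStar (hΦ : ∃ t : ℝ≥0∞, 0 < t ∧ Φ t ≠ ∞)
    {L : EuclideanSpace ℝ ι ≃L[ℝ] EuclideanSpace ℝ ι}
    {S T : OrliczModulationSpace Φ ω → OrliczModulationSpace Φ ω'} (hS : ExtendsPullback L S)
    (hT : ExtendsPullback L T)
    (hSc : Continuous[weakStarTopology Φ ω, weakStarTopology Φ ω'] S)
    (hTc : Continuous[weakStarTopology Φ ω, weakStarTopology Φ ω'] T) : S = T := by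
  let := weakStarTopology Φ ω
  let := weakStarTopology Φ ω'
  have := t2Space_weakStar (Φ := Φ) (ω := ω')
  exact hSc.ext_on (dense_gsSet_weakStar hΦ) hTc (hS.eqOn hT)

end OrliczModulationSpace

end WeakStar

/-! ### The Luxemburg norm separates continuous functions -/

section Separation

theorem orliczNorm_pos {E : Type*} [MeasureSpace E] {Φ : YoungFunction} {ω : E → ℝ} {F : E → ℂ}
    {s : Set E} (hs : MeasurableSet s) (hs0 : volume s ≠ 0) {κ : ℝ} (hκ : 0 < κ)
    (hF : ∀ z ∈ s, κ ≤ ‖F z‖ * ω z) (hne : (orliczSet Φ ω F).Nonempty) :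
    0 < orliczNorm Φ ω F := by
  obtain ⟨t, ht⟩ := (Φ.tendsto'.eventually
    (lt_mem_nhds (ENNReal.inv_ne_top.2 hs0).lt_top)).exists_forall_of_atTop
  refine (show 0 < κ / (t + 1) by positivity).trans_le (le_csInf hne fun r ⟨hr0, hr⟩ => ?_)
  by_contra! hlt
  have hmarkov : Φ (ENNReal.ofReal (κ / r)) ≤ (volume s)⁻¹ := by
    rw [ENNReal.le_inv_iff_mul_le, ← setLIntegral_const]
    refine (setLIntegral_mono' hs fun z hz => Φ.mono (ENNReal.ofReal_le_ofReal ?_)).trans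
      ((setLIntegral_le_lintegral _ _).trans hr)
    gcongr
    exact hF z hz
  refine (ht (κ / r).toNNReal ?_).not_ge hmarkov
  rw [← NNReal.coe_le_coe, Real.coe_toNNReal _ (by positivity), le_div_iff₀ hr0]
  rw [lt_div_iff₀ (by positivity)] at hlt
  nlinarith

theorem eq_zero_of_orliczNorm_eq_zero {V : Type*} [NormedAddCommGroup V] [NormedSpace ℝ V]
    [FiniteDimensional ℝ V] [MeasureSpace V] [BorelSpace V]
    [(volume : Measure V).IsAddHaarMeasure] {Φ : YoungFunction} {ω : ModerateWeight V} {F : V → ℂ}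
    (hF : Continuous F) (hne : (orliczSet Φ ω F).Nonempty) (h0 : orliczNorm Φ ω F = 0) :
    F = 0 := by
  funext z₀
  by_contra hz₀
  obtain ⟨B, r, hB, hr, hω⟩ := ω.exists_le_mul_exp_sub
  have hnorm : 0 < ‖F z₀‖ := norm_pos_iff.2 hz₀
  have hω₀ : 0 < ω z₀ := ω.pos z₀
  have hopen : IsOpen {z | ‖F z₀‖ / 2 < ‖F z‖} := isOpen_lt continuous_const hF.norm
  obtain ⟨ρ, hρ, hball⟩ := Metric.isOpen_iff.1 hopen z₀ (half_lt_self hnorm)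
  have hlower : ∀ z ∈ Metric.ball z₀ ρ,
      ‖F z₀‖ / 2 * (ω z₀ / (B * Real.exp (r * ρ))) ≤ ‖F z‖ * ω z := fun z hz => by
    have hωz : 0 < ω z := ω.pos z
    have hweight : ω z₀ / (B * Real.exp (r * ρ)) ≤ ω z := by
      rw [div_le_iff₀' (by positivity)]
      rw [mem_ball_iff_norm] at hz
      exact (hω z₀ z).trans (by gcongr)
    exact mul_le_mul (hball hz).le hweight (by positivity) (norm_nonneg _)
  exact (orliczNorm_pos measurableSet_ball (Metric.measure_ball_pos volume z₀ hρ).ne'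
    (by positivity) hlower hne).ne' h0

variable {ι : Type*} [Fintype ι]

instance OrliczModulationSpace.instT2Space (Φ : YoungFunction)
    (ω : ModerateWeight (PhaseSpace ι)) : T2Space (OrliczModulationSpace Φ ω) := by
  have : T0Space (OrliczModulationSpace Φ ω) := ⟨fun u v huv => by
    rw [Metric.inseparable_iff, dist_eq_norm, norm_def] at huv
    have hstft : stft (toDistribution Φ ω (u - v)) = 0 :=
      eq_zero_of_orliczNorm_eq_zero (continuous_stft _) (u - v).2.2 huv
    refine sub_eq_zero.1 (toDistribution_injective (ContinuousLinearMap.ext fun φ => ?_))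
    rw [apply_eq_integral_stft, hstft, map_zero]
    simp⟩
  infer_instance

end Separation

/-! ### Norm density of the test functions -/

section Tails

open Bornology

namespace YoungFunction

variable {Φ : YoungFunction}

theorem map_two_pow_mul_le {r C : ℝ≥0} (hC : ∀ t : ℝ≥0∞, t ≤ r → Φ (2 * t) ≤ C * Φ t) (k : ℕ)
    {t : ℝ≥0∞} (ht : 2 ^ k * t ≤ r) : Φ (2 ^ k * t) ≤ C ^ k * Φ t := by
  induction k with
  | zero => simp
  | succ k ih =>
    have hk : 2 ^ k * t ≤ r := by
      refine le_trans ?_ ht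
      gcongr
      · norm_num
      · omega
    rw [pow_succ', mul_assoc, pow_succ', mul_assoc]
    exact (hC _ hk).trans (by gcongr; exact ih hk)

theorem LocalDelta2.exists_map_mul_le (hΔ : Φ.LocalDelta2) (a : ℝ≥0) :
    ∃ ε : ℝ≥0∞, 0 < ε ∧ ∃ C : ℝ≥0, ∀ t < ε, Φ (a * t) ≤ C * Φ t := by
  obtain ⟨r, hr, C, hC⟩ := hΔ
  obtain ⟨k, hk⟩ := pow_unbounded_of_one_lt a (one_lt_two (α := ℝ≥0))
  refine ⟨r / 2 ^ k, ENNReal.div_pos (by exact_mod_cast hr.ne') (by finiteness), C ^ k,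
    fun t ht => ?_⟩
  have hak : (a : ℝ≥0∞) ≤ 2 ^ k := by exact_mod_cast hk.le
  have ht' : 2 ^ k * t ≤ r := by
    rw [mul_comm]
    exact ENNReal.mul_le_of_le_div ht.le
  push_cast
  exact (Φ.mono (by gcongr)).trans (map_two_pow_mul_le hC k ht')

theorem tendsto_zero_of_tendsto_map_zero (hpos : ∀ t : ℝ≥0∞, 0 < t → 0 < Φ t) {α : Type*}
    {l : Filter α} {g : α → ℝ≥0∞} (hg : Tendsto (fun a => Φ (g a)) l (𝓝 0)) :
    Tendsto g l (𝓝 0) :=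
  ENNReal.tendsto_nhds_zero.2 fun ε hε =>
    (hg.eventually (gt_mem_nhds (hpos ε hε))).mono fun _ ha => (Φ.mono.reflect_lt ha).le

end YoungFunction

section General

theorem tendsto_expKernel_sub_cobounded {V : Type*} [NormedAddCommGroup V]
    (z : V) :
    Tendsto (fun w => expKernel (z - w)) (cobounded V) (𝓝 0) := by
  have hexp := ENNReal.tendsto_ofReal (Real.tendsto_exp_neg_atTop_nhds_zero.comp
    (tendsto_norm_cobounded_atTop.comp (tendsto_const_sub_cobounded z)))
  rwa [ENNReal.ofReal_zero] at hexp

variable {V : Type*} [NormedAddCommGroup V] [MeasureSpace V] [BorelSpace V]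

theorem tendsto_setLIntegral_compl_closedBall [CompleteSpace V] [SecondCountableTopology V]
    {g : V → ℝ≥0∞} (hg : ∫⁻ z, g z ≠ ∞) :
    Tendsto (fun R : ℝ => ∫⁻ z in (Metric.closedBall 0 R)ᶜ, g z) atTop (𝓝 0) := by
  have := isFiniteMeasure_withDensity hg
  have htight := tendsto_measure_compl_closedBall_of_isTightMeasureSet
    (isTightMeasureSet_singleton (μ := volume.withDensity g)) 0
  simpa only [iSup_singleton, mem_singleton_iff, iSup_iSup_eq_left,
    withDensity_apply g Metric.isClosed_closedBall.measurableSet.compl] using htight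

theorem exists_mem_orliczSet_indicator_compl_closedBall [CompleteSpace V]
    [SecondCountableTopology V] {Φ : YoungFunction} (hΔ : Φ.LocalDelta2) {ω : V → ℝ} {F : V → ℂ}
    {r₀ : ℝ} (hr₀ : r₀ ∈ orliczSet Φ ω F)
    (hF : Tendsto (fun z => ENNReal.ofReal (‖F z‖ * ω z / r₀)) (cobounded V) (𝓝 0)) {r : ℝ}
    (hr : 0 < r) : ∃ R : ℝ, r ∈ orliczSet Φ ω ((Metric.closedBall 0 R)ᶜ.indicator F) := by
  obtain ⟨hr₀_pos, hr₀_int⟩ := hr₀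
  obtain ⟨ε, hε, C, hC⟩ := hΔ.exists_map_mul_le (r₀ / r).toNNReal
  have hscale (z : V) : ENNReal.ofReal (‖F z‖ * ω z / r) =
      (r₀ / r).toNNReal * ENNReal.ofReal (‖F z‖ * ω z / r₀) := by
    rw [← ENNReal.ofReal, ← ENNReal.ofReal_mul (by positivity)]
    congr 1
    field_simp
  have htail : Tendsto (fun R : ℝ => C * ∫⁻ z in (Metric.closedBall 0 R)ᶜ,
      Φ (ENNReal.ofReal (‖F z‖ * ω z / r₀))) atTop (𝓝 0) := by
    simpa only [mul_zero] using ENNReal.Tendsto.const_mul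
      (tendsto_setLIntegral_compl_closedBall (ne_top_of_le_ne_top ENNReal.one_ne_top hr₀_int))
      (Or.inr ENNReal.coe_ne_top)
  have hsmall : ∀ᶠ R : ℝ in atTop, ∀ z ∈ (Metric.closedBall (0 : V) R)ᶜ,
      ENNReal.ofReal (‖F z‖ * ω z / r₀) < ε :=
    ((Metric.hasAntitoneBasis_cobounded_compl_closedBall 0).eventually_subset
      (hF.eventually (gt_mem_nhds hε)))
  obtain ⟨R, hR_tail, hR_small⟩ := ((htail.eventually (gt_mem_nhds one_pos)).and hsmall).exists
  have hmeas : MeasurableSet (Metric.closedBall (0 : V) R)ᶜ :=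
    Metric.isClosed_closedBall.measurableSet.compl
  refine ⟨R, hr, le_trans ?_ hR_tail.le⟩
  rw [← lintegral_const_mul' _ _ ENNReal.coe_ne_top, ← lintegral_indicator hmeas]
  refine lintegral_mono fun z => ?_
  by_cases hz : z ∈ (Metric.closedBall (0 : V) R)ᶜ
  · rw [indicator_of_mem hz, indicator_of_mem hz, hscale]
    exact hC _ (hR_small z hz)
  · simp [indicator_of_notMem hz, Φ.map_zero']

variable [(volume : Measure V).IsAddHaarMeasure]

theorem tendsto_lintegral_expMeasure_cobounded {g : V → ℝ≥0∞} (hg : AEMeasurable g)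
    (hfin : ∫⁻ z, g z ≠ ∞) :
    Tendsto (fun w => ∫⁻ z, g z ∂expMeasure w) (cobounded V) (𝓝 0) := by
  have hconv : Tendsto (fun w => ∫⁻ z, g z * expKernel (z - w)) (cobounded V)
      (𝓝 (∫⁻ _ : V, 0)) := by
    have : (cobounded V).IsCountablyGenerated := by
      rw [← comap_norm_atTop]
      infer_instance
    refine tendsto_lintegral_filter_of_dominated_convergence' g
      (Eventually.of_forall fun w => hg.mul ?_)
      (Eventually.of_forall fun w => Eventually.of_forall fun z => mul_le_of_le_one_right' ?_)
      hfin ?_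
    · exact (continuous_expKernel.comp (continuous_sub_right w)).measurable.aemeasurable
    · simp [expKernel]
    · filter_upwards [ae_lt_top' hg hfin] with z hz
      simpa only [mul_zero] using
        ENNReal.Tendsto.const_mul (tendsto_expKernel_sub_cobounded z) (Or.inr hz.ne)
  simpa only [lintegral_expMeasure hg, lintegral_zero, mul_zero] using
    ENNReal.Tendsto.const_mul hconv (Or.inr (ENNReal.inv_ne_top.2 expMass_ne_zero))

theorem YoungFunction.tendsto_ofReal_cobounded_of_le_lintegral_expKernel [NormedSpace ℝ V]
    [FiniteDimensional ℝ V] {Φ : YoungFunction} (hpos : ∀ t : ℝ≥0∞, 0 < t → 0 < Φ t)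
    {G : V → ℝ≥0∞} (hG : AEMeasurable G) (hfin : ∫⁻ z, Φ (G z) ≠ ∞) {H : V → ℝ}
    (hH : ∀ w, ENNReal.ofReal (H w) ≤ ∫⁻ z, G z * expKernel (z - w)) :
    Tendsto (fun w => ENNReal.ofReal (H w)) (cobounded V) (𝓝 0) := by
  have hmass : 0 < (expMass V).toReal := ENNReal.toReal_pos expMass_ne_zero expMass_ne_top
  have hjensen (w : V) : Φ (ENNReal.ofReal (H w / (2 * (expMass V).toReal))) ≤
      ∫⁻ z, Φ (G z) ∂expMeasure w := by
    simpa using Φ.map_le_mul_lintegral_expMeasure hG le_rfl (hH w)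
  have hscaled : Tendsto (fun w => ENNReal.ofReal (H w / (2 * (expMass V).toReal)))
      (cobounded V) (𝓝 0) :=
    tendsto_zero_of_tendsto_map_zero hpos (tendsto_of_tendsto_of_tendsto_of_le_of_le
      tendsto_const_nhds (tendsto_lintegral_expMeasure_cobounded
        (Φ.measurable.comp_aemeasurable hG) hfin) (fun _ => zero_le) hjensen)
  have hunscaled := ENNReal.Tendsto.const_mul (a := ENNReal.ofReal (2 * (expMass V).toReal))
    hscaled (Or.inr ENNReal.ofReal_ne_top)
  rw [mul_zero] at hunscaled
  refine hunscaled.congr fun w => ?_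
  rw [← ENNReal.ofReal_mul (by positivity), mul_div_cancel₀ _ (by positivity)]

end General

variable {ι : Type*} [Fintype ι]

theorem packetComp_refl (w : PhaseSpace ι) :
    packetComp (ContinuousLinearEquiv.refl ℝ (EuclideanSpace ℝ ι)) w = gaussianPacket w.1 w.2 :=
  Subtype.ext rfl

theorem stft_eq_integral (u : GSDistribution ι) (w : PhaseSpace ι) :
    stft u w = stftConst ι * ∫ z,
      pullbackKernel (ContinuousLinearEquiv.refl ℝ (EuclideanSpace ℝ ι)) w z * stft u z := by
  rw [← apply_packetComp, packetComp_refl, stft_eq]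

theorem tendsto_weighted_stft_cobounded {Φ : YoungFunction}
    (hpos : ∀ t : ℝ≥0∞, 0 < t → 0 < Φ t) {ω : ModerateWeight (PhaseSpace ι)}
    {u : GSDistribution ι} {r : ℝ} (hr : r ∈ orliczSet Φ ω (stft u)) :
    Tendsto (fun w => ENNReal.ofReal (‖stft u w‖ * ω w / r)) (cobounded (PhaseSpace ι))
      (𝓝 0) := by
  obtain ⟨A, hA, hAU⟩ := exists_ofReal_norm_integral_pullbackKernel_le (ω := ω) (ω' := ω)
    (L := .refl ℝ (EuclideanSpace ℝ ι)) (M := .refl ℝ _) (fun _ _ => rfl) (fun _ => rfl)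
  have hc : 0 < stftConst ι := stftConst_pos
  have hmeas : AEMeasurable fun z => ENNReal.ofReal (‖stft u z‖ * ω z / r) :=
    (((continuous_stft u).norm.aemeasurable.mul ω.aemeasurable).div_const r).ennreal_ofReal
  have hlim := Φ.tendsto_ofReal_cobounded_of_le_lintegral_expKernel hpos hmeas
    (ne_top_of_le_ne_top ENNReal.one_ne_top hr.2) fun w => hAU (stft u) w r hr.1
  have hscaled := ENNReal.Tendsto.const_mul (a := ENNReal.ofReal (stftConst ι * A)) hlim
    (Or.inr ENNReal.ofReal_ne_top)
  rw [mul_zero] at hscaled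
  refine hscaled.congr fun w => ?_
  rw [← ENNReal.ofReal_mul (by positivity), stft_eq_integral u w, norm_mul, Complex.norm_real,
    Real.norm_of_nonneg hc.le]
  congr 1
  field_simp

theorem exists_stft_sub_ofGS_eq_integral_indicator_compl (u : GSDistribution ι)
    {K : Set (PhaseSpace ι)} (hK : IsCompact K) : ∃ f : GelfandShilov ι,
    stft (u - GSDistribution.ofGS f) = fun w => stftConst ι * ∫ z,
      pullbackKernel (ContinuousLinearEquiv.refl ℝ (EuclideanSpace ℝ ι)) w z *
        Kᶜ.indicator (stft u) z := by
  have hpacket : Continuous fun z : PhaseSpace ι =>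
      (stftConst ι * stft u z) • gaussianPacket z.1 (-z.2) :=
    (continuous_const.mul (continuous_stft u)).smul continuous_gaussianPacket_neg_snd
  obtain ⟨f, -, hf⟩ := GelfandShilov.exists_eq_integral (μ := volume.restrict K) hpacket
    fun h hh =>
      ((GelfandShilov.continuous_gsNorm hh).comp hpacket).continuousOn.integrableOn_compact hK
  refine ⟨f, funext fun w => ?_⟩
  have hofGS : GSDistribution.ofGS f (gaussianPacket w.1 w.2) =
      ∫ z in K, pullbackKernel (.refl ℝ _) w z * stft u z := by
    rw [GSDistribution.ofGS_comm, hf]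
    congr 1
    funext z
    rw [map_smul, smul_eq_mul, pullbackKernel, packetComp_refl, stft_eq (GSDistribution.ofGS _)]
    ring
  have hu : u (gaussianPacket w.1 w.2) = ∫ z, pullbackKernel (.refl ℝ _) w z * stft u z := by
    rw [← packetComp_refl, apply_packetComp]
  simp only [← indicator_mul_right]
  rw [integral_indicator hK.measurableSet.compl,
    setIntegral_compl hK.measurableSet (integrable_pullbackKernel_mul _ u w), stft_eq,
    sub_apply, hofGS, hu]

namespace OrliczModulationSpace

variable {Φ : YoungFunction} {ω ω' : ModerateWeight (PhaseSpace ι)}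

theorem dense_gsSet (hΦ : ∃ t : ℝ≥0∞, 0 < t ∧ Φ t ≠ ∞) (hΔ : Φ.LocalDelta2)
    (hpos : ∀ t : ℝ≥0∞, 0 < t → 0 < Φ t) : Dense (gsSet Φ ω) := by
  obtain ⟨C, hC, hCU⟩ := exists_mul_mem_orliczSet_integral_pullbackKernel (ω := ω) (ω' := ω)
    (L := .refl ℝ (EuclideanSpace ℝ ι)) (M := .refl ℝ _) (fun _ _ => rfl) (fun _ => rfl)
  have hc : 0 < stftConst ι := stftConst_pos
  intro u
  rw [Metric.mem_closure_iff]
  intro ε hε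
  obtain ⟨r₀, hr₀⟩ := u.2.2
  obtain ⟨R, hR⟩ := exists_mem_orliczSet_indicator_compl_closedBall hΔ hr₀
    (tendsto_weighted_stft_cobounded hpos hr₀) (r := ε / 2 / (stftConst ι * C)) (by positivity)
  obtain ⟨f, hf⟩ := exists_stft_sub_ofGS_eq_integral_indicator_compl (toDistribution Φ ω u)
    (isCompact_closedBall 0 R)
  let v : OrliczModulationSpace Φ ω := ⟨GSDistribution.ofGS f, ofGS_mem hΦ f⟩
  have hv : toDistribution Φ ω (u - v) = toDistribution Φ ω u - GSDistribution.ofGS f := rfl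
  have htail_meas : AEStronglyMeasurable ((Metric.closedBall (0 : PhaseSpace ι) R)ᶜ.indicator
      (stft (toDistribution Φ ω u))) :=
    (continuous_stft _).aestronglyMeasurable.indicator
      Metric.isClosed_closedBall.measurableSet.compl
  have hmem := mul_mem_orliczSet Φ ω _ (c := (stftConst ι : ℂ)) (by exact_mod_cast hc.ne')
    (hCU Φ _ htail_meas _ hR)
  rw [← hf, ← hv, Complex.norm_real, Real.norm_of_nonneg hc.le] at hmem
  refine ⟨v, ⟨f, rfl⟩, ?_⟩
  rw [dist_eq_norm, norm_def]
  calc orliczNorm Φ ω (stft (toDistribution Φ ω (u - v)))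
      ≤ stftConst ι * (C * (ε / 2 / (stftConst ι * C))) :=
        csInf_le (orliczSet_bddBelow _ _ _) hmem
    _ = ε / 2 := by field_simp
    _ < ε := half_lt_self hε

theorem eq_of_continuous (hΦ : ∃ t : ℝ≥0∞, 0 < t ∧ Φ t ≠ ∞) (hΔ : Φ.LocalDelta2)
    (hpos : ∀ t : ℝ≥0∞, 0 < t → 0 < Φ t) {L : EuclideanSpace ℝ ι ≃L[ℝ] EuclideanSpace ℝ ι}
    {S T : OrliczModulationSpace Φ ω → OrliczModulationSpace Φ ω'} (hS : ExtendsPullback L S)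
    (hT : ExtendsPullback L T) (hSc : Continuous S) (hTc : Continuous T) : S = T :=
  hSc.ext_on (dense_gsSet hΦ hΔ hpos) hTc (hS.eqOn hT)

end OrliczModulationSpace

end Tails

/-! ### The shear and its contragredient -/

section ShearDual

variable {d : ℕ}

theorem inner_pair (x y ξ η : EuclideanSpace ℝ (Fin d)) :
    inner ℝ (pair x y) (pair ξ η) = inner ℝ x ξ + inner ℝ y η := by
  simp [pair, PiLp.inner_apply]

theorem inner_act (A : Matrix (Fin d) (Fin d) ℝ) (x y : EuclideanSpace ℝ (Fin d)) :
    inner ℝ (act A x) y = inner ℝ x (act A.transpose y) := by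
  rw [act, act, ← Matrix.conjTranspose_eq_transpose_of_trivial,
    Matrix.toEuclideanLin_conjTranspose_eq_adjoint, LinearMap.adjoint_inner_right]

/-- The map `(ξ, η) ↦ (ξ + A^*(ξ + η), η - A^*(ξ + η))`, the inverse transpose of `T_A`. -/
def shearDual (A : Matrix (Fin d) (Fin d) ℝ) :
    EuclideanSpace ℝ (Fin d ⊕ Fin d) ≃L[ℝ] EuclideanSpace ℝ (Fin d ⊕ Fin d) :=
  LinearEquiv.toContinuousLinearEquiv
    { toFun := fun z => pair (fstPart z + act A.transpose (fstPart z + sndPart z))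
        (sndPart z - act A.transpose (fstPart z + sndPart z))
      invFun := fun z => pair (fstPart z - act A.transpose (fstPart z + sndPart z))
        (sndPart z + act A.transpose (fstPart z + sndPart z))
      map_add' := fun z w => by
        rw [← pair_add]
        simp only [fstPart_add, sndPart_add, act, map_add]
        congr 1 <;> abel
      map_smul' := fun c z => by
        rw [RingHom.id_apply, ← pair_smul]
        simp only [fstPart_smul, sndPart_smul, act, ← smul_add, map_smul, smul_sub]
      left_inv := fun z => by
        simp only [fstPart_pair, sndPart_pair, add_add_sub_cancel, add_sub_cancel_right,
          sub_add_cancel, pair_fstPart_sndPart]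
      right_inv := fun z => by
        simp only [fstPart_pair, sndPart_pair, sub_add_add_cancel, add_sub_cancel_right,
          sub_add_cancel, pair_fstPart_sndPart] }

theorem shearDual_pair (A : Matrix (Fin d) (Fin d) ℝ) (ξ η : EuclideanSpace ℝ (Fin d)) :
    shearDual A (pair ξ η) =
      pair (ξ + act A.transpose (ξ + η)) (η - act A.transpose (ξ + η)) := rfl

theorem inner_shear_pair_shearDual_pair (A : Matrix (Fin d) (Fin d) ℝ)
    (x y ξ η : EuclideanSpace ℝ (Fin d)) :
    inner ℝ (shear A (pair x y)) (shearDual A (pair ξ η)) = inner ℝ (pair x y) (pair ξ η) := by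
  have hadj := inner_act A (x - y) (ξ + η)
  rw [shear_pair, shearDual_pair, inner_pair, inner_pair]
  simp only [inner_sub_left, inner_add_right, inner_sub_right] at hadj ⊢
  linarith

theorem inner_shear_shearDual (A : Matrix (Fin d) (Fin d) ℝ)
    (z ζ : EuclideanSpace ℝ (Fin d ⊕ Fin d)) :
    inner ℝ (shear A z) (shearDual A ζ) = inner ℝ z ζ := by
  simpa only [pair_fstPart_sndPart] using
    inner_shear_pair_shearDual_pair A (fstPart z) (sndPart z) (fstPart ζ) (sndPart ζ)

end ShearDual

end OrliczModulation

end

theorem mainTheorem9_general {ι : Type*} [Fintype ι]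
    {L M : EuclideanSpace ℝ ι ≃L[ℝ] EuclideanSpace ℝ ι}
    (hLM : ∀ y ξ, inner ℝ (L y) (M ξ) = inner ℝ y ξ) {Φ : YoungFunction}
    (hΦ : ∃ t : ℝ≥0∞, 0 < t ∧ Φ t ≠ ∞)
    {ω ω' : ModerateWeight (EuclideanSpace ℝ ι × EuclideanSpace ℝ ι)}
    (hω : ∀ w, ω' w = ω (L.prodCongr M w)) :
    (∀ f : GelfandShilov ι,
      GSDistribution.ofGS f ∈ modulationSubmodule Φ ω ∧
        GSDistribution.ofGS f ∈ modulationSubmodule Φ ω') ∧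
    ∃ T : OrliczModulationSpace Φ ω ≃L[ℂ] OrliczModulationSpace Φ ω',
      ExtendsPullback L T ∧
      (∀ u : OrliczModulationSpace Φ ω,
        toDistribution Φ ω' (T u) = GSDistribution.pullback L (toDistribution Φ ω u)) ∧
      Continuous[weakStarTopology Φ ω, weakStarTopology Φ ω'] T ∧
      (∀ S : OrliczModulationSpace Φ ω → OrliczModulationSpace Φ ω',
        ExtendsPullback L S →
          Continuous[weakStarTopology Φ ω, weakStarTopology Φ ω'] S → S = T) ∧
      (Φ.LocalDelta2 → (∀ t : ℝ≥0∞, 0 < t → 0 < Φ t) →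
        ∀ S : OrliczModulationSpace Φ ω → OrliczModulationSpace Φ ω',
          ExtendsPullback L S → Continuous S → S = T) := by
  obtain ⟨T, hT⟩ := exists_pullbackEquiv (Φ := Φ) hLM hω
  have hext : ExtendsPullback L T := fun f u hu => by rw [hT, hu, GSDistribution.pullback_ofGS]
  have hweak : Continuous[weakStarTopology Φ ω, weakStarTopology Φ ω'] T :=
    continuous_weakStar_of_pullback hT
  exact ⟨fun f => ⟨ofGS_mem hΦ f, ofGS_mem hΦ f⟩, T, hext, hT, hweak,
    fun S hS hSc => eq_of_continuous_weakStar hΦ hS hext hSc hweak,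
    fun hΔ hpos S hS hSc => eq_of_continuous hΦ hΔ hpos hS hext hSc T.continuous⟩

theorem mainTheorem9 (d : ℕ) (A : Matrix (Fin d) (Fin d) ℝ) (Φ : YoungFunction)
    (hΦ : ∃ t : ℝ≥0∞, 0 < t ∧ Φ t ≠ ∞)
    (ω₀ ωA : ModerateWeight
      (EuclideanSpace ℝ (Fin d ⊕ Fin d) × EuclideanSpace ℝ (Fin d ⊕ Fin d)))
    (hω : ∀ x y ξ η : EuclideanSpace ℝ (Fin d),
      ωA (pair x y, pair ξ η) =
        ω₀ (pair (x - act A (x - y)) (y - act A (x - y)),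
          pair (ξ + act A.transpose (ξ + η)) (η - act A.transpose (ξ + η)))) :
    (∀ f : GelfandShilov (Fin d ⊕ Fin d),
      GSDistribution.ofGS f ∈ modulationSubmodule Φ ω₀ ∧
        GSDistribution.ofGS f ∈ modulationSubmodule Φ ωA) ∧
    ∃ T : OrliczModulationSpace Φ ω₀ ≃L[ℂ] OrliczModulationSpace Φ ωA,
      ExtendsPullback (shear A) T ∧
      (∀ u : OrliczModulationSpace Φ ω₀,
        toDistribution Φ ωA (T u) =
          GSDistribution.pullback (shear A) (toDistribution Φ ω₀ u)) ∧
      Continuous[weakStarTopology Φ ω₀, weakStarTopology Φ ωA] T ∧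
      (∀ S : OrliczModulationSpace Φ ω₀ → OrliczModulationSpace Φ ωA,
        ExtendsPullback (shear A) S →
          Continuous[weakStarTopology Φ ω₀, weakStarTopology Φ ωA] S → S = T) ∧
      (Φ.LocalDelta2 → (∀ t : ℝ≥0∞, 0 < t → 0 < Φ t) →
        ∀ S : OrliczModulationSpace Φ ω₀ → OrliczModulationSpace Φ ωA,
          ExtendsPullback (shear A) S → Continuous S → S = T) := by
  refine mainTheorem9_general (inner_shear_shearDual A) hΦ fun w => ?_
  simpa only [pair_fstPart_sndPart] using!
    hω (fstPart w.1) (sndPart w.1) (fstPart w.2) (sndPart w.2)
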